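/- Let $N\ge 1$ be an integer, $p,q>0$, and $$0<\beta<\frac m2,\qquad m>\frac{2N+1}{N+1}.$$ Let $K\in C(\mathbb R^N\setminus\{0\})$, $K>0$, satisfy $\liminf_{x\to0}K(x)>0$ and, for some constants $c,\rho>0$, $K(x)\ge c|x|^{-\beta}$ whenever $|x|>\rho$; put $(K*u^p)(x,t)=\int_{\mathbb R^N}K(x-y)u^p(y,t)\,dy\in[0,\infty]$. Let $\mathcal A:\mathbb R^N\times\mathbb R\times\mathbb R^N\to\mathbb R^N$ be a Carathéodory function such that, for some $c_0>0$ and with $m'=m/(m-1)$, $$\mathcal A(x,z,0)=0,\qquad \mathcal A(x,z,\xi)\cdot\xi\ge0,\qquad \mathcal A(x,z,\xi)\cdot\xi\ge c_0|\mathcal A(x,z,\xi)|^{m'}\qquad\text{for all }(x,z,\xi)\in\mathbb R^N\times[0,\infty)\times\mathbb R^N$$ (that is, $L_{\mathcal A}u=\operatorname{div}\mathcal A(x,u,\nabla u)$ is weakly $m$-coercive). Let $u_0\in L^1_{loc}(\mathbb R^N)$, $u_0\ge0$. A nonnegative weak solution of $$u_t-L_{\mathcal A}u\ge (K*u^p)u^q\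 \text{ in }\mathbb R^N\times(0,\infty),\qquad u(\cdot,0)=u_0,\tag{1}$$ in the class $\mathcal S$ is a function $u\in W^{1,m}_{loc}(\mathbb R^N\times(0,\infty))$, $u\ge0$ a.e., with $\mathcal A(x,u,\nabla u)\in [L^{m'}_{loc}(\mathbb R^N\times(0,\infty))]^N$ and $(K*u^p)u^q\in L^1_{loc}(\mathbb R^N\times(0,\infty))$, which satisfies the inequality in one of the following two forms for every nonnegative $\varphi\in C^1_c(\mathbb R^N\times\mathbb R)$, where the integrals on the right-hand side are required to converge absolutely: either $$\int_0^\infty\!\!\int_{\mathbb R^N}(K*u^p)u^q\varphi\,dx\,dt\le\int_0^\infty\!\!\int_{\mathbb R^N}u_t\,\varphi\,dx\,dt+\int_0^\infty\!\!\int_{\mathbb R^N}\mathcal A(x,u,\nabla u)\cdot\nabla\varphi\,dx\,dt$$ and $u$ has initial trace $u_0$ (i.e. $\int u(x,t)\chi(x)\,dx\to\int u_0\chi\,dx$ as $t\to0^+$ outside a null set of times, for every $\chi\in C_c(\mathbb R^N)$), or $$\int_0^\infty\!\!\int_{\mathbb R^N}(K*u^p)u^q\varphi\,dx\,dt\le-\int_{\mathbb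 R^N}u_0(x)\varphi(x,0)\,dx-\int_0^\infty\!\!\int_{\mathbb R^N}u\,\varphi_t\,dx\,dt+\int_0^\infty\!\!\int_{\mathbb R^N}\mathcal A(x,u,\nabla u)\cdot\nabla\varphi\,dx\,dt.$$ If $$2\max\{1,m-1\}<p+q\le m-1+\frac{N-\beta+m}{N+\beta},$$ then (1) has no nonnegative weak solution $u\in\mathcal S$ other than $u=0$ a.e. in $\mathbb R^N\times(0,\infty)$. -/

import Mathlib

open MeasureTheory Filter Topology Set
open scoped ENNReal

noncomputable section

namespace QuasilinearNonlocal

/-- Euclidean space `ℝ^N`. -/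
abbrev E (N : ℕ) := EuclideanSpace ℝ (Fin N)

/-- The open half-space `ℝ^N × (0,∞)`. -/
def halfSpace (N : ℕ) : Set (E N × ℝ) := {z | 0 < z.2}

/-- The spatial gradient `∇φ` of a function on `ℝ^N × ℝ`. -/
def spatialGrad {N : ℕ} (φ : E N × ℝ → ℝ) (z : E N × ℝ) : E N :=
  gradient (fun x : E N => φ (x, z.2)) z.1

/-- The time derivative `φ_t` of a function on `ℝ^N × ℝ`. -/
def timeDeriv {N : ℕ} (φ : E N × ℝ → ℝ) (z : E N × ℝ) : ℝ :=
  deriv (fun t : ℝ => φ (z.1, t)) z.2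

/-- `f ∈ L^r_loc(ℝ^N × (0,∞))`. -/
def MemLpLoc {N : ℕ} {F : Type*} [NormedAddCommGroup F] (f : E N × ℝ → F) (r : ℝ) : Prop :=
  ∀ C : Set (E N × ℝ), IsCompact C → C ⊆ halfSpace N →
    MemLp f (ENNReal.ofReal r) (volume.restrict C)

/-- `ut` is the weak time derivative of `u` in `ℝ^N × (0,∞)`. -/
def IsWeakTimeDeriv {N : ℕ} (u ut : E N × ℝ → ℝ) : Prop :=
  ∀ φ : E N × ℝ → ℝ, ContDiff ℝ 1 φ → HasCompactSupport φ → tsupport φ ⊆ halfSpace N →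
    ∫ z in halfSpace N, u z * timeDeriv φ z = - ∫ z in halfSpace N, ut z * φ z

/-- `Du` is the weak spatial gradient of `u` in `ℝ^N × (0,∞)`. -/
def IsWeakSpatialGrad {N : ℕ} (u : E N × ℝ → ℝ) (Du : E N × ℝ → E N) : Prop :=
  ∀ φ : E N × ℝ → ℝ, ContDiff ℝ 1 φ → HasCompactSupport φ → tsupport φ ⊆ halfSpace N →
    ∫ z in halfSpace N, u z • spatialGrad φ z = - ∫ z in halfSpace N, φ z • Du z

/-- `u ∈ W^{1,m}_loc(ℝ^N × (0,∞))`, with weak time derivative `ut` and weak spatial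
gradient `Du`. -/
structure IsSobolevLoc {N : ℕ} (m : ℝ) (u ut : E N × ℝ → ℝ) (Du : E N × ℝ → E N) : Prop where
  memLp : MemLpLoc u m
  memLp_time : MemLpLoc ut m
  memLp_grad : MemLpLoc Du m
  weak_time : IsWeakTimeDeriv u ut
  weak_grad : IsWeakSpatialGrad u Du

/-- `𝒜 : ℝ^N × ℝ × ℝ^N → ℝ^N` is a Carathéodory function. -/
structure IsCaratheodory {N : ℕ} (A : E N → ℝ → E N → E N) : Prop where
  measurable : ∀ (z : ℝ) (ξ : E N), AEMeasurable (fun x => A x z ξ) volume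
  continuous : ∀ᵐ x ∂(volume : Measure (E N)), Continuous (fun w : ℝ × E N => A x w.1 w.2)

/-- The structural assumptions on `𝒜` which say that `L_𝒜 u = div 𝒜(x, u, ∇u)` is a weakly
`m`-coercive operator. -/
structure IsWeaklyCoercive {N : ℕ} (m : ℝ) (A : E N → ℝ → E N → E N) : Prop where
  caratheodory : IsCaratheodory A
  map_zero : ∀ (x : E N) (z : ℝ), 0 ≤ z → A x z 0 = 0
  nonneg : ∀ (x : E N) (z : ℝ) (ξ : E N), 0 ≤ z → 0 ≤ inner ℝ (A x z ξ) ξ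
  coercive : ∃ c₀ : ℝ, 0 < c₀ ∧ ∀ (x : E N) (z : ℝ) (ξ : E N), 0 ≤ z →
    c₀ * ‖A x z ξ‖ ^ (m / (m - 1)) ≤ inner ℝ (A x z ξ) ξ

/-- The assumptions on the kernel `K ∈ C(ℝ^N \ {0})`; the value `K 0` plays no role. -/
structure IsAdmissibleKernel {N : ℕ} (β : ℝ) (K : E N → ℝ) : Prop where
  continuousOn : ContinuousOn K {0}ᶜ
  pos : ∀ x : E N, x ≠ 0 → 0 < K x
  liminf_pos : 0 < liminf (fun x : E N => (K x : EReal)) (𝓝[≠] 0)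
  decay : ∃ c ρ : ℝ, 0 < c ∧ 0 < ρ ∧ ∀ x : E N, ρ < ‖x‖ → c * ‖x‖ ^ (-β) ≤ K x

/-- `(K ∗ u^p)(x,t) = ∫ K(x-y) u(y,t)^p dy`, with values in `[0,∞]`. -/
def convPow {N : ℕ} (K : E N → ℝ) (p : ℝ) (u : E N × ℝ → ℝ) (z : E N × ℝ) : ℝ≥0∞ :=
  ∫⁻ y : E N, ENNReal.ofReal (K (z.1 - y) * u (y, z.2) ^ p)

/-- `(K ∗ u^p) u^q`, with values in `[0,∞]`. -/
def nonlocalTerm {N : ℕ} (K : E N → ℝ) (p q : ℝ) (u : E N × ℝ → ℝ) (z : E N × ℝ) : ℝ≥0∞ :=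
  convPow K p u z * ENNReal.ofReal (u z ^ q)

/-- The vector field `𝒜(x, u, ∇u)` on space-time. -/
def flux {N : ℕ} (A : E N → ℝ → E N → E N) (u : E N × ℝ → ℝ) (Du : E N × ℝ → E N)
    (z : E N × ℝ) : E N :=
  A z.1 (u z) (Du z)

/-- The weak inequality
`∬ (K∗u^p) u^q φ ≤ ∬ u_t φ + ∬ 𝒜(x,u,∇u)·∇φ` for all `0 ≤ φ ∈ C¹_c(ℝ^N × ℝ)`, the integrals
being over `ℝ^N × (0,∞)` and those on the right being convergent. -/
def WeakIneq {N : ℕ} (K : E N → ℝ) (p q : ℝ) (A : E N → ℝ → E N → E N)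
    (u ut : E N × ℝ → ℝ) (Du : E N × ℝ → E N) : Prop :=
  ∀ φ : E N × ℝ → ℝ, ContDiff ℝ 1 φ → HasCompactSupport φ → (∀ z, 0 ≤ φ z) →
    IntegrableOn (fun z => ut z * φ z) (halfSpace N) ∧
    IntegrableOn (fun z => inner ℝ (flux A u Du z) (spatialGrad φ z)) (halfSpace N) ∧
    ((∫⁻ z in halfSpace N, nonlocalTerm K p q u z * ENNReal.ofReal (φ z) : ℝ≥0∞) : EReal) ≤
      (((∫ z in halfSpace N, ut z * φ z) +
        ∫ z in halfSpace N, inner ℝ (flux A u Du z) (spatialGrad φ z) : ℝ) : EReal)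

/-- The initial condition `u(·,0) = u₀` in the sense of traces:
`∫ u(x,t) χ(x) dx → ∫ u₀ χ dx` as `t → 0+` (off a null set of times) for `χ ∈ C_c(ℝ^N)`. -/
def HasInitialTrace {N : ℕ} (u₀ : E N → ℝ) (u : E N × ℝ → ℝ) : Prop :=
  ∀ χ : E N → ℝ, Continuous χ → HasCompactSupport χ →
    Tendsto (fun t : ℝ => ∫ x : E N, u (x, t) * χ x) (𝓝[>] 0 ⊓ ae volume)
      (𝓝 (∫ x : E N, u₀ x * χ x))

/-- The weak inequality after integration by parts in time, which contains the initial condition: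
`∬ (K∗u^p) u^q φ ≤ -∫ u₀ φ(·,0) - ∬ u φ_t + ∬ 𝒜(x,u,∇u)·∇φ` for all
`0 ≤ φ ∈ C¹_c(ℝ^N × ℝ)`. -/
def WeakIneqByParts {N : ℕ} (K : E N → ℝ) (p q : ℝ) (A : E N → ℝ → E N → E N)
    (u₀ : E N → ℝ) (u : E N × ℝ → ℝ) (Du : E N × ℝ → E N) : Prop :=
  ∀ φ : E N × ℝ → ℝ, ContDiff ℝ 1 φ → HasCompactSupport φ → (∀ z, 0 ≤ φ z) →
    IntegrableOn (fun z => u z * timeDeriv φ z) (halfSpace N) ∧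
    IntegrableOn (fun z => inner ℝ (flux A u Du z) (spatialGrad φ z)) (halfSpace N) ∧
    ((∫⁻ z in halfSpace N, nonlocalTerm K p q u z * ENNReal.ofReal (φ z) : ℝ≥0∞) : EReal) ≤
      ((-(∫ x : E N, u₀ x * φ (x, 0)) - (∫ z in halfSpace N, u z * timeDeriv φ z) +
        ∫ z in halfSpace N, inner ℝ (flux A u Du z) (spatialGrad φ z) : ℝ) : EReal)

/-- `u` is a nonnegative weak solution, in the class `𝒮`, of
`u_t - div 𝒜(x,u,∇u) ≥ (K∗u^p) u^q` in `ℝ^N × (0,∞)`, `u(·,0) = u₀`.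
The weak inequality may be satisfied in either of its two forms. -/
def IsNonnegWeakSolution {N : ℕ} (m p q : ℝ) (K : E N → ℝ) (A : E N → ℝ → E N → E N)
    (u₀ : E N → ℝ) (u : E N × ℝ → ℝ) : Prop :=
  (∀ᵐ z ∂(volume.restrict (halfSpace N)), 0 ≤ u z) ∧
  ∃ (ut : E N × ℝ → ℝ) (Du : E N × ℝ → E N),
    IsSobolevLoc m u ut Du ∧
    MemLpLoc (flux A u Du) (m / (m - 1)) ∧
    (∀ C : Set (E N × ℝ), IsCompact C → C ⊆ halfSpace N →
      ∫⁻ z in C, nonlocalTerm K p q u z < ∞) ∧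
    ((WeakIneq K p q A u ut Du ∧ HasInitialTrace u₀ u) ∨ WeakIneqByParts K p q A u₀ u Du)

end QuasilinearNonlocal

end

/-! The proof is a nonlinear capacity argument at a scale that leaves a quadratic energy invariant.
Write σ = (p+q)/2, γ = N+β and F = 𝒜(x,u,∇u). Only test functions supported in t > 0 are used. For
these the two weak forms coincide, and the initial datum disappears: a time cutoff rising from 0 has
a derivative of the favourable sign there.

Upper bound. Testing with (u+ε)^(-α) χζ for a small α > 0, coercivity and Young's inequality bound ∬
|F|^{m'} (u+ε)^(-1-α) χζ by integrals of (u+ε)^(1-α) and (u+ε)^(m-1-α) against derivatives of the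
cutoff (`IsInteriorWeakIneq.flux_le`). Testing with χζ itself and applying Young to F·∇χ, weighted
so that this flux integral appears, bounds ∬ (K∗u^p)u^q χζ by lower powers of u where the cutoff
varies (`IsInteriorWeakIneq.weighted_test`).

Lower bound. For x, y in B_{2R} the kernel is at least c R^(-β). By Cauchy–Schwarz, (∫u^p χ)(∫u^q χ)
≥ (∫u^σ χ)², so the nonlocal term dominates c R^(-β) times the energy ∫ζ(∫u^σ χ)² dt
(`le_lintegral_nonlocalTerm`).

Scaling. Put u = R^(-γ) v and T = R^(2γσ-2N). The upper bound on p+q says precisely that, for R ≥ 1,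
the diffusion factor R^(-γ(m-1)-m) is at most the time factor R^(-γ)/T. Hence the energy is at most
a constant times the average, over a box of size R^N T, of lower powers of v
(`exists_cutoff_estimate`). With this T the average of v^σ is controlled by the square root of the
energy, without any power of R.

Conclusion. All powers of v involved are less than σ, thanks to p+q > 2 max{1, m-1} and the
smallness of α. Absorption bounds the energy uniformly in R, so the total energy is finite
(`HasCutoffEstimate.totalEnergy_lt_top`). The energy of the transition region is then the tail of a
convergent integral. Since the lower powers are at most η + C v^σ with η arbitrarily small once ε is
small, the total energy vanishes (`HasCutoffEstimate.totalEnergy_eq_zero`). This second step is what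
covers the critical exponent. -/

noncomputable section

namespace QuasilinearNonlocal

/-! ### Convergence of mollifications in L^m. -/

section Mollification

open ContinuousLinearMap
open scoped Convolution

variable {G F : Type*} [NormedAddCommGroup G] [NormedSpace ℝ G] [FiniteDimensional ℝ G]
  [MeasurableSpace G] [BorelSpace G] [NormedAddCommGroup F] {μ : Measure G} [μ.IsAddHaarMeasure]

/-- Translations act continuously on L^p for finite p; here the abstract action is unfolded on
functions. -/
theorem tendsto_eLpNorm_translate_sub {p : ℝ≥0∞} (hp1 : 1 ≤ p) (hp : p ≠ ∞) {f : G → F}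
    (hf : MemLp f p μ) :
    Tendsto (fun y : G => eLpNorm (fun x => f (x - y) - f x) p μ) (𝓝 0) (𝓝 0) := by
  have : Fact (1 ≤ p) := ⟨hp1⟩
  have : Fact (p ≠ ∞) := ⟨hp⟩
  have hc : Continuous fun y : G => (DomAddAct.mk (-y)) +ᵥ hf.toLp f :=
    (DomAddAct.continuous_mk.comp continuous_neg).vadd continuous_const
  have h0 := (hc.tendsto 0).edist (tendsto_const_nhds (x := hf.toLp f))
  have e0 : (DomAddAct.mk (-(0 : G))) +ᵥ hf.toLp f = hf.toLp f := by
    rw [neg_zero]; exact zero_vadd _ _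
  rw [e0, edist_self] at h0
  refine h0.congr fun y => ?_
  rw [DomAddAct.mk_vadd_toLp, Lp.edist_toLp_toLp]
  refine eLpNorm_congr_ae (Eventually.of_forall fun x => ?_)
  simp [vadd_eq_add, sub_eq_add_neg, add_comm]

theorem rpow_lintegral_le_lintegral_rpow {α : Type*} [MeasurableSpace α] {ν : Measure α}
    [IsProbabilityMeasure ν] {p : ℝ} (hp : 1 ≤ p) {g : α → ℝ≥0∞} (hg : AEMeasurable g ν) :
    (∫⁻ y, g y ∂ν) ^ p ≤ ∫⁻ y, g y ^ p ∂ν := by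
  have hp0 : 0 < p := by linarith
  rcases hp.eq_or_lt with rfl | hp1
  · simp
  have h := ENNReal.lintegral_mul_le_Lp_mul_Lq ν (Real.HolderConjugate.conjExponent hp1) hg
    (aemeasurable_const (b := (1 : ℝ≥0∞)))
  simp only [Pi.mul_apply, mul_one, ENNReal.one_rpow, lintegral_one, measure_univ] at h
  calc (∫⁻ y, g y ∂ν) ^ p ≤ ((∫⁻ y, g y ^ p ∂ν) ^ (1 / p)) ^ p := by gcongr
    _ = _ := by rw [← ENNReal.rpow_mul, one_div_mul_cancel hp0.ne', ENNReal.rpow_one]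

variable [NormedSpace ℝ F] [CompleteSpace F]

/-- The normalised bump is a probability density and the error is the mean of f(x - y) - f(x), so
this is Jensen's inequality. -/
theorem enorm_convolution_sub_le {m : ℝ} (hm : 1 ≤ m) {f : G → F} (hf : LocallyIntegrable f μ)
    (φ : ContDiffBump (0 : G)) (x : G) :
    ‖(φ.normed μ ⋆[lsmul ℝ ℝ, μ] f) x - f x‖ₑ ^ m ≤
      ∫⁻ y, ENNReal.ofReal (φ.normed μ y) * ‖f (x - y) - f x‖ₑ ^ m ∂μ := by
  have hnn : ∀ y, 0 ≤ φ.normed μ y := φ.nonneg_normed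
  have hcont : Continuous (φ.normed μ) := φ.continuous_normed
  have hmeas : Measurable fun y => ENNReal.ofReal (φ.normed μ y) :=
    (hcont.measurable).ennreal_ofReal
  have : IsProbabilityMeasure (μ.withDensity fun y => ENNReal.ofReal (φ.normed μ y)) := by
    constructor
    rw [withDensity_apply _ MeasurableSet.univ, Measure.restrict_univ,
      ← ofReal_integral_eq_lintegral_ofReal φ.integrable_normed (Eventually.of_forall hnn),
      φ.integral_normed, ENNReal.ofReal_one]
  have hfm : AEStronglyMeasurable (fun y => f (x - y)) μ :=
    hf.aestronglyMeasurable.comp_quasiMeasurePreserving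
      (quasiMeasurePreserving_sub_left μ x)
  have hgm : AEMeasurable (fun y => ‖f (x - y) - f x‖ₑ) μ :=
    (hfm.sub aestronglyMeasurable_const).enorm
  have hi : Integrable (fun y => φ.normed μ y • f (x - y)) μ :=
    (φ.hasCompactSupport_normed.convolutionExists_left (L := lsmul ℝ ℝ) hcont hf) x
  have hi2 : Integrable (fun y => φ.normed μ y • f x) μ := φ.integrable_normed.smul_const _
  have e1 : (φ.normed μ ⋆[lsmul ℝ ℝ, μ] f) x - f x =
      ∫ y, φ.normed μ y • (f (x - y) - f x) ∂μ := by
    simp only [smul_sub]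
    rw [integral_sub hi hi2, integral_smul_const, φ.integral_normed, one_smul]
    simp [convolution_def]
  have e2 : ‖(φ.normed μ ⋆[lsmul ℝ ℝ, μ] f) x - f x‖ₑ ≤
      ∫⁻ y, ‖f (x - y) - f x‖ₑ ∂(μ.withDensity fun y => ENNReal.ofReal (φ.normed μ y)) := by
    rw [e1, lintegral_withDensity_eq_lintegral_mul₀ hmeas.aemeasurable hgm]
    refine (enorm_integral_le_lintegral_enorm _).trans (le_of_eq ?_)
    refine lintegral_congr fun y => ?_
    rw [enorm_smul, Real.enorm_eq_ofReal (hnn y)]; rfl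
  calc _ ≤ (∫⁻ y, ‖f (x - y) - f x‖ₑ
        ∂(μ.withDensity fun y => ENNReal.ofReal (φ.normed μ y))) ^ m := by gcongr
    _ ≤ _ := rpow_lintegral_le_lintegral_rpow hm
      (hgm.mono_ac (withDensity_absolutelyContinuous _ _))
    _ = _ := lintegral_withDensity_eq_lintegral_mul₀ hmeas.aemeasurable (hgm.pow_const _)

/-- Integrating the Jensen bound in x and exchanging the integrals leaves a mean of translation
errors over the support of the bump. Those errors are uniformly small once the radius is. -/
theorem tendsto_eLpNorm_convolution_sub {m : ℝ} (hm : 1 ≤ m) {f : G → F}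
    (hf : MemLp f (ENNReal.ofReal m) μ) {φ : ℕ → ContDiffBump (0 : G)}
    (hφ : Tendsto (fun n => (φ n).rOut) atTop (𝓝 0)) :
    Tendsto (fun n => eLpNorm (fun x => ((φ n).normed μ ⋆[lsmul ℝ ℝ, μ] f) x - f x)
      (ENNReal.ofReal m) μ) atTop (𝓝 0) := by
  have hm0 : 0 < m := by linarith
  have hm1 : 1 ≤ ENNReal.ofReal m := by simpa using ENNReal.ofReal_le_ofReal hm
  have hlf : LocallyIntegrable f μ := hf.locallyIntegrable hm1
  have hne : ENNReal.ofReal m ≠ 0 := by simpa using hm0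
  have key := tendsto_eLpNorm_translate_sub (μ := μ) hm1 ENNReal.ofReal_ne_top hf
  rw [ENNReal.tendsto_nhds_zero] at key ⊢
  intro ε hε
  obtain ⟨r, hr, hr'⟩ := Metric.eventually_nhds_iff.1 (key ε hε)
  filter_upwards [hφ.eventually (gt_mem_nhds hr)] with n hn
  have hpow : ∀ g : G → F, eLpNorm g (ENNReal.ofReal m) μ ≤ ε ↔
      ∫⁻ x, ‖g x‖ₑ ^ m ∂μ ≤ ε ^ m := by
    intro g
    rw [eLpNorm_eq_lintegral_rpow_enorm_toReal hne ENNReal.ofReal_ne_top,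
      ENNReal.toReal_ofReal hm0.le, one_div, ENNReal.rpow_inv_le_iff hm0]
  rw [hpow]
  have hjm : AEMeasurable (Function.uncurry fun x y =>
      ENNReal.ofReal ((φ n).normed μ y) * ‖f (x - y) - f x‖ₑ ^ m) (μ.prod μ) := by
    refine AEMeasurable.mul ?_ (AEMeasurable.pow_const (AEStronglyMeasurable.enorm ?_) _)
    · exact (((φ n).continuous_normed.comp continuous_snd).measurable.ennreal_ofReal).aemeasurable
    · refine AEStronglyMeasurable.sub ?_ hf.1.comp_fst
      exact hf.1.comp_quasiMeasurePreserving (quasiMeasurePreserving_sub μ μ)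
  calc ∫⁻ x, ‖((φ n).normed μ ⋆[lsmul ℝ ℝ, μ] f) x - f x‖ₑ ^ m ∂μ
      ≤ ∫⁻ x, ∫⁻ y, ENNReal.ofReal ((φ n).normed μ y) * ‖f (x - y) - f x‖ₑ ^ m ∂μ ∂μ :=
        lintegral_mono fun x => enorm_convolution_sub_le hm hlf (φ n) x
    _ = ∫⁻ y, ∫⁻ x, ENNReal.ofReal ((φ n).normed μ y) * ‖f (x - y) - f x‖ₑ ^ m ∂μ ∂μ :=
        lintegral_lintegral_swap hjm
    _ ≤ ∫⁻ y, ENNReal.ofReal ((φ n).normed μ y) * ε ^ m ∂μ := by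
        refine lintegral_mono fun y => ?_
        rw [lintegral_const_mul' _ _ ENNReal.ofReal_ne_top]
        by_cases hy : y ∈ Metric.ball (0 : G) (φ n).rOut
        · gcongr
          exact (hpow _).1 (hr' (lt_trans (Metric.mem_ball.1 hy) hn))
        · have : (φ n).normed μ y = 0 := by
            rw [← (φ n).support_normed_eq (μ := μ)] at hy
            simpa using hy
          simp [this]
    _ = ε ^ m := by
        rw [lintegral_mul_const _ ((φ n).continuous_normed.measurable.ennreal_ofReal),
          ← ofReal_integral_eq_lintegral_ofReal (φ n).integrable_normed
            (Eventually.of_forall (φ n).nonneg_normed), (φ n).integral_normed]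
        simp

end Mollification

/-! ### Derivatives of mollifications and weak derivatives. -/

section Approximation

open ContinuousLinearMap
open scoped Convolution

variable {N : ℕ}

instance isAddHaarMeasure_volume_prod : (volume : Measure (E N × ℝ)).IsAddHaarMeasure :=
  Measure.prod.instIsAddHaarMeasure (volume : Measure (E N)) (volume : Measure ℝ)

theorem timeDeriv_eq_fderiv {φ : E N × ℝ → ℝ} {z : E N × ℝ} (h : DifferentiableAt ℝ φ z) :
    timeDeriv φ z = fderiv ℝ φ z (0, 1) := by
  have h1 : HasDerivAt (fun t : ℝ => ((z.1, t) : E N × ℝ)) (0, 1) z.2 :=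
    (hasDerivAt_const _ _).prodMk (hasDerivAt_id _)
  exact (HasFDerivAt.comp_hasDerivAt z.2 (f := fun t : ℝ => ((z.1, t) : E N × ℝ))
    h.hasFDerivAt h1).deriv

theorem inner_spatialGrad {φ : E N × ℝ → ℝ} {z : E N × ℝ} (h : DifferentiableAt ℝ φ z)
    (e : E N) : inner ℝ (spatialGrad φ z) e = fderiv ℝ φ z (e, 0) := by
  have h1 : HasFDerivAt (fun x : E N => ((x, z.2) : E N × ℝ)) (inl ℝ (E N) ℝ) z.1 :=
    hasFDerivAt_prodMk_left _ _
  have h2 := (HasFDerivAt.comp z.1 (f := fun x : E N => ((x, z.2) : E N × ℝ))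
    h.hasFDerivAt h1).fderiv
  change inner ℝ ((InnerProductSpace.toDual ℝ (E N)).symm
    (fderiv ℝ (φ ∘ fun x : E N => ((x, z.2) : E N × ℝ)) z.1)) e = _
  rw [InnerProductSpace.toDual_symm_apply, h2]
  simp

theorem isOpen_halfSpace : IsOpen (halfSpace N) := isOpen_lt continuous_const continuous_snd

theorem measurableSet_halfSpace : MeasurableSet (halfSpace N) := isOpen_halfSpace.measurableSet

theorem ContDiff.continuous_timeDeriv {φ : E N × ℝ → ℝ} (h : ContDiff ℝ 1 φ) :
    Continuous (timeDeriv φ) := by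
  have : timeDeriv φ = fun z => fderiv ℝ φ z (0, 1) :=
    funext fun z => timeDeriv_eq_fderiv (h.differentiable one_ne_zero z)
  rw [this]
  exact (h.continuous_fderiv one_ne_zero).clm_apply continuous_const

theorem spatialGrad_eq {φ : E N × ℝ → ℝ} {z : E N × ℝ} (h : DifferentiableAt ℝ φ z) :
    spatialGrad φ z = (InnerProductSpace.toDual ℝ (E N)).symm
      ((fderiv ℝ φ z).comp (inl ℝ (E N) ℝ)) := by
  refine ext_inner_right ℝ fun e => ?_
  rw [inner_spatialGrad h, InnerProductSpace.toDual_symm_apply]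
  simp

theorem ContDiff.continuous_spatialGrad {φ : E N × ℝ → ℝ} (h : ContDiff ℝ 1 φ) :
    Continuous (spatialGrad φ) := by
  rw [show spatialGrad φ = _ from
    funext fun z => spatialGrad_eq (h.differentiable one_ne_zero z)]
  exact (InnerProductSpace.toDual ℝ (E N)).symm.continuous.comp
    ((h.continuous_fderiv one_ne_zero).clm_comp continuous_const)

theorem timeDeriv_eq_zero_of_notMem_tsupport {φ : E N × ℝ → ℝ} {z : E N × ℝ}
    (h : z ∉ tsupport φ) : timeDeriv φ z = 0 := by
  have h0 := notMem_tsupport_iff_eventuallyEq.1 h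
  have hd : DifferentiableAt ℝ φ z := h0.differentiableAt_iff.2 (differentiableAt_const (0 : ℝ))
  rw [timeDeriv_eq_fderiv hd, h0.fderiv_eq]
  simp

theorem spatialGrad_eq_zero_of_notMem_tsupport {φ : E N × ℝ → ℝ} {z : E N × ℝ}
    (h : z ∉ tsupport φ) : spatialGrad φ z = 0 := by
  have h0 := notMem_tsupport_iff_eventuallyEq.1 h
  have hd : DifferentiableAt ℝ φ z := h0.differentiableAt_iff.2 (differentiableAt_const (0 : ℝ))
  refine ext_inner_right ℝ fun e => ?_
  rw [inner_spatialGrad hd, h0.fderiv_eq]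
  simp

theorem fderiv_bump_convolution {f : E N × ℝ → ℝ} (hf : LocallyIntegrable f volume)
    (φ : ContDiffBump (0 : E N × ℝ)) (z w : E N × ℝ) :
    fderiv ℝ (φ.normed volume ⋆[lsmul ℝ ℝ, volume] f) z w =
      ∫ y, f y * fderiv ℝ (φ.normed volume) (z - y) w := by
  have hρ : ContDiff ℝ 1 (φ.normed (volume : Measure (E N × ℝ))) := φ.contDiff_normed
  have hswap : (φ.normed volume ⋆[lsmul ℝ ℝ, volume] f) =
      (f ⋆[lsmul ℝ ℝ, volume] φ.normed volume) := by
    ext x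
    rw [convolution_lsmul_swap, convolution_lsmul]
    simp [mul_comm]
  rw [hswap, (φ.hasCompactSupport_normed.hasFDerivAt_convolution_right (lsmul ℝ ℝ) hf hρ
    z).fderiv, convolution_precompR_apply _ hf (φ.hasCompactSupport_normed.fderiv ℝ)
    (hρ.continuous_fderiv one_ne_zero)]
  rfl

variable {z : E N × ℝ} {s : Set (E N × ℝ)} {φ : ContDiffBump (0 : E N × ℝ)}

theorem tsupport_normed_sub_subset (hz : Metric.closedBall z φ.rOut ⊆ s) :
    tsupport (fun y => φ.normed (volume : Measure (E N × ℝ)) (z - y)) ⊆ s := by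
  refine Subset.trans (closure_minimal (fun y hy => ?_) Metric.isClosed_closedBall) hz
  have : z - y ∈ Function.support (φ.normed (volume : Measure (E N × ℝ))) := hy
  rw [φ.support_normed_eq, mem_ball_zero_iff] at this
  rw [Metric.mem_closedBall, dist_eq_norm, norm_sub_rev]
  exact this.le

theorem hasCompactSupport_normed_sub :
    HasCompactSupport (fun y => φ.normed (volume : Measure (E N × ℝ)) (z - y)) :=
  (isCompact_closedBall z φ.rOut).of_isClosed_subset (isClosed_tsupport _)
    (tsupport_normed_sub_subset subset_rfl)

theorem contDiff_normed_sub :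
    ContDiff ℝ 1 (fun y => φ.normed (volume : Measure (E N × ℝ)) (z - y)) :=
  (φ.contDiff_normed (n := 1)).comp (contDiff_const.sub contDiff_id)

theorem fderiv_normed_sub (y w : E N × ℝ) :
    fderiv ℝ (fun y => φ.normed (volume : Measure (E N × ℝ)) (z - y)) y w =
      - fderiv ℝ (φ.normed volume) (z - y) w := by
  have hρ : ContDiff ℝ 1 (φ.normed (volume : Measure (E N × ℝ))) := φ.contDiff_normed
  have := (hρ.differentiable one_ne_zero (z - y)).hasFDerivAt.comp y
    ((hasFDerivAt_const z y).sub (hasFDerivAt_id y))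
  rw [show (fun y => φ.normed (volume : Measure (E N × ℝ)) (z - y)) =
    φ.normed volume ∘ fun y => z - y from rfl]
  erw [this.fderiv]
  simp

/-- Differentiation falls on the bump, and y ↦ ρ(z - y) is supported in s, so the truncation of u to
s is invisible. The sign comes from the reflection. The right side is then the weak derivative
pairing with an admissible test function. -/
theorem fderiv_bump_convolution_indicator {u : E N × ℝ → ℝ}
    (hsh : s ⊆ halfSpace N) (hu : LocallyIntegrable (s.indicator u) volume)
    (hz : Metric.closedBall z φ.rOut ⊆ s) (w : E N × ℝ) :
    fderiv ℝ (φ.normed volume ⋆[lsmul ℝ ℝ, volume] s.indicator u) z w =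
      - ∫ y in halfSpace N, u y * fderiv ℝ (fun y => φ.normed volume (z - y)) y w := by
  rw [fderiv_bump_convolution hu, ← integral_neg, ← integral_indicator measurableSet_halfSpace]
  refine integral_congr_ae (Eventually.of_forall fun y => ?_)
  by_cases hy : y ∈ s
  · simp only [indicator_of_mem hy, indicator_of_mem (hsh hy), fderiv_normed_sub]
    ring
  · have h0 : y ∉ tsupport (fun y => φ.normed (volume : Measure (E N × ℝ)) (z - y)) :=
      fun h => hy (tsupport_normed_sub_subset hz h)
    have h1 : fderiv ℝ (fun y => φ.normed (volume : Measure (E N × ℝ)) (z - y)) y = 0 := by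
      rw [(notMem_tsupport_iff_eventuallyEq.1 h0).fderiv_eq]
      simp
    have h2 : fderiv ℝ (φ.normed (volume : Measure (E N × ℝ))) (z - y) w = 0 := by
      rw [← neg_eq_zero, ← fderiv_normed_sub, h1]
      simp
    simp [indicator, h1, h2]

theorem bump_convolution_indicator {F : Type*} [NormedAddCommGroup F] [NormedSpace ℝ F]
    {g : E N × ℝ → F} (hsh : s ⊆ halfSpace N) (hz : Metric.closedBall z φ.rOut ⊆ s) :
    (φ.normed volume ⋆[lsmul ℝ ℝ, volume] s.indicator g) z =
      ∫ y in halfSpace N, φ.normed volume (z - y) • g y := by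
  rw [convolution_lsmul_swap, ← integral_indicator measurableSet_halfSpace]
  refine integral_congr_ae (Eventually.of_forall fun y => ?_)
  by_cases hy : y ∈ s
  · simp only [indicator_of_mem hy, indicator_of_mem (hsh hy)]
  · have h0 : φ.normed (volume : Measure (E N × ℝ)) (z - y) = 0 := by
      by_contra h
      exact hy (tsupport_normed_sub_subset hz (subset_tsupport _ h))
    simp [indicator, h0]

theorem timeDeriv_bump_convolution {u ut : E N × ℝ → ℝ} (h : IsWeakTimeDeriv u ut)
    (hsh : s ⊆ halfSpace N)
    (hu : LocallyIntegrable (s.indicator u) volume) (hz : Metric.closedBall z φ.rOut ⊆ s) :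
    timeDeriv (φ.normed volume ⋆[lsmul ℝ ℝ, volume] s.indicator u) z =
      (φ.normed volume ⋆[lsmul ℝ ℝ, volume] s.indicator ut) z := by
  have hd : ContDiff ℝ 1 (φ.normed volume ⋆[lsmul ℝ ℝ, volume] s.indicator u) :=
    φ.hasCompactSupport_normed.contDiff_convolution_left (n := 1) _ φ.contDiff_normed hu
  have hw := h _ (contDiff_normed_sub (z := z) (φ := φ)) hasCompactSupport_normed_sub
    ((tsupport_normed_sub_subset hz).trans hsh)
  rw [timeDeriv_eq_fderiv (hd.differentiable one_ne_zero z),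
    fderiv_bump_convolution_indicator hsh hu hz, bump_convolution_indicator hsh hz,
    neg_eq_iff_eq_neg]
  simp only [timeDeriv_eq_fderiv
    ((contDiff_normed_sub (z := z) (φ := φ)).differentiable one_ne_zero _)] at hw
  rw [hw]
  simp [mul_comm]

/-- The weak gradient identity is vector valued, so it is paired with a fixed vector e to reduce it
to a directional derivative of the convolution. -/
theorem spatialGrad_bump_convolution {u : E N × ℝ → ℝ} {Du : E N × ℝ → E N}
    (h : IsWeakSpatialGrad u Du) (hs : IsCompact s) (hsh : s ⊆ halfSpace N)
    (hu : IntegrableOn u s volume) (hDu : IntegrableOn Du s volume)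
    (hz : Metric.closedBall z φ.rOut ⊆ s) :
    spatialGrad (φ.normed volume ⋆[lsmul ℝ ℝ, volume] s.indicator u) z =
      (φ.normed volume ⋆[lsmul ℝ ℝ, volume] s.indicator Du) z := by
  have hu' : LocallyIntegrable (s.indicator u) volume :=
    ((integrable_indicator_iff hs.measurableSet).2 hu).locallyIntegrable
  have hd : ContDiff ℝ 1 (φ.normed volume ⋆[lsmul ℝ ℝ, volume] s.indicator u) :=
    φ.hasCompactSupport_normed.contDiff_convolution_left (n := 1) _ φ.contDiff_normed hu'
  set η : E N × ℝ → ℝ := fun y => φ.normed volume (z - y) with hη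
  have hηc : ContDiff ℝ 1 η := contDiff_normed_sub
  have hηs : tsupport η ⊆ s := tsupport_normed_sub_subset hz
  have hw := h η hηc hasCompactSupport_normed_sub (hηs.trans hsh)
  have hint1 : IntegrableOn (fun y => u y • spatialGrad η y) (halfSpace N) := by
    have : IntegrableOn (fun y => u y • spatialGrad η y) s :=
      hu.smul_continuousOn (ContDiff.continuous_spatialGrad hηc).continuousOn hs
    refine (this.integrable_of_forall_notMem_eq_zero fun y hy => ?_).integrableOn
    rw [spatialGrad_eq_zero_of_notMem_tsupport fun h => hy (hηs h), smul_zero]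
  have hint2 : IntegrableOn (fun y => η y • Du y) (halfSpace N) := by
    have : IntegrableOn (fun y => η y • Du y) s :=
      hDu.continuousOn_smul hηc.continuous.continuousOn hs
    refine (this.integrable_of_forall_notMem_eq_zero fun y hy => ?_).integrableOn
    rw [image_eq_zero_of_notMem_tsupport fun h => hy (hηs h), zero_smul]
  refine ext_inner_right ℝ fun e => ?_
  rw [inner_spatialGrad (hd.differentiable one_ne_zero z),
    fderiv_bump_convolution_indicator hsh hu' hz,
    bump_convolution_indicator hsh hz, neg_eq_iff_eq_neg, ← inner_neg_left, ← hw,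
    real_inner_comm, ← integral_inner hint1]
  refine integral_congr_ae (Eventually.of_forall fun y => ?_)
  simp only
  rw [inner_smul_right, real_inner_comm, inner_spatialGrad (hηc.differentiable one_ne_zero y)]

end Approximation

/-! ### Nonnegative smooth approximation on compact sets, and passage to the limit. -/

section Limits

open ContinuousLinearMap
open scoped Convolution

variable {N : ℕ}

/-- Truncate u to a compact thickening of C inside the half-space and mollify with radii below the
thickening width. On C the derivatives of the mollification are mollifications of the weak
derivatives. Nonnegativity survives, which keeps v + ε away from 0 later. -/
theorem IsSobolevLoc.exists_approx {m : ℝ} (hm : 1 ≤ m) {u ut : E N × ℝ → ℝ}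
    {Du : E N × ℝ → E N} (h : IsSobolevLoc m u ut Du)
    (hu : ∀ᵐ z ∂(volume.restrict (halfSpace N)), 0 ≤ u z) {C : Set (E N × ℝ)} (hC : IsCompact C)
    (hCs : C ⊆ halfSpace N) :
    ∃ v : ℕ → E N × ℝ → ℝ, (∀ n, ContDiff ℝ 1 (v n)) ∧ (∀ n z, 0 ≤ v n z) ∧
      Tendsto (fun n => eLpNorm (v n - u) (ENNReal.ofReal m) (volume.restrict C)) atTop (𝓝 0) ∧
      Tendsto (fun n => eLpNorm (timeDeriv (v n) - ut) (ENNReal.ofReal m) (volume.restrict C))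
        atTop (𝓝 0) ∧
      Tendsto (fun n => eLpNorm (spatialGrad (v n) - Du) (ENNReal.ofReal m) (volume.restrict C))
        atTop (𝓝 0) := by
  have hm1 : 1 ≤ ENNReal.ofReal m := by simpa using ENNReal.ofReal_le_ofReal hm
  obtain ⟨δ, hδ, hδs⟩ := hC.exists_cthickening_subset_open isOpen_halfSpace hCs
  set s := Metric.cthickening δ C with hs
  have hsc : IsCompact s := hC.cthickening
  have hsm : MeasurableSet s := hsc.measurableSet
  have hind : ∀ {F : Type} [NormedAddCommGroup F] {g : E N × ℝ → F}, MemLpLoc g m →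
      MemLp (s.indicator g) (ENNReal.ofReal m) volume := fun hg =>
    (memLp_indicator_iff_restrict hsm).2 (hg s hsc hδs)
  -- The outer radius δ/(n+1) never exceeds δ, so balls of that radius about points of C stay in the
  -- thickening.
  let φ : ℕ → ContDiffBump (0 : E N × ℝ) := fun n =>
    ⟨δ / (2 * (n + 1)), δ / (n + 1), by positivity, by
      have : (0 : ℝ) < n + 1 := by positivity
      gcongr; linarith⟩
  have hφ : Tendsto (fun n => (φ n).rOut) atTop (𝓝 0) :=
    tendsto_const_nhds.div_atTop (tendsto_natCast_atTop_atTop.atTop_add tendsto_const_nhds)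
  have hball : ∀ n, ∀ z ∈ C, Metric.closedBall z (φ n).rOut ⊆ s := fun n z hz =>
    (Metric.closedBall_subset_closedBall
      (div_le_self hδ.le (by simp))).trans (Metric.closedBall_subset_cthickening hz δ)
  have hli : LocallyIntegrable (s.indicator u) volume :=
    (hind h.memLp).locallyIntegrable hm1
  have hnn : ∀ᵐ z ∂(volume : Measure (E N × ℝ)), 0 ≤ s.indicator u z := by
    rw [ae_restrict_iff' measurableSet_halfSpace] at hu
    filter_upwards [hu] with z hz
    by_cases hzs : z ∈ s
    · rw [indicator_of_mem hzs]
      exact hz (hδs hzs)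
    · rw [indicator_of_notMem hzs]
  refine ⟨fun n => (φ n).normed volume ⋆[lsmul ℝ ℝ, volume] s.indicator u, fun n =>
    (φ n).hasCompactSupport_normed.contDiff_convolution_left (n := 1) _ (φ n).contDiff_normed hli,
    fun n z => ?_, ?_, ?_, ?_⟩
  · simp only [convolution_lsmul_swap]
    refine integral_nonneg_of_ae ?_
    filter_upwards [hnn] with y hy
    exact mul_nonneg ((φ n).nonneg_normed _) hy
  · refine tendsto_of_tendsto_of_tendsto_of_le_of_le tendsto_const_nhds
      (tendsto_eLpNorm_convolution_sub hm (hind h.memLp) hφ) (fun _ => zero_le) fun n => ?_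
    refine (eLpNorm_congr_ae ?_).trans_le (eLpNorm_mono_measure _ Measure.restrict_le_self)
    filter_upwards [ae_restrict_mem hC.measurableSet] with z hz
    simp only [Pi.sub_apply]
    rw [indicator_of_mem (Metric.self_subset_cthickening C hz : z ∈ s) u]
  · refine tendsto_of_tendsto_of_tendsto_of_le_of_le tendsto_const_nhds
      (tendsto_eLpNorm_convolution_sub hm (hind h.memLp_time) hφ) (fun _ => zero_le) fun n => ?_
    refine (eLpNorm_congr_ae ?_).trans_le (eLpNorm_mono_measure _ Measure.restrict_le_self)
    filter_upwards [ae_restrict_mem hC.measurableSet] with z hz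
    simp only [Pi.sub_apply]
    rw [timeDeriv_bump_convolution h.weak_time hδs hli (hball n z hz),
      indicator_of_mem (Metric.self_subset_cthickening C hz : z ∈ s) ut]
  · refine tendsto_of_tendsto_of_tendsto_of_le_of_le tendsto_const_nhds
      (tendsto_eLpNorm_convolution_sub hm (hind h.memLp_grad) hφ) (fun _ => zero_le) fun n => ?_
    refine (eLpNorm_congr_ae ?_).trans_le (eLpNorm_mono_measure _ Measure.restrict_le_self)
    have : IsFiniteMeasure (volume.restrict s) := ⟨by simpa using hsc.measure_lt_top⟩
    filter_upwards [ae_restrict_mem hC.measurableSet] with z hz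
    simp only [Pi.sub_apply]
    rw [spatialGrad_bump_convolution h.weak_grad hsc hδs
      ((h.memLp s hsc hδs).integrable hm1) ((h.memLp_grad s hsc hδs).integrable hm1)
      (hball n z hz), indicator_of_mem (Metric.self_subset_cthickening C hz : z ∈ s) Du]

/-- Split b_n g_n = b_n g₀ + b_n (g_n - g₀): dominated convergence for the first term, L¹
convergence and the uniform bound for the second. -/
theorem tendsto_integral_mul_of_bounded {α : Type*} [MeasurableSpace α] {μ : Measure α}
    {b : ℕ → α → ℝ} {b₀ : α → ℝ} {B : ℝ} {g : ℕ → α → ℝ} {g₀ : α → ℝ}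
    (hbm : ∀ n, AEStronglyMeasurable (b n) μ) (hb : ∀ n, ∀ᵐ x ∂μ, |b n x| ≤ B)
    (hlim : ∀ᵐ x ∂μ, Tendsto (fun n => b n x) atTop (𝓝 (b₀ x)))
    (hgi : ∀ n, Integrable (g n) μ) (hg₀ : Integrable g₀ μ)
    (hg : Tendsto (fun n => eLpNorm (g n - g₀) 1 μ) atTop (𝓝 0)) :
    Tendsto (fun n => ∫ x, b n x * g n x ∂μ) atTop (𝓝 (∫ x, b₀ x * g₀ x ∂μ)) := by
  have h1 : Tendsto (fun n => ∫ x, b n x * g₀ x ∂μ) atTop (𝓝 (∫ x, b₀ x * g₀ x ∂μ)) := by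
    refine tendsto_integral_of_dominated_convergence (fun x => B * |g₀ x|)
      (fun n => (hbm n).mul hg₀.1) (hg₀.abs.const_mul B) (fun n => ?_) ?_
    · filter_upwards [hb n] with x hx
      rw [norm_mul]
      exact mul_le_mul_of_nonneg_right hx (abs_nonneg _)
    · filter_upwards [hlim] with x hx using hx.mul_const _
  have hi1 : ∀ n, Integrable (fun x => b n x * g₀ x) μ := fun n =>
    hg₀.bdd_mul (hbm n) (hb n)
  have hi2 : ∀ n, Integrable (fun x => b n x * (g n x - g₀ x)) μ := fun n =>
    ((hgi n).sub hg₀).bdd_mul (hbm n) (hb n)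
  have h2 : Tendsto (fun n => ∫ x, b n x * (g n x - g₀ x) ∂μ) atTop (𝓝 0) := by
    rw [tendsto_zero_iff_norm_tendsto_zero]
    have h3 : Tendsto (fun n => B * (eLpNorm (g n - g₀) 1 μ).toReal) atTop (𝓝 0) := by
      simpa using ((ENNReal.tendsto_toReal ENNReal.zero_ne_top).comp hg).const_mul B
    refine squeeze_zero (fun n => norm_nonneg _) (fun n => ?_) h3
    refine (norm_integral_le_integral_norm _).trans ?_
    have e : (eLpNorm (g n - g₀) 1 μ).toReal = ∫ x, ‖(g n - g₀) x‖ ∂μ := by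
      rw [eLpNorm_one_eq_lintegral_enorm, integral_norm_eq_lintegral_enorm
        ((hgi n).sub hg₀).1]
    rw [e, ← integral_const_mul]
    refine integral_mono_ae (hi2 n).norm (((hgi n).sub hg₀).norm.const_mul B) ?_
    filter_upwards [hb n] with x hx
    rw [norm_mul]
    exact mul_le_mul_of_nonneg_right hx (norm_nonneg _)
  have := h1.add h2
  rw [add_zero] at this
  refine this.congr fun n => ?_
  rw [← integral_add (hi1 n) (hi2 n)]
  congr 1; ext x; ring

theorem integral_timeDeriv_eq_zero {φ : E N × ℝ → ℝ} (h : ContDiff ℝ 1 φ)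
    (hs : HasCompactSupport φ) : ∫ z, timeDeriv φ z = 0 := by
  have h1 : ∀ z, timeDeriv φ z = fderiv ℝ φ z (0, 1) := fun z =>
    timeDeriv_eq_fderiv (h.differentiable one_ne_zero z)
  simp only [h1]
  have hc : Continuous fun z => fderiv ℝ φ z (0, 1) :=
    (h.continuous_fderiv one_ne_zero).clm_apply continuous_const
  have := integral_mul_fderiv_eq_neg_fderiv_mul_of_integrable (μ := volume) (𝕜 := ℝ)
    (f := fun _ : E N × ℝ => (1 : ℝ)) (g := φ) (v := (0, 1)) (by simp)
    (by simpa using (hc.integrable_of_hasCompactSupport (hs.fderiv_apply ℝ _)))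
    (by simpa using h.continuous.integrable_of_hasCompactSupport hs)
    (fun _ _ => differentiableAt_const _) (fun z _ => h.differentiable one_ne_zero z)
  simpa using this

theorem setIntegral_eq_of_tsupport {F : Type*} [NormedAddCommGroup F] [NormedSpace ℝ F]
    {φ : E N × ℝ → ℝ} {g : E N × ℝ → F} (hφ : tsupport φ ⊆ halfSpace N)
    (hg : ∀ z, z ∉ tsupport φ → g z = 0) :
    ∫ z in halfSpace N, g z = ∫ z in tsupport φ, g z :=
  setIntegral_eq_of_subset_of_forall_sdiff_eq_zero measurableSet_halfSpace hφ
    fun z hz => hg z hz.2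

end Limits

/-! ### Testing with negative powers of a smooth approximation. -/

section PowerTest

variable {N : ℕ} {v ψ : E N × ℝ → ℝ} {ε : ℝ}

theorem contDiff_rpow_add (hv : ContDiff ℝ 1 v) (hv0 : ∀ z, 0 ≤ v z) (hε : 0 < ε) (r : ℝ) :
    ContDiff ℝ 1 fun z => (v z + ε) ^ r :=
  (hv.add contDiff_const).rpow_const_of_ne fun z => by linarith [hv0 z]

theorem fderiv_rpow_add_mul (hv : ContDiff ℝ 1 v) (hv0 : ∀ z, 0 ≤ v z) (hε : 0 < ε)
    (hψ : ContDiff ℝ 1 ψ) (r : ℝ) (z w : E N × ℝ) :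
    fderiv ℝ (fun z => (v z + ε) ^ r * ψ z) z w =
      r * ((v z + ε) ^ (r - 1) * ψ z * fderiv ℝ v z w) + (v z + ε) ^ r * fderiv ℝ ψ z w := by
  have h1 := (((hv.differentiable one_ne_zero z).hasFDerivAt.add_const ε).rpow_const (p := r)
    (Or.inl (by linarith [hv0 z]))).mul (hψ.differentiable one_ne_zero z).hasFDerivAt
  have h2 : fderiv ℝ (fun z => (v z + ε) ^ r * ψ z) z = _ := h1.fderiv
  rw [h2]
  simp only [add_apply, FunLike.coe_smul, Pi.smul_apply, smul_eq_mul]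
  ring

theorem timeDeriv_rpow_add_mul (hv : ContDiff ℝ 1 v) (hv0 : ∀ z, 0 ≤ v z) (hε : 0 < ε)
    (hψ : ContDiff ℝ 1 ψ) (r : ℝ) (z : E N × ℝ) :
    timeDeriv (fun z => (v z + ε) ^ r * ψ z) z =
      r * ((v z + ε) ^ (r - 1) * ψ z * timeDeriv v z) + (v z + ε) ^ r * timeDeriv ψ z := by
  rw [timeDeriv_eq_fderiv (((contDiff_rpow_add hv hv0 hε r).mul hψ).differentiable one_ne_zero z),
    timeDeriv_eq_fderiv (hv.differentiable one_ne_zero z),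
    timeDeriv_eq_fderiv (hψ.differentiable one_ne_zero z), fderiv_rpow_add_mul hv hv0 hε hψ]

theorem spatialGrad_rpow_add_mul (hv : ContDiff ℝ 1 v) (hv0 : ∀ z, 0 ≤ v z) (hε : 0 < ε)
    (hψ : ContDiff ℝ 1 ψ) (r : ℝ) (z : E N × ℝ) :
    spatialGrad (fun z => (v z + ε) ^ r * ψ z) z =
      (r * ((v z + ε) ^ (r - 1) * ψ z)) • spatialGrad v z + (v z + ε) ^ r • spatialGrad ψ z := by
  refine ext_inner_right ℝ fun e => ?_
  rw [inner_spatialGrad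
      (((contDiff_rpow_add hv hv0 hε r).mul hψ).differentiable one_ne_zero z),
    inner_add_left, inner_smul_left, inner_smul_left,
    inner_spatialGrad (hv.differentiable one_ne_zero z),
    inner_spatialGrad (hψ.differentiable one_ne_zero z), fderiv_rpow_add_mul hv hv0 hε hψ]
  simp only [conj_trivial]
  ring

/-- `0 ≤ ∬ u_t φ + ∬ F·∇φ` for all `0 ≤ φ ∈ C¹_c(ℝ^N × (0,∞))`. -/
def IsInteriorSupersolution (ut : E N × ℝ → ℝ) (F : E N × ℝ → E N) : Prop :=
  ∀ φ : E N × ℝ → ℝ, ContDiff ℝ 1 φ → HasCompactSupport φ → tsupport φ ⊆ halfSpace N →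
    (∀ z, 0 ≤ φ z) →
    0 ≤ (∫ z in halfSpace N, ut z * φ z) + ∫ z in halfSpace N, inner ℝ (F z) (spatialGrad φ z)

variable {ut : E N × ℝ → ℝ} {F : E N × ℝ → E N}

/-- The power (u+ε)^(-α) is not C¹, so the test function is built from a smooth v and only later is
v sent to u. Writing u_t = (u_t - v_t) + v_t isolates an error, while (v+ε)^(-α) v_t is an exact
time derivative and can be integrated by parts. -/
theorem IsInteriorSupersolution.smooth_power_test (h : IsInteriorSupersolution ut F)
    (hψ : ContDiff ℝ 1 ψ) (hψc : HasCompactSupport ψ) (hψs : tsupport ψ ⊆ halfSpace N)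
    (hψ0 : ∀ z, 0 ≤ ψ z) (hut : IntegrableOn ut (tsupport ψ)) (hF : IntegrableOn F (tsupport ψ))
    (hv : ContDiff ℝ 1 v) (hv0 : ∀ z, 0 ≤ v z) (hε : 0 < ε) {α : ℝ} (hα : α < 1) :
    0 ≤ (∫ z in tsupport ψ, ((v z + ε) ^ (-α) * ψ z) * (ut z - timeDeriv v z))
      - (1 / (1 - α)) * (∫ z in tsupport ψ, timeDeriv ψ z * (v z + ε) ^ (1 - α))
      - α * (∫ z in tsupport ψ, ((v z + ε) ^ (-α - 1) * ψ z) * inner ℝ (F z) (spatialGrad v z))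
      + ∫ z in tsupport ψ, (v z + ε) ^ (-α) * inner ℝ (F z) (spatialGrad ψ z) := by
  have hc : IsCompact (tsupport ψ) := hψc
  have hrc : ∀ r : ℝ, Continuous fun z => (v z + ε) ^ r := fun r =>
    (contDiff_rpow_add hv hv0 hε r).continuous
  have hts : ∀ r : ℝ, tsupport (fun z => (v z + ε) ^ r * ψ z) ⊆ tsupport ψ := fun r =>
    tsupport_mul_subset_right
  have hcs : ∀ r : ℝ, HasCompactSupport (fun z => (v z + ε) ^ r * ψ z) := fun r =>
    hψc.mul_left
  have key := h _ ((contDiff_rpow_add hv hv0 hε (-α)).mul hψ) (hcs _) ((hts _).trans hψs)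
    fun z => mul_nonneg (Real.rpow_nonneg (by linarith [hv0 z]) _) (hψ0 z)
  have hsub : ∀ {H : Type} [NormedAddCommGroup H] [NormedSpace ℝ H] {g : E N × ℝ → H},
      (∀ z, z ∉ tsupport ψ → g z = 0) → ∫ z in halfSpace N, g z = ∫ z in tsupport ψ, g z :=
    fun hg => setIntegral_eq_of_tsupport hψs hg
  rw [hsub fun z hz => by rw [image_eq_zero_of_notMem_tsupport hz]; simp,
    hsub fun z hz => by
      rw [spatialGrad_eq_zero_of_notMem_tsupport fun h' => hz (hts _ h'), inner_zero_right]] at key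
  have i1 : IntegrableOn (fun z => ((v z + ε) ^ (-α) * ψ z) * ut z) (tsupport ψ) :=
    hut.continuousOn_mul ((hrc _).mul hψ.continuous).continuousOn hc
  have i2 : IntegrableOn (fun z => ((v z + ε) ^ (-α) * ψ z) * timeDeriv v z) (tsupport ψ) :=
    (((hrc _).mul hψ.continuous).mul (ContDiff.continuous_timeDeriv hv)).continuousOn.integrableOn_compact
      hc
  have hFi : ∀ {g : E N × ℝ → E N}, Continuous g →
      IntegrableOn (fun z => inner ℝ (F z) (g z)) (tsupport ψ) := by
    intro g hg
    obtain ⟨B, hB⟩ := hc.exists_bound_of_continuousOn hg.continuousOn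
    refine Integrable.mono' (hF.norm.const_mul B) (hF.1.inner hg.aestronglyMeasurable) ?_
    filter_upwards [ae_restrict_mem hc.measurableSet] with z hz
    calc _ ≤ ‖F z‖ * ‖g z‖ := norm_inner_le_norm _ _
      _ ≤ ‖F z‖ * B := by gcongr; exact hB z hz
      _ = _ := mul_comm _ _
  have i3 : IntegrableOn (fun z => ((v z + ε) ^ (-α - 1) * ψ z) *
      inner ℝ (F z) (spatialGrad v z)) (tsupport ψ) :=
    (hFi (ContDiff.continuous_spatialGrad hv)).continuousOn_mul
      ((hrc _).mul hψ.continuous).continuousOn hc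
  have i4 : IntegrableOn (fun z => (v z + ε) ^ (-α) * inner ℝ (F z) (spatialGrad ψ z))
      (tsupport ψ) :=
    (hFi (ContDiff.continuous_spatialGrad hψ)).continuousOn_mul (hrc _).continuousOn hc
  have i5 : IntegrableOn (fun z => timeDeriv ψ z * (v z + ε) ^ (1 - α)) (tsupport ψ) :=
    ((ContDiff.continuous_timeDeriv hψ).mul (hrc _)).continuousOn.integrableOn_compact hc
  have e1 : ∫ z in tsupport ψ, inner ℝ (F z)
      (spatialGrad (fun z => (v z + ε) ^ (-α) * ψ z) z) =
      - α * (∫ z in tsupport ψ, ((v z + ε) ^ (-α - 1) * ψ z) * inner ℝ (F z) (spatialGrad v z))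
      + ∫ z in tsupport ψ, (v z + ε) ^ (-α) * inner ℝ (F z) (spatialGrad ψ z) := by
    rw [← integral_const_mul, ← integral_add (i3.const_mul _) i4]
    refine integral_congr_ae (Eventually.of_forall fun z => ?_)
    simp only
    rw [spatialGrad_rpow_add_mul hv hv0 hε hψ, inner_add_right, inner_smul_right,
      inner_smul_right]
    ring
  -- The time derivative of (v+ε)^(1-α) ψ has zero integral; expanding it gives the identity.
  have e2 : (∫ z in tsupport ψ, ((v z + ε) ^ (-α) * ψ z) * timeDeriv v z) =
      - (1 / (1 - α)) * ∫ z in tsupport ψ, timeDeriv ψ z * (v z + ε) ^ (1 - α) := by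
    have h0 := integral_timeDeriv_eq_zero ((contDiff_rpow_add hv hv0 hε (1 - α)).mul hψ) (hcs _)
    rw [← setIntegral_eq_integral_of_forall_compl_eq_zero (s := tsupport ψ) fun z hz =>
      timeDeriv_eq_zero_of_notMem_tsupport fun h' => hz (hts _ h')] at h0
    have e3 : ∫ z in tsupport ψ, timeDeriv (fun z => (v z + ε) ^ (1 - α) * ψ z) z =
        (1 - α) * (∫ z in tsupport ψ, ((v z + ε) ^ (-α) * ψ z) * timeDeriv v z) +
        ∫ z in tsupport ψ, timeDeriv ψ z * (v z + ε) ^ (1 - α) := by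
      rw [← integral_const_mul, ← integral_add (i2.const_mul _) i5]
      refine integral_congr_ae (Eventually.of_forall fun z => ?_)
      simp only
      rw [timeDeriv_rpow_add_mul hv hv0 hε hψ, show 1 - α - 1 = -α by ring]
      ring
    have hα' : (1 - α) ≠ 0 := by linarith
    rw [e3] at h0
    field_simp
    linarith
  have e4 : (∫ z in tsupport ψ, ((v z + ε) ^ (-α) * ψ z) * (ut z - timeDeriv v z)) =
      (∫ z in tsupport ψ, ut z * ((v z + ε) ^ (-α) * ψ z)) -
      ∫ z in tsupport ψ, ((v z + ε) ^ (-α) * ψ z) * timeDeriv v z := by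
    have : (∫ z in tsupport ψ, ut z * ((v z + ε) ^ (-α) * ψ z)) =
        ∫ z in tsupport ψ, ((v z + ε) ^ (-α) * ψ z) * ut z := by
      congr 1; ext z; ring
    rw [this, ← integral_sub i1 i2]
    congr 1; ext z; ring
  rw [e1] at key
  rw [e4, e2]
  linarith

end PowerTest

/-! ### Removing the smoothness: the power test for u itself. -/

section PowerTestLimit

variable {N : ℕ}

theorem abs_rpow_add_sub_rpow_add_le {a b ε r : ℝ} (ha : 0 ≤ a) (hb : 0 ≤ b) (hε : 0 < ε)
    (hr0 : 0 ≤ r) (hr1 : r ≤ 1) :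
    |(a + ε) ^ r - (b + ε) ^ r| ≤ r * ε ^ (r - 1) * |a - b| := by
  have hd : ∀ x ∈ Ici (0 : ℝ), HasDerivWithinAt (fun x => (x + ε) ^ r)
      (r * (x + ε) ^ (r - 1)) (Ici 0) x := by
    intro x hx
    have hx' : (0 : ℝ) ≤ x := hx
    have := ((hasDerivAt_id x).add_const ε).rpow_const (p := r)
      (Or.inl (by simp only [id]; linarith))
    simpa using this.hasDerivWithinAt
  refine (convex_Ici (0 : ℝ)).norm_image_sub_le_of_norm_hasDerivWithin_le hd (fun x hx => ?_)
    hb ha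
  have hx' : (0 : ℝ) ≤ x := hx
  rw [Real.norm_of_nonneg (mul_nonneg hr0 (Real.rpow_nonneg (by linarith) _))]
  exact mul_le_mul_of_nonneg_left
    (Real.rpow_le_rpow_of_nonpos hε (by linarith) (by linarith)) hr0

theorem rpow_add_le_of_nonpos {a ε r : ℝ} (ha : 0 ≤ a) (hε : 0 < ε) (hr : r ≤ 0) :
    (a + ε) ^ r ≤ ε ^ r :=
  Real.rpow_le_rpow_of_nonpos hε (by linarith) hr

theorem ofReal_holderTriple {m : ℝ} (hm : 1 < m) :
    ENNReal.HolderTriple (ENNReal.ofReal (m / (m - 1))) (ENNReal.ofReal m) 1 := by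
  have h := (Real.HolderConjugate.conjExponent hm).symm
  refine ⟨?_⟩
  rw [Real.conjExponent] at h
  rw [← ENNReal.ofReal_inv_of_pos h.pos, ← ENNReal.ofReal_inv_of_pos (by linarith),
    ← ENNReal.ofReal_add (inv_nonneg.2 h.nonneg) (by positivity), h.inv_add_inv_eq_one]
  simp

variable {m : ℝ} {u ut : E N × ℝ → ℝ} {Du F : E N × ℝ → E N} {ψ : E N × ℝ → ℝ}

/-- Let v → u in W^{1,m} on the support of ψ. The negative powers of v+ε are bounded by powers of ε,
and F·∇v converges in L¹ by Hölder, so every term passes to the limit and the one with u_t - v_t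
vanishes. -/
theorem IsInteriorSupersolution.power_test (h : IsInteriorSupersolution ut F) (hm : 1 < m)
    (hS : IsSobolevLoc m u ut Du) (hF : MemLpLoc F (m / (m - 1)))
    (hu : ∀ᵐ z ∂(volume.restrict (halfSpace N)), 0 ≤ u z)
    (hψ : ContDiff ℝ 1 ψ) (hψc : HasCompactSupport ψ) (hψs : tsupport ψ ⊆ halfSpace N)
    (hψ0 : ∀ z, 0 ≤ ψ z) {ε : ℝ} (hε : 0 < ε) {α : ℝ} (hα0 : 0 < α) (hα : α < 1) :
    α * (∫ z in tsupport ψ, ((u z + ε) ^ (-α - 1) * ψ z) * inner ℝ (F z) (Du z)) ≤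
      - (1 / (1 - α)) * (∫ z in tsupport ψ, timeDeriv ψ z * (u z + ε) ^ (1 - α))
      + ∫ z in tsupport ψ, (u z + ε) ^ (-α) * inner ℝ (F z) (spatialGrad ψ z) := by
  have hc : IsCompact (tsupport ψ) := hψc
  set μ : Measure (E N × ℝ) := volume.restrict (tsupport ψ) with hμ
  have : IsFiniteMeasure μ := ⟨by simpa [hμ] using hc.measure_lt_top⟩
  have hT := ofReal_holderTriple hm
  have hm1 : 1 ≤ ENNReal.ofReal m := by simpa using ENNReal.ofReal_le_ofReal hm.le
  have hu' : ∀ᵐ z ∂μ, 0 ≤ u z := ae_restrict_of_ae_restrict_of_subset hψs hu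
  have huL : MemLp u (ENNReal.ofReal m) μ := hS.memLp _ hc hψs
  have hutL : MemLp ut (ENNReal.ofReal m) μ := hS.memLp_time _ hc hψs
  have hDuL : MemLp Du (ENNReal.ofReal m) μ := hS.memLp_grad _ hc hψs
  have hFL : MemLp F (ENNReal.ofReal (m / (m - 1))) μ := hF _ hc hψs
  have hFi : Integrable F μ := by
    refine hFL.integrable ?_
    rw [← ENNReal.ofReal_one]
    exact ENNReal.ofReal_le_ofReal (by rw [le_div_iff₀ (by linarith)]; linarith)
  obtain ⟨v, hvc, hv0, hvu, hvt, hvD⟩ := hS.exists_approx hm.le hu hc hψs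
  -- A subsequence converging almost everywhere makes the powers of v+ε converge pointwise.
  obtain ⟨ns, hns, hae⟩ := (tendstoInMeasure_of_tendsto_eLpNorm (one_pos.trans_le hm1).ne'
    (fun n => (hvc n).continuous.aestronglyMeasurable) huL.1 hvu).exists_seq_tendsto_ae
  have hnst := hns.tendsto_atTop
  have hcont : ∀ n (r : ℝ), Continuous fun z => (v (ns n) z + ε) ^ r := fun n r =>
    (contDiff_rpow_add (hvc _) (hv0 _) hε r).continuous
  have hlim : ∀ r : ℝ, ∀ᵐ z ∂μ, Tendsto (fun n => (v (ns n) z + ε) ^ r) atTop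
      (𝓝 ((u z + ε) ^ r)) := by
    intro r
    filter_upwards [hae, hu'] with z hz hz0
    exact (hz.add_const ε).rpow_const (Or.inl (by linarith))
  have L1 : ∀ {g : ℕ → E N × ℝ → ℝ}, (∀ n, AEStronglyMeasurable (g n) μ) →
      Tendsto (fun n => eLpNorm (g n) (ENNReal.ofReal m) μ) atTop (𝓝 0) →
      Tendsto (fun n => eLpNorm (g n) 1 μ) atTop (𝓝 0) := by
    intro g hgm hg
    have h2 := ENNReal.Tendsto.mul_const (b := μ univ ^ (1 / (1 : ℝ≥0∞).toReal -
      1 / (ENNReal.ofReal m).toReal)) hg (Or.inr (ENNReal.rpow_ne_top_of_nonneg (by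
        rw [ENNReal.toReal_ofReal (by linarith), ENNReal.toReal_one, sub_nonneg]
        rw [div_le_div_iff₀ (by linarith) one_pos]; linarith) (measure_ne_top μ univ)))
    rw [zero_mul] at h2
    exact tendsto_of_tendsto_of_tendsto_of_le_of_le tendsto_const_nhds h2 (fun _ => zero_le)
      fun n => eLpNorm_le_eLpNorm_mul_rpow_measure_univ hm1 (hgm n)
  obtain ⟨B, hB⟩ := hc.exists_bound_of_continuousOn hψ.continuous.continuousOn
  have hbd : ∀ r : ℝ, r ≤ 0 → ∀ n, ∀ᵐ z ∂μ, |(v (ns n) z + ε) ^ r * ψ z| ≤ ε ^ r * B := by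
    intro r hr n
    filter_upwards [ae_restrict_mem hc.measurableSet] with z hz
    have h0 : 0 ≤ (v (ns n) z + ε) ^ r := Real.rpow_nonneg (by linarith [hv0 (ns n) z]) r
    rw [abs_mul, abs_of_nonneg h0]
    exact mul_le_mul (rpow_add_le_of_nonpos (hv0 _ _) hε hr) (hB z hz) (abs_nonneg _)
      (by positivity)
  have hbd' : ∀ n, ∀ᵐ z ∂μ, |(v (ns n) z + ε) ^ (-α)| ≤ ε ^ (-α) := by
    intro n
    refine Eventually.of_forall fun z => ?_
    rw [abs_of_nonneg (Real.rpow_nonneg (by linarith [hv0 (ns n) z]) _)]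
    exact rpow_add_le_of_nonpos (hv0 _ _) hε (by linarith)
  have hFinner : ∀ {G : E N × ℝ → E N}, MemLp G (ENNReal.ofReal m) μ →
      Integrable (fun z => inner ℝ (F z) (G z)) μ := fun {G} hG =>
    memLp_one_iff_integrable.1 (MemLp.of_bilin (p := ENNReal.ofReal (m / (m - 1)))
      (q := ENNReal.ofReal m) (fun x y : E N => inner ℝ x y) 1 hFL hG (hFL.1.inner hG.1)
      (Eventually.of_forall fun z => by simpa using nnnorm_inner_le_nnnorm (𝕜 := ℝ) _ _))
  have hgradL : ∀ {w : E N × ℝ → ℝ}, ContDiff ℝ 1 w →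
      MemLp (spatialGrad w) (ENNReal.ofReal m) μ := fun {w} hw => by
    obtain ⟨B', hB'⟩ := hc.exists_bound_of_continuousOn
      (ContDiff.continuous_spatialGrad hw).continuousOn
    refine MemLp.of_bound (ContDiff.continuous_spatialGrad hw).aestronglyMeasurable B' ?_
    filter_upwards [ae_restrict_mem hc.measurableSet] with z hz using hB' z hz
  have t1 : Tendsto (fun n => ∫ z, ((v (ns n) z + ε) ^ (-α) * ψ z) *
      (ut z - timeDeriv (v (ns n)) z) ∂μ) atTop (𝓝 (∫ z, ((u z + ε) ^ (-α) * ψ z) * 0 ∂μ)) := by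
    have hcv : ∀ n, Integrable (timeDeriv (v (ns n))) μ := fun n =>
      (ContDiff.continuous_timeDeriv (hvc _)).continuousOn.integrableOn_compact hc
    refine tendsto_integral_mul_of_bounded (g₀ := fun _ => 0)
      (g := fun n z => ut z - timeDeriv (v (ns n)) z)
      (fun n => ((hcont n _).mul hψ.continuous).aestronglyMeasurable) (hbd (-α) (by linarith)) ?_
      (fun n => (hutL.integrable hm1).sub (hcv n)) (integrable_zero _ _ _) ?_
    · filter_upwards [hlim (-α)] with z hz using hz.mul_const _
    · refine L1 (fun n => ((hutL.1.sub (hcv n).1).sub aestronglyMeasurable_const)) ?_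
      refine (hvt.comp hnst).congr fun n => ?_
      simp only [Function.comp]
      rw [eLpNorm_sub_comm]
      congr 1
      ext z; simp
  have t2 : Tendsto (fun n => ∫ z, timeDeriv ψ z * (v (ns n) z + ε) ^ (1 - α) ∂μ) atTop
      (𝓝 (∫ z, timeDeriv ψ z * (u z + ε) ^ (1 - α) ∂μ)) := by
    obtain ⟨B', hB'⟩ := hc.exists_bound_of_continuousOn
      (ContDiff.continuous_timeDeriv hψ).continuousOn
    have hmeas : AEStronglyMeasurable (fun z => (u z + ε) ^ (1 - α)) μ :=
      ((huL.1.aemeasurable.add_const ε).pow_const _).aestronglyMeasurable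
    have hgi : ∀ n, Integrable (fun z => (v (ns n) z + ε) ^ (1 - α)) μ := fun n =>
      (hcont n _).continuousOn.integrableOn_compact hc
    -- As 0 < 1-α < 1, the power 1-α is Lipschitz on [ε, ∞), so L¹ convergence of v suffices for
    -- this term.
    have hle : ∀ n, ∀ᵐ z ∂μ, ‖((v (ns n) z + ε) ^ (1 - α)) - (u z + ε) ^ (1 - α)‖ ≤
        (1 - α) * ε ^ (1 - α - 1) * ‖(v (ns n) - u) z‖ := by
      intro n
      filter_upwards [hu'] with z hz
      exact abs_rpow_add_sub_rpow_add_le (hv0 _ _) hz hε (by linarith) (by linarith)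
    have hvi : ∀ n, Integrable (v (ns n) - u) μ := fun n =>
      Integrable.sub ((hvc _).continuous.continuousOn.integrableOn_compact hc)
        (huL.integrable hm1)
    refine tendsto_integral_mul_of_bounded (b := fun _ => timeDeriv ψ) (B := B')
      (fun n => (ContDiff.continuous_timeDeriv hψ).aestronglyMeasurable)
      (fun n => by filter_upwards [ae_restrict_mem hc.measurableSet] with z hz using hB' z hz)
      (Eventually.of_forall fun z => tendsto_const_nhds) hgi ?_ ?_
    · have h0 : Integrable (fun z => (v (ns 0) z + ε) ^ (1 - α) - (u z + ε) ^ (1 - α)) μ :=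
        ((hvi 0).norm.const_mul _).mono' ((hgi 0).1.sub hmeas) (hle 0)
      refine ((hgi 0).sub h0).congr (Eventually.of_forall fun z => ?_)
      simp
    · have h1 := L1 (fun n => (hvi n).1) (hvu.comp hnst)
      have h2 := ENNReal.Tendsto.const_mul (a := ENNReal.ofReal ((1 - α) * ε ^ (1 - α - 1))) h1
        (Or.inr ENNReal.ofReal_ne_top)
      rw [mul_zero] at h2
      exact tendsto_of_tendsto_of_tendsto_of_le_of_le tendsto_const_nhds h2 (fun _ => zero_le)
        fun n => eLpNorm_le_mul_eLpNorm_of_ae_le_mul (hle n) 1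
  have t3 : Tendsto (fun n => ∫ z, ((v (ns n) z + ε) ^ (-α - 1) * ψ z) *
      inner ℝ (F z) (spatialGrad (v (ns n)) z) ∂μ) atTop
      (𝓝 (∫ z, ((u z + ε) ^ (-α - 1) * ψ z) * inner ℝ (F z) (Du z) ∂μ)) := by
    refine tendsto_integral_mul_of_bounded
      (fun n => ((hcont n _).mul hψ.continuous).aestronglyMeasurable)
      (hbd (-α - 1) (by linarith)) ?_ (fun n => hFinner (hgradL (hvc _))) (hFinner hDuL) ?_
    · filter_upwards [hlim (-α - 1)] with z hz using hz.mul_const _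
    · have h2 := ENNReal.Tendsto.const_mul (a := eLpNorm F (ENNReal.ofReal (m / (m - 1))) μ)
        (hvD.comp hnst) (Or.inr hFL.2.ne)
      rw [mul_zero] at h2
      refine tendsto_of_tendsto_of_tendsto_of_le_of_le tendsto_const_nhds h2 (fun _ => zero_le)
        fun n => ?_
      have h3 := eLpNorm_le_eLpNorm_mul_eLpNorm'_of_norm (p := ENNReal.ofReal (m / (m - 1)))
        (q := ENNReal.ofReal m) (r := 1) hFL.1
        ((hgradL (hvc (ns n))).1.sub hDuL.1) (fun x y : E N => inner ℝ x y) 1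
        (Eventually.of_forall fun z => by
          simpa using norm_inner_le_norm (𝕜 := ℝ) (F z) ((spatialGrad (v (ns n)) - Du) z))
      refine (le_of_eq ?_).trans (h3.trans (le_of_eq (by
        rw [ENNReal.coe_one, one_mul]; rfl)))
      congr 1
      ext z
      simp [inner_sub_right]
  have t4 : Tendsto (fun n => ∫ z, (v (ns n) z + ε) ^ (-α) *
      inner ℝ (F z) (spatialGrad ψ z) ∂μ) atTop
      (𝓝 (∫ z, (u z + ε) ^ (-α) * inner ℝ (F z) (spatialGrad ψ z) ∂μ)) :=
    tendsto_integral_mul_of_bounded (g := fun _ z => inner ℝ (F z) (spatialGrad ψ z))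
      (fun n => (hcont n _).aestronglyMeasurable) hbd' (hlim _)
      (fun n => hFinner (hgradL hψ)) (hFinner (hgradL hψ)) (by simp)
  have key := ge_of_tendsto' (((t1.sub (t2.const_mul (1 / (1 - α)))).sub (t3.const_mul α)).add t4)
    fun n => h.smooth_power_test hψ hψc hψs hψ0 (hutL.integrable hm1) hFi (hvc (ns n)) (hv0 _)
      hε hα
  simp only [mul_zero, integral_zero] at key
  linarith

end PowerTestLimit

/-! ### Weighted Young inequality, product cutoffs and interior weak inequalities. -/

section WeightedTest

variable {N : ℕ}

/-- True also without integrability, since the Bochner integral is then 0; upper bounds can be moved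
to `ℝ≥0∞` without integrability checks. -/
theorem ofReal_integral_le_lintegral_ofReal {α : Type*} [MeasurableSpace α] {μ : Measure α}
    (f : α → ℝ) : ENNReal.ofReal (∫ x, f x ∂μ) ≤ ∫⁻ x, ENNReal.ofReal (f x) ∂μ := by
  by_cases hf : Integrable f μ
  · rw [integral_eq_lintegral_pos_part_sub_lintegral_neg_part hf]
    exact (ENNReal.ofReal_le_ofReal (sub_le_self _ ENNReal.toReal_nonneg)).trans
      ENNReal.ofReal_toReal_le
  · simp [integral_undef hf]

/-- Young's inequality with the weights which occur for power-type test functions. -/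
theorem mul_le_young_weight {m : ℝ} (hm : 1 < m) {a b δ χ w W : ℝ} (ha : 0 ≤ a) (hb : 0 ≤ b)
    (hδ : 0 < δ) (hχ : 0 ≤ χ) (hw : 0 < w) (hW : 0 ≤ W) (hbW : b ^ m ≤ W * χ ^ (m - 1)) :
    a * b ≤ δ * a ^ (m / (m - 1)) * χ * w + δ ^ (1 - m) * w ^ (1 - m) * W := by
  have hm0 : 0 < m := by linarith
  have hm1 : 0 < m - 1 := by linarith
  -- Where the cutoff vanishes, so does its gradient, by the hypothesis on b.
  rcases hχ.eq_or_lt with rfl | hχ0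
  · rw [Real.zero_rpow hm1.ne', mul_zero] at hbW
    have hb0 : b = 0 := by
      by_contra h
      exact absurd hbW (not_le.2 (Real.rpow_pos_of_pos (lt_of_le_of_ne hb (Ne.symm h)) m))
    subst hb0
    simp only [mul_zero, zero_mul, zero_add]
    positivity
  · have hc := (Real.HolderConjugate.conjExponent hm).symm
    rw [Real.conjExponent] at hc
    -- Chosen so that (a s)^{m'} is exactly the first term of the right-hand side.
    set s : ℝ := (δ * χ * w) ^ ((m - 1) / m) with hs
    have hs0 : 0 < s := by positivity
    have h1 := Real.young_inequality_of_nonneg (mul_nonneg ha hs0.le) (div_nonneg hb hs0.le) hc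
    have e1 : a * s * (b / s) = a * b := by field_simp
    have e2 : (a * s) ^ (m / (m - 1)) = δ * a ^ (m / (m - 1)) * χ * w := by
      rw [Real.mul_rpow ha hs0.le, hs, ← Real.rpow_mul (by positivity),
        show (m - 1) / m * (m / (m - 1)) = 1 by field_simp, Real.rpow_one]
      ring
    have e3 : (b / s) ^ m ≤ δ ^ (1 - m) * w ^ (1 - m) * W := by
      rw [Real.div_rpow hb hs0.le, hs, ← Real.rpow_mul (by positivity),
        div_mul_cancel₀ _ hm0.ne', div_le_iff₀ (by positivity),
        Real.mul_rpow (by positivity) hw.le, Real.mul_rpow hδ.le hχ]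
      have e4 : ∀ x : ℝ, 0 < x → x ^ (1 - m) * x ^ (m - 1) = 1 := fun x hx => by
        rw [← Real.rpow_add hx]; simp
      calc b ^ m ≤ W * χ ^ (m - 1) := hbW
        _ = (δ ^ (1 - m) * δ ^ (m - 1)) * (w ^ (1 - m) * w ^ (m - 1)) * (W * χ ^ (m - 1)) := by
            rw [e4 δ hδ, e4 w hw]; ring
        _ = _ := by ring
    rw [e1] at h1
    refine h1.trans (add_le_add ?_ ?_)
    · rw [← e2]
      exact div_le_self (by positivity) hc.lt.le
    · exact (div_le_self (by positivity) hm.le).trans e3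

variable {χ : E N → ℝ} {ζ : ℝ → ℝ}

theorem tsupport_mul_prod_subset :
    tsupport (fun z : E N × ℝ => χ z.1 * ζ z.2) ⊆ tsupport χ ×ˢ tsupport ζ := by
  refine closure_minimal (fun z hz => ?_) ((isClosed_tsupport _).prod (isClosed_tsupport _))
  have hz' : χ z.1 * ζ z.2 ≠ 0 := hz
  exact ⟨subset_tsupport _ (left_ne_zero_of_mul hz'), subset_tsupport _ (right_ne_zero_of_mul hz')⟩

theorem hasCompactSupport_mul_prod (hχ : HasCompactSupport χ) (hζ : HasCompactSupport ζ) :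
    HasCompactSupport (fun z : E N × ℝ => χ z.1 * ζ z.2) :=
  (IsCompact.prod hχ hζ).of_isClosed_subset (isClosed_tsupport _) tsupport_mul_prod_subset

theorem contDiff_mul_prod (hχ : ContDiff ℝ 1 χ) (hζ : ContDiff ℝ 1 ζ) :
    ContDiff ℝ 1 (fun z : E N × ℝ => χ z.1 * ζ z.2) :=
  (hχ.comp contDiff_fst).mul (hζ.comp contDiff_snd)

theorem timeDeriv_mul_prod (z : E N × ℝ) :
    timeDeriv (fun z : E N × ℝ => χ z.1 * ζ z.2) z = χ z.1 * deriv ζ z.2 := by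
  simp [timeDeriv]

theorem spatialGrad_mul_prod (hχ : ContDiff ℝ 1 χ) (z : E N × ℝ) :
    spatialGrad (fun z : E N × ℝ => χ z.1 * ζ z.2) z = ζ z.2 • gradient χ z.1 := by
  have hd := hχ.differentiable one_ne_zero z.1
  simp only [spatialGrad, gradient]
  have : fderiv ℝ (fun x => χ x * ζ z.2) z.1 = ζ z.2 • fderiv ℝ χ z.1 := by
    rw [fderiv_mul_const hd]
  rw [this]
  simp

/-- `∬ f φ ≤ ∬ u_t φ + ∬ F·∇φ` for all `0 ≤ φ ∈ C¹_c(ℝ^N × (0,∞))`. -/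
def IsInteriorWeakIneq (f : E N × ℝ → ℝ≥0∞) (ut : E N × ℝ → ℝ) (F : E N × ℝ → E N) : Prop :=
  ∀ φ : E N × ℝ → ℝ, ContDiff ℝ 1 φ → HasCompactSupport φ → tsupport φ ⊆ halfSpace N →
    (∀ z, 0 ≤ φ z) →
    ((∫⁻ z in halfSpace N, f z * ENNReal.ofReal (φ z) : ℝ≥0∞) : EReal) ≤
      (((∫ z in halfSpace N, ut z * φ z) +
        ∫ z in halfSpace N, inner ℝ (F z) (spatialGrad φ z) : ℝ) : EReal)

variable {f : E N × ℝ → ℝ≥0∞} {m : ℝ} {u ut : E N × ℝ → ℝ} {Du F : E N × ℝ → E N}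

theorem IsInteriorWeakIneq.isInteriorSupersolution (h : IsInteriorWeakIneq f ut F) :
    IsInteriorSupersolution ut F := fun φ h1 h2 h3 h4 => by
  have := (EReal.coe_ennreal_nonneg _).trans (h φ h1 h2 h3 h4)
  exact_mod_cast this

theorem IsInteriorWeakIneq.lintegral_le (h : IsInteriorWeakIneq f ut F) {φ : E N × ℝ → ℝ}
    (h1 : ContDiff ℝ 1 φ) (h2 : HasCompactSupport φ) (h3 : tsupport φ ⊆ halfSpace N)
    (h4 : ∀ z, 0 ≤ φ z) :
    ∫⁻ z in halfSpace N, f z * ENNReal.ofReal (φ z) ≤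
      ENNReal.ofReal ((∫ z in halfSpace N, ut z * φ z) +
        ∫ z in halfSpace N, inner ℝ (F z) (spatialGrad φ z)) := by
  have h0 := h.isInteriorSupersolution φ h1 h2 h3 h4
  have := h φ h1 h2 h3 h4
  rw [← EReal.coe_ennreal_le_coe_ennreal_iff, EReal.coe_ennreal_ofReal, max_eq_left h0]
  exact this

/-- The half-space is a countable union of compact sets, and measurability is local on such a union.
-/
theorem MemLpLoc.aestronglyMeasurable {H : Type*} [NormedAddCommGroup H] {g : E N × ℝ → H}
    {r : ℝ} (h : MemLpLoc g r) : AEStronglyMeasurable g (volume.restrict (halfSpace N)) := by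
  obtain ⟨K, hK⟩ : ∃ K : ℕ → Set (E N × ℝ), (∀ n, IsCompact (K n)) ∧
      ⋃ n, K n = halfSpace N := by
    refine ⟨fun n => Metric.closedBall 0 n ×ˢ Icc (1 / ((n : ℝ) + 1)) n, fun n =>
      (isCompact_closedBall _ _).prod isCompact_Icc, ?_⟩
    ext z
    simp only [mem_iUnion, mem_prod, mem_closedBall_zero_iff, mem_Icc, halfSpace, mem_ofPred_eq]
    constructor
    · rintro ⟨n, -, h1, -⟩
      exact lt_of_lt_of_le (by positivity) h1
    · intro hz
      obtain ⟨n1, hn1⟩ := exists_nat_ge ‖z.1‖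
      obtain ⟨n2, hn2⟩ := exists_nat_ge z.2
      obtain ⟨n3, hn3⟩ := exists_nat_one_div_lt hz
      have a1 : (n1 : ℝ) ≤ (n1 + n2 + n3 : ℕ) := by push_cast; nlinarith [n2.cast_nonneg (α := ℝ), n3.cast_nonneg (α := ℝ)]
      have a2 : (n2 : ℝ) ≤ (n1 + n2 + n3 : ℕ) := by push_cast; nlinarith [n1.cast_nonneg (α := ℝ), n3.cast_nonneg (α := ℝ)]
      have a3 : (n3 : ℝ) ≤ (n1 + n2 + n3 : ℕ) := by push_cast; nlinarith [n2.cast_nonneg (α := ℝ), n1.cast_nonneg (α := ℝ)]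
      refine ⟨n1 + n2 + n3, hn1.trans a1, le_trans ?_ hn3.le, hn2.trans a2⟩
      exact one_div_le_one_div_of_le (by positivity) (by linarith)
  rw [← hK.2, aestronglyMeasurable_iUnion_iff]
  exact fun n => (h (K n) (hK.1 n) (hK.2 ▸ subset_iUnion K n)).1

end WeightedTest

/-! ### The two capacity estimates. -/

section WeightedTestMain

variable {N : ℕ} {f : E N × ℝ → ℝ≥0∞} {m : ℝ} {u ut : E N × ℝ → ℝ} {Du F : E N × ℝ → E N}
  {χ : E N → ℝ} {ζ : ℝ → ℝ} {D : ℝ → ℝ} {W : E N → ℝ}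

/-- `χ(x) ζ(t)` is a nonnegative `C¹` cutoff supported in `t > 0`, with bounds `D` for `(ζ')⁻`
and `W` for `|∇χ|^m χ^(1-m)`. -/
structure IsCutoff (m : ℝ) (χ : E N → ℝ) (ζ : ℝ → ℝ) (D : ℝ → ℝ) (W : E N → ℝ) : Prop where
  contDiff_space : ContDiff ℝ 1 χ
  compact_space : HasCompactSupport χ
  nonneg_space : ∀ x, 0 ≤ χ x
  contDiff_time : ContDiff ℝ 1 ζ
  compact_time : HasCompactSupport ζ
  nonneg_time : ∀ t, 0 ≤ ζ t
  tsupport_time : tsupport ζ ⊆ Ioi 0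
  measurable_D : Measurable D
  nonneg_D : ∀ t, 0 ≤ D t
  deriv_le : ∀ t, -deriv ζ t ≤ D t
  measurable_W : Measurable W
  nonneg_W : ∀ x, 0 ≤ W x
  gradient_le : ∀ x, ‖gradient χ x‖ ^ m ≤ W x * χ x ^ (m - 1)

theorem IsCutoff.tsupport_subset (hc : IsCutoff m χ ζ D W) :
    tsupport (fun z : E N × ℝ => χ z.1 * ζ z.2) ⊆ halfSpace N :=
  fun _ hz => hc.tsupport_time (tsupport_mul_prod_subset hz).2

theorem IsCutoff.nonneg (hc : IsCutoff m χ ζ D W) (z : E N × ℝ) : 0 ≤ χ z.1 * ζ z.2 :=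
  mul_nonneg (hc.nonneg_space _) (hc.nonneg_time _)

/-- The integral of `|F|^{m'} (u+ε)^{-1-α} χ ζ` is controlled by lower order terms. -/
theorem IsInteriorWeakIneq.flux_le (h : IsInteriorWeakIneq f ut F) (hm : 1 < m)
    (hS : IsSobolevLoc m u ut Du) (hF : MemLpLoc F (m / (m - 1)))
    (hu : ∀ᵐ z ∂(volume.restrict (halfSpace N)), 0 ≤ u z) {c₀ : ℝ} (hc₀ : 0 < c₀)
    (hco : ∀ᵐ z ∂(volume.restrict (halfSpace N)),
      c₀ * ‖F z‖ ^ (m / (m - 1)) ≤ inner ℝ (F z) (Du z))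
    {α : ℝ} (hα0 : 0 < α) (hα1 : α < 1) (hc : IsCutoff m χ ζ D W) {ε : ℝ} (hε : 0 < ε) :
    ENNReal.ofReal (α * c₀ / 2) * ∫⁻ z in tsupport (fun z : E N × ℝ => χ z.1 * ζ z.2),
        ENNReal.ofReal (‖F z‖ ^ (m / (m - 1)) * χ z.1 * ζ z.2 * (u z + ε) ^ (-α - 1)) ≤
      ENNReal.ofReal (1 / (1 - α)) * (∫⁻ z in tsupport (fun z : E N × ℝ => χ z.1 * ζ z.2),
        ENNReal.ofReal ((u z + ε) ^ (1 - α) * (χ z.1 * D z.2))) +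
      ENNReal.ofReal ((α * c₀ / 2) ^ (1 - m)) *
        ∫⁻ z in tsupport (fun z : E N × ℝ => χ z.1 * ζ z.2),
        ENNReal.ofReal ((u z + ε) ^ (m - 1 - α) * (W z.1 * ζ z.2)) := by
  set ψ : E N × ℝ → ℝ := fun z => χ z.1 * ζ z.2 with hψdef
  have hψs : tsupport ψ ⊆ halfSpace N := hc.tsupport_subset
  have hψc : HasCompactSupport ψ := hasCompactSupport_mul_prod hc.compact_space hc.compact_time
  have hψ : ContDiff ℝ 1 ψ := contDiff_mul_prod hc.contDiff_space hc.contDiff_time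
  have hK : IsCompact (tsupport ψ) := hψc
  set μ : Measure (E N × ℝ) := volume.restrict (tsupport ψ) with hμ
  have hT := ofReal_holderTriple hm
  have hu' : ∀ᵐ z ∂μ, 0 ≤ u z := ae_restrict_of_ae_restrict_of_subset hψs hu
  have hco' : ∀ᵐ z ∂μ, c₀ * ‖F z‖ ^ (m / (m - 1)) ≤ inner ℝ (F z) (Du z) :=
    ae_restrict_of_ae_restrict_of_subset hψs hco
  have huM : AEMeasurable u μ := (hS.memLp _ hK hψs).1.aemeasurable
  have hm' : 0 < m / (m - 1) := div_pos (by linarith) (by linarith)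
  -- Coercivity yields α c₀ Y = 2δY on the left; Young's inequality spends one δY and the other
  -- remains.
  set δ : ℝ := α * c₀ / 2 with hδ
  have hδ0 : 0 < δ := by positivity
  have hFL := hF _ hK hψs
  have hFp : Integrable (fun z => ‖F z‖ ^ (m / (m - 1))) μ := by
    have := hFL.integrable_norm_rpow (by simpa using hm') ENNReal.ofReal_ne_top
    rwa [ENNReal.toReal_ofReal hm'.le] at this
  have hFD : Integrable (fun z => inner ℝ (F z) (Du z)) μ :=
    memLp_one_iff_integrable.1 (MemLp.of_bilin (p := ENNReal.ofReal (m / (m - 1)))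
      (q := ENNReal.ofReal m) (fun x y : E N => inner ℝ x y) 1 hFL (hS.memLp_grad _ hK hψs)
      (hFL.1.inner (hS.memLp_grad _ hK hψs).1)
      (Eventually.of_forall fun z => by simpa using nnnorm_inner_le_nnnorm (𝕜 := ℝ) _ _))
  obtain ⟨B, hB⟩ := hK.exists_bound_of_continuousOn hψ.continuous.continuousOn
  have hwm : AEStronglyMeasurable (fun z => (u z + ε) ^ (-α - 1) * ψ z) μ :=
    (((huM.add_const ε).pow_const _).mul hψ.continuous.aemeasurable).aestronglyMeasurable
  have hwb : ∀ᵐ z ∂μ, ‖(u z + ε) ^ (-α - 1) * ψ z‖ ≤ ε ^ (-α - 1) * B := by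
    filter_upwards [hu', ae_restrict_mem hK.measurableSet] with z hz hzK
    rw [norm_mul, Real.norm_of_nonneg (Real.rpow_nonneg (by linarith) _)]
    exact mul_le_mul (rpow_add_le_of_nonpos hz hε (by linarith)) (hB z hzK) (norm_nonneg _)
      (by positivity)
  have hy : ∀ z, ‖F z‖ ^ (m / (m - 1)) * χ z.1 * ζ z.2 * (u z + ε) ^ (-α - 1) =
      ((u z + ε) ^ (-α - 1) * ψ z) * ‖F z‖ ^ (m / (m - 1)) := fun z => by
    simp only [hψdef]; ring
  have hyi : Integrable (fun z => ‖F z‖ ^ (m / (m - 1)) * χ z.1 * ζ z.2 *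
      (u z + ε) ^ (-α - 1)) μ := by
    simp only [hy]
    exact hFp.bdd_mul hwm hwb
  have hy0 : ∀ᵐ z ∂μ, 0 ≤ ‖F z‖ ^ (m / (m - 1)) * χ z.1 * ζ z.2 * (u z + ε) ^ (-α - 1) := by
    filter_upwards [hu'] with z hz
    rw [hy]
    exact mul_nonneg (mul_nonneg (Real.rpow_nonneg (by linarith) _) (hc.nonneg z))
      (Real.rpow_nonneg (norm_nonneg _) _)
  have hYe := ofReal_integral_eq_lintegral_ofReal hyi hy0
  set Y := ∫⁻ z, ENNReal.ofReal (‖F z‖ ^ (m / (m - 1)) * χ z.1 * ζ z.2 *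
    (u z + ε) ^ (-α - 1)) ∂μ with hY
  -- Finiteness of Y permits cancelling δY at the end; it holds because F is in L^{m'} on the
  -- support and (u+ε)^(-α-1) is at most ε^(-α-1).
  have hYtop : Y ≠ ∞ := by rw [← hYe]; exact ENNReal.ofReal_ne_top
  have key := h.isInteriorSupersolution.power_test hm hS hF hu hψ hψc hψs hc.nonneg hε hα0 hα1
  have hlow : c₀ * ∫ z, ‖F z‖ ^ (m / (m - 1)) * χ z.1 * ζ z.2 * (u z + ε) ^ (-α - 1) ∂μ ≤
      ∫ z, ((u z + ε) ^ (-α - 1) * ψ z) * inner ℝ (F z) (Du z) ∂μ := by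
    rw [← integral_const_mul]
    refine integral_mono_ae (hyi.const_mul _) (hFD.bdd_mul hwm hwb) ?_
    filter_upwards [hu', hco'] with z hz hz'
    simp only [hy]
    calc c₀ * (((u z + ε) ^ (-α - 1) * ψ z) * ‖F z‖ ^ (m / (m - 1)))
        = ((u z + ε) ^ (-α - 1) * ψ z) * (c₀ * ‖F z‖ ^ (m / (m - 1))) := by ring
      _ ≤ _ := mul_le_mul_of_nonneg_left hz' (mul_nonneg (Real.rpow_nonneg (by linarith) _)
        (hc.nonneg z))
  have h1α : 0 < 1 / (1 - α) := one_div_pos.2 (by linarith)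
  have hA : ENNReal.ofReal (-(1 / (1 - α)) * ∫ z, timeDeriv ψ z * (u z + ε) ^ (1 - α) ∂μ) ≤
      ENNReal.ofReal (1 / (1 - α)) *
        ∫⁻ z, ENNReal.ofReal ((u z + ε) ^ (1 - α) * (χ z.1 * D z.2)) ∂μ := by
    rw [show -(1 / (1 - α)) * ∫ z, timeDeriv ψ z * (u z + ε) ^ (1 - α) ∂μ =
        (1 / (1 - α)) * ∫ z, -(timeDeriv ψ z * (u z + ε) ^ (1 - α)) ∂μ by
      rw [integral_neg]; ring, ENNReal.ofReal_mul h1α.le]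
    gcongr
    refine (ofReal_integral_le_lintegral_ofReal _).trans (lintegral_mono_ae ?_)
    filter_upwards [hu'] with z hz
    refine ENNReal.ofReal_le_ofReal ?_
    rw [timeDeriv_mul_prod]
    calc -(χ z.1 * deriv ζ z.2 * (u z + ε) ^ (1 - α))
        = (u z + ε) ^ (1 - α) * (χ z.1 * -deriv ζ z.2) := by ring
      _ ≤ _ := mul_le_mul_of_nonneg_left (mul_le_mul_of_nonneg_left (hc.deriv_le _)
        (hc.nonneg_space _)) (Real.rpow_nonneg (by linarith) _)
  have hB' : ENNReal.ofReal (∫ z, (u z + ε) ^ (-α) * inner ℝ (F z) (spatialGrad ψ z) ∂μ) ≤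
      ENNReal.ofReal δ * Y + ENNReal.ofReal (δ ^ (1 - m)) *
        ∫⁻ z, ENNReal.ofReal ((u z + ε) ^ (m - 1 - α) * (W z.1 * ζ z.2)) ∂μ := by
    rw [hY, ← lintegral_const_mul' _ _ ENNReal.ofReal_ne_top,
      ← lintegral_const_mul' _ _ ENNReal.ofReal_ne_top, ← lintegral_add_left'
        (hyi.1.aemeasurable.ennreal_ofReal.const_mul _)]
    refine (ofReal_integral_le_lintegral_ofReal _).trans (lintegral_mono_ae ?_)
    filter_upwards [hu', hy0] with z hz hyz
    have hpos : 0 < u z + ε := by linarith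
    have hW0 : 0 ≤ (u z + ε) ^ (m - 1 - α) * (W z.1 * ζ z.2) :=
      mul_nonneg (Real.rpow_nonneg hpos.le _) (mul_nonneg (hc.nonneg_W _) (hc.nonneg_time _))
    rw [← ENNReal.ofReal_mul hδ0.le, ← ENNReal.ofReal_mul (by positivity),
      ← ENNReal.ofReal_add (mul_nonneg hδ0.le hyz) (mul_nonneg (by positivity) hW0)]
    refine ENNReal.ofReal_le_ofReal ?_
    -- With weight (u+ε)^(-1), multiplication by (u+ε)^(-α) reproduces the integrand of Y.
    have hyoung := mul_le_young_weight hm (norm_nonneg (F z)) (norm_nonneg (gradient χ z.1)) hδ0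
      (hc.nonneg_space z.1) (inv_pos.2 hpos) (hc.nonneg_W z.1) (hc.gradient_le z.1)
    have hin : inner ℝ (F z) (spatialGrad ψ z) ≤ ‖F z‖ * ‖gradient χ z.1‖ * ζ z.2 := by
      rw [spatialGrad_mul_prod hc.contDiff_space, inner_smul_right, mul_comm]
      exact mul_le_mul_of_nonneg_right (real_inner_le_norm _ _) (hc.nonneg_time _)
    have e1 : (u z + ε) ^ (-α) * (u z + ε)⁻¹ = (u z + ε) ^ (-α - 1) := by
      rw [Real.rpow_sub_one hpos.ne', div_eq_mul_inv]
    have e2 : (u z + ε) ^ (-α) * ((u z + ε)⁻¹) ^ (1 - m) = (u z + ε) ^ (m - 1 - α) := by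
      rw [Real.inv_rpow hpos.le, ← Real.rpow_neg hpos.le, ← Real.rpow_add hpos]
      congr 1; ring
    calc (u z + ε) ^ (-α) * inner ℝ (F z) (spatialGrad ψ z)
        ≤ (u z + ε) ^ (-α) * ((δ * ‖F z‖ ^ (m / (m - 1)) * χ z.1 * (u z + ε)⁻¹ +
          δ ^ (1 - m) * (u z + ε)⁻¹ ^ (1 - m) * W z.1) * ζ z.2) :=
          mul_le_mul_of_nonneg_left (hin.trans
            (mul_le_mul_of_nonneg_right hyoung (hc.nonneg_time _))) (Real.rpow_nonneg hpos.le _)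
      _ = δ * (‖F z‖ ^ (m / (m - 1)) * χ z.1 * ζ z.2 * ((u z + ε) ^ (-α) * (u z + ε)⁻¹)) +
          δ ^ (1 - m) * (((u z + ε) ^ (-α) * (u z + ε)⁻¹ ^ (1 - m)) * (W z.1 * ζ z.2)) := by
          ring
      _ = _ := by rw [e1, e2]
  have htot : ENNReal.ofReal δ * Y + ENNReal.ofReal δ * Y ≤
      ENNReal.ofReal (1 / (1 - α)) *
        (∫⁻ z, ENNReal.ofReal ((u z + ε) ^ (1 - α) * (χ z.1 * D z.2)) ∂μ) +
      (ENNReal.ofReal δ * Y + ENNReal.ofReal (δ ^ (1 - m)) *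
        ∫⁻ z, ENNReal.ofReal ((u z + ε) ^ (m - 1 - α) * (W z.1 * ζ z.2)) ∂μ) := by
    have h2 : (δ + δ) * ∫ z, ‖F z‖ ^ (m / (m - 1)) * χ z.1 * ζ z.2 *
        (u z + ε) ^ (-α - 1) ∂μ ≤
        -(1 / (1 - α)) * (∫ z, timeDeriv ψ z * (u z + ε) ^ (1 - α) ∂μ)
        + ∫ z, (u z + ε) ^ (-α) * inner ℝ (F z) (spatialGrad ψ z) ∂μ := by
      refine le_trans ?_ key
      calc _ = α * (c₀ * ∫ z, ‖F z‖ ^ (m / (m - 1)) * χ z.1 * ζ z.2 *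
          (u z + ε) ^ (-α - 1) ∂μ) := by rw [hδ]; ring
        _ ≤ _ := mul_le_mul_of_nonneg_left hlow hα0.le
    have h3 := (ENNReal.ofReal_le_ofReal h2).trans (ENNReal.ofReal_add_le.trans
      (add_le_add hA hB'))
    rwa [ENNReal.ofReal_mul (by positivity), hYe, ENNReal.ofReal_add hδ0.le hδ0.le,
      add_mul] at h3
  rw [add_left_comm] at htot
  exact (ENNReal.add_le_add_iff_left (ENNReal.mul_ne_top ENNReal.ofReal_ne_top hYtop)).1 htot

/-- Nonlinear capacity estimate: the nonlinear term tested with `χ ζ` is controlled by lower order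
powers of `u` on the sets where the cutoff varies. -/
theorem IsInteriorWeakIneq.weighted_test (h : IsInteriorWeakIneq f ut F) (hm : 1 < m)
    (hS : IsSobolevLoc m u ut Du) (hF : MemLpLoc F (m / (m - 1)))
    (hu : ∀ᵐ z ∂(volume.restrict (halfSpace N)), 0 ≤ u z) {c₀ : ℝ} (hc₀ : 0 < c₀)
    (hco : ∀ᵐ z ∂(volume.restrict (halfSpace N)),
      c₀ * ‖F z‖ ^ (m / (m - 1)) ≤ inner ℝ (F z) (Du z))
    {α : ℝ} (hα0 : 0 < α) (hα1 : α < 1) :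
    ∃ C : ℝ, 0 < C ∧ ∀ (χ : E N → ℝ) (ζ D : ℝ → ℝ) (W : E N → ℝ), IsCutoff m χ ζ D W →
      ∀ l ε : ℝ, 0 < l → 0 < ε →
      ∫⁻ z in halfSpace N, f z * ENNReal.ofReal (χ z.1 * ζ z.2) ≤
        ENNReal.ofReal C * ∫⁻ z in halfSpace N, ENNReal.ofReal
          ((u z + l * (u z + ε) ^ (1 - α)) * (χ z.1 * D z.2) +
            (l * (u z + ε) ^ (m - 1 - α) + l ^ (1 - m) * (u z + ε) ^ ((1 + α) * (m - 1))) *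
              (W z.1 * ζ z.2)) := by
  have hδ0 : 0 < α * c₀ / 2 := by positivity
  have h1α : 0 < 1 / (1 - α) := one_div_pos.2 (by linarith)
  set δ : ℝ := α * c₀ / 2 with hδ
  -- The summands are the coefficient 1 of the direct terms and the two constants obtained by
  -- dividing the flux estimate by δ; none depends on the cutoff, l or ε.
  refine ⟨1 + δ⁻¹ * (1 / (1 - α)) + δ⁻¹ * δ ^ (1 - m), by positivity,
    fun χ ζ D W hc l ε hl hε => ?_⟩
  set c₁ := δ⁻¹ * (1 / (1 - α)) with hc₁
  set c₂ := δ⁻¹ * δ ^ (1 - m) with hc₂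
  have hc₁0 : 0 < c₁ := by positivity
  have hc₂0 : 0 < c₂ := by positivity
  have hflux := h.flux_le hm hS hF hu hc₀ hco hα0 hα1 hc hε
  set ψ : E N × ℝ → ℝ := fun z => χ z.1 * ζ z.2 with hψdef
  have hψs : tsupport ψ ⊆ halfSpace N := hc.tsupport_subset
  have hψc : HasCompactSupport ψ := hasCompactSupport_mul_prod hc.compact_space hc.compact_time
  have hψ : ContDiff ℝ 1 ψ := contDiff_mul_prod hc.contDiff_space hc.contDiff_time
  have hK : IsCompact (tsupport ψ) := hψc
  set μ : Measure (E N × ℝ) := volume.restrict (tsupport ψ) with hμ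
  have hu' : ∀ᵐ z ∂μ, 0 ≤ u z := ae_restrict_of_ae_restrict_of_subset hψs hu
  have huM : AEMeasurable u μ := (hS.memLp _ hK hψs).1.aemeasurable
  have hFM : AEMeasurable F μ := (hF _ hK hψs).1.aemeasurable
  set Y := ∫⁻ z, ENNReal.ofReal (‖F z‖ ^ (m / (m - 1)) * χ z.1 * ζ z.2 *
    (u z + ε) ^ (-α - 1)) ∂μ with hY
  set G₀ := ∫⁻ z, ENNReal.ofReal (u z * (χ z.1 * D z.2)) ∂μ with hG₀
  set G₁ := ∫⁻ z, ENNReal.ofReal ((u z + ε) ^ (1 - α) * (χ z.1 * D z.2)) ∂μ with hG₁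
  set G₂ := ∫⁻ z, ENNReal.ofReal ((u z + ε) ^ (m - 1 - α) * (W z.1 * ζ z.2)) ∂μ with hG₂
  set G₃ := ∫⁻ z, ENNReal.ofReal ((u z + ε) ^ ((1 + α) * (m - 1)) * (W z.1 * ζ z.2)) ∂μ with hG₃
  have hYle : Y ≤ ENNReal.ofReal c₁ * G₁ + ENNReal.ofReal c₂ * G₂ := by
    have h1 : Y = ENNReal.ofReal δ⁻¹ * (ENNReal.ofReal δ * Y) := by
      rw [← mul_assoc, ← ENNReal.ofReal_mul (by positivity), inv_mul_cancel₀ hδ0.ne',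
        ENNReal.ofReal_one, one_mul]
    rw [h1, hc₁, hc₂, ENNReal.ofReal_mul (by positivity), ENNReal.ofReal_mul (by positivity),
      mul_assoc, mul_assoc, ← mul_add]
    gcongr
  have hχm : Measurable fun z : E N × ℝ => χ z.1 :=
    hc.contDiff_space.continuous.measurable.comp measurable_fst
  have hζm : Measurable fun z : E N × ℝ => ζ z.2 :=
    hc.contDiff_time.continuous.measurable.comp measurable_snd
  have hχD : Measurable fun z : E N × ℝ => χ z.1 * D z.2 :=
    hχm.mul (hc.measurable_D.comp measurable_snd)
  have hWζ : Measurable fun z : E N × ℝ => W z.1 * ζ z.2 :=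
    (hc.measurable_W.comp measurable_fst).mul hζm
  have hχD0 : ∀ z : E N × ℝ, 0 ≤ χ z.1 * D z.2 := fun z =>
    mul_nonneg (hc.nonneg_space _) (hc.nonneg_D _)
  have hWζ0 : ∀ z : E N × ℝ, 0 ≤ W z.1 * ζ z.2 := fun z =>
    mul_nonneg (hc.nonneg_W _) (hc.nonneg_time _)
  have hI : ∫⁻ z in halfSpace N, f z * ENNReal.ofReal (ψ z) ≤
      G₀ + (ENNReal.ofReal l * Y + ENNReal.ofReal (l ^ (1 - m)) * G₃) := by
    refine (h.lintegral_le hψ hψc hψs hc.nonneg).trans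
      (ENNReal.ofReal_add_le.trans (add_le_add ?_ ?_))
    -- The time derivative moves to the cutoff. Because u ≥ 0, only an upper bound D for -ζ' is
    -- needed.
    · rw [← neg_neg (∫ z in halfSpace N, ut z * ψ z), ← hS.weak_time ψ hψ hψc hψs,
        setIntegral_eq_of_tsupport (φ := ψ) hψs fun z hz => by
          rw [timeDeriv_eq_zero_of_notMem_tsupport hz, mul_zero], ← integral_neg]
      refine (ofReal_integral_le_lintegral_ofReal _).trans (lintegral_mono_ae ?_)
      filter_upwards [hu'] with z hz
      refine ENNReal.ofReal_le_ofReal ?_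
      rw [timeDeriv_mul_prod]
      calc -(u z * (χ z.1 * deriv ζ z.2)) = u z * (χ z.1 * -deriv ζ z.2) := by ring
        _ ≤ _ := mul_le_mul_of_nonneg_left (mul_le_mul_of_nonneg_left (hc.deriv_le _)
          (hc.nonneg_space _)) hz
    · rw [setIntegral_eq_of_tsupport (φ := ψ) hψs fun z hz => by
        rw [spatialGrad_eq_zero_of_notMem_tsupport hz, inner_zero_right]]
      have hYm : AEMeasurable (fun z => ENNReal.ofReal (‖F z‖ ^ (m / (m - 1)) * χ z.1 * ζ z.2 *
          (u z + ε) ^ (-α - 1))) μ :=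
        ((((hFM.norm.pow_const _).mul hχm.aemeasurable).mul hζm.aemeasurable).mul
          ((huM.add_const ε).pow_const _)).ennreal_ofReal
      rw [hY, hG₃, ← lintegral_const_mul' _ _ ENNReal.ofReal_ne_top,
        ← lintegral_const_mul' _ _ ENNReal.ofReal_ne_top,
        ← lintegral_add_left' (hYm.const_mul _)]
      refine (ofReal_integral_le_lintegral_ofReal _).trans (lintegral_mono_ae ?_)
      filter_upwards [hu'] with z hz
      have hpos : 0 < u z + ε := by linarith
      have hy0 : 0 ≤ ‖F z‖ ^ (m / (m - 1)) * χ z.1 * ζ z.2 * (u z + ε) ^ (-α - 1) :=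
        mul_nonneg (mul_nonneg (mul_nonneg (by positivity) (hc.nonneg_space _))
          (hc.nonneg_time _)) (by positivity)
      have hW0 := mul_nonneg (Real.rpow_nonneg hpos.le ((1 + α) * (m - 1))) (hWζ0 z)
      rw [← ENNReal.ofReal_mul hl.le, ← ENNReal.ofReal_mul (by positivity),
        ← ENNReal.ofReal_add (mul_nonneg hl.le hy0) (mul_nonneg (by positivity) hW0)]
      refine ENNReal.ofReal_le_ofReal ?_
      -- The weight (u+ε)^(-α-1) makes the first Young term l times the integrand of Y. The
      -- parameter l stays free to be matched to the scale of u.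
      have hyoung := mul_le_young_weight hm (norm_nonneg (F z)) (norm_nonneg (gradient χ z.1)) hl
        (hc.nonneg_space z.1) (Real.rpow_pos_of_pos hpos (-α - 1)) (hc.nonneg_W z.1)
        (hc.gradient_le z.1)
      have hin : inner ℝ (F z) (spatialGrad ψ z) ≤ ‖F z‖ * ‖gradient χ z.1‖ * ζ z.2 := by
        rw [spatialGrad_mul_prod hc.contDiff_space, inner_smul_right, mul_comm]
        exact mul_le_mul_of_nonneg_right (real_inner_le_norm _ _) (hc.nonneg_time _)
      have e2 : ((u z + ε) ^ (-α - 1)) ^ (1 - m) = (u z + ε) ^ ((1 + α) * (m - 1)) := by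
        rw [← Real.rpow_mul hpos.le]
        congr 1; ring
      rw [e2] at hyoung
      refine hin.trans ((mul_le_mul_of_nonneg_right hyoung (hc.nonneg_time _)).trans
        (le_of_eq ?_))
      ring
  have hC0 : 1 ≤ 1 + c₁ + c₂ := by linarith
  have hC1 : c₁ ≤ 1 + c₁ + c₂ := by linarith
  have hC2 : c₂ ≤ 1 + c₁ + c₂ := by linarith
  have hsum : G₀ + ENNReal.ofReal l * G₁ + (ENNReal.ofReal l * G₂ +
      ENNReal.ofReal (l ^ (1 - m)) * G₃) ≤ ∫⁻ z in halfSpace N, ENNReal.ofReal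
          ((u z + l * (u z + ε) ^ (1 - α)) * (χ z.1 * D z.2) +
            (l * (u z + ε) ^ (m - 1 - α) + l ^ (1 - m) * (u z + ε) ^ ((1 + α) * (m - 1))) *
              (W z.1 * ζ z.2)) := by
    have hpm : ∀ r : ℝ, AEMeasurable (fun z => (u z + ε) ^ r) μ := fun r =>
      (huM.add_const ε).pow_const _
    have hm0 : AEMeasurable (fun z => ENNReal.ofReal (u z * (χ z.1 * D z.2))) μ :=
      (huM.mul hχD.aemeasurable).ennreal_ofReal
    have hm1 : AEMeasurable (fun z => ENNReal.ofReal l *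
        ENNReal.ofReal ((u z + ε) ^ (1 - α) * (χ z.1 * D z.2))) μ := (((hpm (1 - α)).mul hχD.aemeasurable).ennreal_ofReal).const_mul
      (ENNReal.ofReal l)
    have hm2 : AEMeasurable (fun z => ENNReal.ofReal l *
        ENNReal.ofReal ((u z + ε) ^ (m - 1 - α) * (W z.1 * ζ z.2))) μ := (((hpm (m - 1 - α)).mul hWζ.aemeasurable).ennreal_ofReal).const_mul
      (ENNReal.ofReal l)
    have hm3 : AEMeasurable (fun z => ENNReal.ofReal (u z * (χ z.1 * D z.2)) +
        ENNReal.ofReal l * ENNReal.ofReal ((u z + ε) ^ (1 - α) * (χ z.1 * D z.2))) μ :=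
      hm0.add hm1
    refine le_trans (le_of_eq ?_) (lintegral_mono_set hψs)
    rw [hG₀, hG₁, hG₂, hG₃, ← lintegral_const_mul' _ _ ENNReal.ofReal_ne_top,
      ← lintegral_const_mul' _ _ ENNReal.ofReal_ne_top,
      ← lintegral_const_mul' _ _ ENNReal.ofReal_ne_top, ← lintegral_add_left' hm0,
      ← lintegral_add_left' hm2, ← lintegral_add_left' hm3]
    refine lintegral_congr_ae ?_
    filter_upwards [hu'] with z hz
    have hpos : 0 < u z + ε := by linarith
    have p1 := Real.rpow_nonneg hpos.le (1 - α)
    have p2 := Real.rpow_nonneg hpos.le (m - 1 - α)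
    have p3 := Real.rpow_nonneg hpos.le ((1 + α) * (m - 1))
    have p4 := Real.rpow_nonneg hl.le (1 - m)
    have q0 := mul_nonneg hz (hχD0 z)
    have q1 := mul_nonneg hl.le (mul_nonneg p1 (hχD0 z))
    have q2 := mul_nonneg hl.le (mul_nonneg p2 (hWζ0 z))
    have q3 := mul_nonneg p4 (mul_nonneg p3 (hWζ0 z))
    rw [← ENNReal.ofReal_mul hl.le, ← ENNReal.ofReal_mul hl.le, ← ENNReal.ofReal_mul p4,
      ← ENNReal.ofReal_add q0 q1, ← ENNReal.ofReal_add q2 q3,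
      ← ENNReal.ofReal_add (add_nonneg q0 q1) (add_nonneg q2 q3)]
    congr 1
    ring
  refine hI.trans (le_trans ?_ (mul_le_mul_right hsum _))
  have hone : (1 : ℝ≥0∞) ≤ ENNReal.ofReal (1 + c₁ + c₂) := by
    simpa using ENNReal.ofReal_le_ofReal hC0
  calc G₀ + (ENNReal.ofReal l * Y + ENNReal.ofReal (l ^ (1 - m)) * G₃)
      ≤ G₀ + (ENNReal.ofReal l * (ENNReal.ofReal c₁ * G₁ + ENNReal.ofReal c₂ * G₂) +
        ENNReal.ofReal (l ^ (1 - m)) * G₃) := by gcongr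
    _ = 1 * G₀ + ENNReal.ofReal c₁ * (ENNReal.ofReal l * G₁) +
        (ENNReal.ofReal c₂ * (ENNReal.ofReal l * G₂) +
          1 * (ENNReal.ofReal (l ^ (1 - m)) * G₃)) := by ring
    _ ≤ ENNReal.ofReal (1 + c₁ + c₂) * G₀ +
        ENNReal.ofReal (1 + c₁ + c₂) * (ENNReal.ofReal l * G₁) +
        (ENNReal.ofReal (1 + c₁ + c₂) * (ENNReal.ofReal l * G₂) +
          ENNReal.ofReal (1 + c₁ + c₂) * (ENNReal.ofReal (l ^ (1 - m)) * G₃)) := by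
        gcongr
    _ = _ := by ring

end WeightedTestMain

/-! ### Bounding the nonlocal term from below by the energy. -/

section NonlocalLowerBound

variable {N : ℕ} {β p q : ℝ} {K : E N → ℝ}

/-- Three regimes: near 0 the liminf bounds K below, on the compact annulus continuity and
positivity do, and far away the decay hypothesis does. The first two bounds are constants, which
suffice because R^(-β) ≤ 1 for R ≥ 1. -/
theorem IsAdmissibleKernel.exists_lower_bound (hK : IsAdmissibleKernel β K) (hβ : 0 < β) :
    ∃ c : ℝ, 0 < c ∧ ∀ R : ℝ, 1 ≤ R → ∀ x : E N, x ≠ 0 → ‖x‖ ≤ 4 * R → c * R ^ (-β) ≤ K x := by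
  obtain ⟨c₁, ρ, hc₁, hρ, hdec⟩ := hK.decay
  obtain ⟨a, ha0, ha⟩ := EReal.lt_iff_exists_real_btwn.1 hK.liminf_pos
  have hev := eventually_lt_of_lt_liminf ha
  obtain ⟨r, hr, hr'⟩ := Metric.mem_nhdsWithin_iff.1 hev
  have ha0' : 0 < a := by exact_mod_cast ha0
  have hcomp : IsCompact (Metric.closedBall (0 : E N) ρ \ Metric.ball 0 r) :=
    (isCompact_closedBall _ _).diff Metric.isOpen_ball
  have hcont : ContinuousOn K (Metric.closedBall (0 : E N) ρ \ Metric.ball 0 r) :=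
    hK.continuousOn.mono fun x hx hx0 => hx.2 (by rw [hx0]; exact Metric.mem_ball_self hr)
  obtain ⟨b, hb0, hb⟩ : ∃ b : ℝ, 0 < b ∧
      ∀ x ∈ Metric.closedBall (0 : E N) ρ \ Metric.ball 0 r, b ≤ K x := by
    rcases (Metric.closedBall (0 : E N) ρ \ Metric.ball 0 r).eq_empty_or_nonempty with h | h
    · exact ⟨1, one_pos, by simp [h]⟩
    · obtain ⟨x, hx, hmin⟩ := hcomp.exists_isMinOn h hcont
      exact ⟨K x, hK.pos x fun h0 => hx.2 (by rw [h0]; exact Metric.mem_ball_self hr),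
        fun y hy => hmin hy⟩
  refine ⟨min (min a b) (c₁ * 4 ^ (-β)), by positivity, fun R hR x hx hxR => ?_⟩
  have hR0 : 0 < R := by linarith
  have hRβ : R ^ (-β) ≤ 1 := Real.rpow_le_one_of_one_le_of_nonpos hR (by linarith)
  have hRβ0 : 0 < R ^ (-β) := Real.rpow_pos_of_pos hR0 _
  by_cases hxρ : ρ < ‖x‖
  · calc min (min a b) (c₁ * 4 ^ (-β)) * R ^ (-β) ≤ (c₁ * 4 ^ (-β)) * R ^ (-β) := by
          gcongr; exact min_le_right _ _
      _ = c₁ * (4 * R) ^ (-β) := by rw [Real.mul_rpow (by norm_num) hR0.le]; ring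
      _ ≤ c₁ * ‖x‖ ^ (-β) := by
          refine mul_le_mul_of_nonneg_left ?_ hc₁.le
          exact Real.rpow_le_rpow_of_nonpos (norm_pos_iff.2 hx) hxR (by linarith)
      _ ≤ K x := hdec x hxρ
  · have hab : min a b ≤ K x := by
      by_cases hxr : x ∈ Metric.ball (0 : E N) r
      · have : (a : EReal) < K x := hr' ⟨hxr, hx⟩
        exact (min_le_left _ _).trans (by exact_mod_cast this.le)
      · exact (min_le_right _ _).trans (hb x ⟨by simpa using not_lt.1 hxρ, hxr⟩)
    calc min (min a b) (c₁ * 4 ^ (-β)) * R ^ (-β) ≤ min (min a b) (c₁ * 4 ^ (-β)) * 1 := by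
          gcongr
      _ ≤ K x := by rw [mul_one]; exact (min_le_left _ _).trans hab

/-- Cauchy–Schwarz for the square roots of v^p χ and v^q χ. -/
theorem sq_lintegral_le {α : Type*} [MeasurableSpace α] {μ : Measure α} (hp : 0 < p) (hq : 0 < q)
    {v χ : α → ℝ} (hv : Measurable v) (hv0 : ∀ x, 0 ≤ v x) (hχ : Measurable χ)
    (hχ0 : ∀ x, 0 ≤ χ x) :
    (∫⁻ x, ENNReal.ofReal (v x ^ ((p + q) / 2) * χ x) ∂μ) ^ 2 ≤
      (∫⁻ x, ENNReal.ofReal (v x ^ p * χ x) ∂μ) * ∫⁻ x, ENNReal.ofReal (v x ^ q * χ x) ∂μ := by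
  have hm : ∀ r : ℝ, Measurable fun x => ENNReal.ofReal (v x ^ r * χ x) := fun r =>
    ((hv.pow_const r).mul hχ).ennreal_ofReal
  have h := ENNReal.lintegral_mul_le_Lp_mul_Lq μ Real.HolderConjugate.two_two
    (f := fun x => ENNReal.ofReal (v x ^ p * χ x) ^ (1 / 2 : ℝ))
    (g := fun x => ENNReal.ofReal (v x ^ q * χ x) ^ (1 / 2 : ℝ))
    ((hm p).pow_const _).aemeasurable ((hm q).pow_const _).aemeasurable
  simp only [Pi.mul_apply, ← ENNReal.rpow_mul] at h
  rw [one_div_mul_cancel two_ne_zero] at h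
  simp only [ENNReal.rpow_one] at h
  have e : ∀ x, ENNReal.ofReal (v x ^ ((p + q) / 2) * χ x) =
      ENNReal.ofReal (v x ^ p * χ x) ^ (1 / 2 : ℝ) *
        ENNReal.ofReal (v x ^ q * χ x) ^ (1 / 2 : ℝ) := by
    intro x
    have h1 := mul_nonneg (Real.rpow_nonneg (hv0 x) p) (hχ0 x)
    have h2 := mul_nonneg (Real.rpow_nonneg (hv0 x) q) (hχ0 x)
    rw [ENNReal.ofReal_rpow_of_nonneg h1 (by norm_num),
      ENNReal.ofReal_rpow_of_nonneg h2 (by norm_num), ← ENNReal.ofReal_mul (by positivity),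
      ← Real.mul_rpow h1 h2]
    congr 1
    rw [show v x ^ p * χ x * (v x ^ q * χ x) = (v x ^ ((p + q) / 2) * χ x) ^ 2 by
      rw [mul_pow, ← Real.rpow_natCast (v x ^ _), ← Real.rpow_mul (hv0 x),
        show (p + q) / 2 * ((2 : ℕ) : ℝ) = p + q by push_cast; ring,
        Real.rpow_add_of_nonneg (hv0 x) hp.le hq.le]
      ring]
    rw [← Real.sqrt_eq_rpow, Real.sqrt_sq (mul_nonneg (Real.rpow_nonneg (hv0 x) _) (hχ0 x))]
  simp only [e]
  calc _ ≤ ((∫⁻ x, ENNReal.ofReal (v x ^ p * χ x) ∂μ) ^ (1 / 2 : ℝ) *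
      (∫⁻ x, ENNReal.ofReal (v x ^ q * χ x) ∂μ) ^ (1 / 2 : ℝ)) ^ 2 := by gcongr
    _ = _ := by
      rw [mul_pow, ← ENNReal.rpow_natCast, ← ENNReal.rpow_natCast, ← ENNReal.rpow_mul,
        ← ENNReal.rpow_mul]
      norm_num

theorem lintegral_halfSpace_eq {g : E N × ℝ → ℝ≥0∞} (hg : Measurable g)
    (h0 : ∀ z, z ∉ halfSpace N → g z = 0) :
    ∫⁻ z in halfSpace N, g z = ∫⁻ t, ∫⁻ x, g (x, t) := by
  rw [setLIntegral_eq_of_support_subset, Measure.volume_eq_prod, lintegral_prod_symm' _ hg]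
  intro z hz
  by_contra h
  exact hz (h0 z h)

/-- If x and y lie in the ball of radius 2R then ‖x - y‖ ≤ 4R and K(x - y) ≥ c. On each time slice
the double integral then factorises and Cauchy–Schwarz applies. -/
theorem le_lintegral_nonlocalTerm (hN : 1 ≤ N) (hp : 0 < p) (hq : 0 < q) {c R : ℝ}
    (hc : 0 ≤ c) (hKc : ∀ x : E N, x ≠ 0 → ‖x‖ ≤ 4 * R → c ≤ K x) {u : E N × ℝ → ℝ}
    (hu : Measurable u) (hu0 : ∀ z, 0 ≤ u z) {χ : E N → ℝ} {ζ : ℝ → ℝ} (hχ : Measurable χ)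
    (hχ0 : ∀ x, 0 ≤ χ x) (hχ1 : ∀ x, χ x ≤ 1) (hχs : ∀ x, 2 * R < ‖x‖ → χ x = 0)
    (hζ : Measurable ζ) (hζs : ∀ t, t ≤ 0 → ζ t = 0) :
    ENNReal.ofReal c * ∫⁻ t, ENNReal.ofReal (ζ t) *
        (∫⁻ x, ENNReal.ofReal (u (x, t) ^ ((p + q) / 2) * χ x)) ^ 2 ≤
      ∫⁻ z in halfSpace N, nonlocalTerm K p q u z * ENNReal.ofReal (χ z.1 * ζ z.2) := by
  have : Nonempty (Fin N) := ⟨⟨0, hN⟩⟩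
  have hsl : ∀ t, Measurable fun x => u (x, t) := fun t => hu.comp measurable_prodMk_right
  set P : ℝ → ℝ≥0∞ := fun t => ∫⁻ y, ENNReal.ofReal (u (y, t) ^ p * χ y) with hP
  have hPm : Measurable P := by
    have h1 : Measurable fun z : E N × ℝ => ENNReal.ofReal (u z ^ p * χ z.1) :=
      ((hu.pow_const p).mul (hχ.comp measurable_fst)).ennreal_ofReal
    exact h1.lintegral_prod_left'
  set g : E N × ℝ → ℝ≥0∞ := fun z => ENNReal.ofReal c * P z.2 * ENNReal.ofReal (u z ^ q) *
    ENNReal.ofReal (χ z.1 * ζ z.2) with hg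
  have hgm : Measurable g := by
    refine ((measurable_const.mul (hPm.comp measurable_snd)).mul
      (hu.pow_const q).ennreal_ofReal).mul ?_
    exact ((hχ.comp measurable_fst).mul (hζ.comp measurable_snd)).ennreal_ofReal
  have hgle : ∀ z, g z ≤ nonlocalTerm K p q u z * ENNReal.ofReal (χ z.1 * ζ z.2) := by
    intro z
    by_cases hz : 2 * R < ‖z.1‖
    · simp [hg, hχs z.1 hz]
    · simp only [hg, nonlocalTerm]
      gcongr
      simp only [hP, convPow]
      rw [← lintegral_const_mul' _ _ ENNReal.ofReal_ne_top]
      refine lintegral_mono_ae ?_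
      -- The value of K at 0 is uncontrolled, so the point y = x is discarded; it is null because N
      -- ≥ 1.
      filter_upwards [measure_eq_zero_iff_ae_notMem.1 (measure_singleton z.1)] with y hy
      rw [← ENNReal.ofReal_mul hc]
      by_cases hy2 : 2 * R < ‖y‖
      · simp [hχs y hy2]
      · refine ENNReal.ofReal_le_ofReal ?_
        have h1 : c ≤ K (z.1 - y) := by
          refine hKc _ (fun h => hy (by rw [mem_singleton_iff]; exact (sub_eq_zero.1 h).symm)) ?_
          calc ‖z.1 - y‖ ≤ ‖z.1‖ + ‖y‖ := norm_sub_le _ _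
            _ ≤ 2 * R + 2 * R := add_le_add (not_lt.1 hz) (not_lt.1 hy2)
            _ = 4 * R := by ring
        have h2 := Real.rpow_nonneg (hu0 (y, z.2)) p
        calc c * (u (y, z.2) ^ p * χ y) ≤ c * (u (y, z.2) ^ p * 1) := by
              gcongr; exact hχ1 y
          _ ≤ _ := by rw [mul_one]; gcongr
  calc ENNReal.ofReal c * ∫⁻ t, ENNReal.ofReal (ζ t) *
        (∫⁻ x, ENNReal.ofReal (u (x, t) ^ ((p + q) / 2) * χ x)) ^ 2
      ≤ ∫⁻ t, ∫⁻ x, g (x, t) := by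
        rw [← lintegral_const_mul' _ _ ENNReal.ofReal_ne_top]
        refine lintegral_mono fun t => ?_
        have h1 := sq_lintegral_le (μ := volume) hp hq (hsl t) (fun x => hu0 _) hχ hχ0
        have h2 : ∫⁻ x, g (x, t) = ENNReal.ofReal c * P t * ENNReal.ofReal (ζ t) *
            ∫⁻ x, ENNReal.ofReal (u (x, t) ^ q * χ x) := by
          have hqm : Measurable fun x => ENNReal.ofReal (u (x, t) ^ q * χ x) :=
            (((hsl t).pow_const q).mul hχ).ennreal_ofReal
          rw [← lintegral_const_mul _ hqm]
          refine lintegral_congr fun x => ?_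
          simp only [hg]
          rw [ENNReal.ofReal_mul (hχ0 x), ENNReal.ofReal_mul (Real.rpow_nonneg (hu0 _) _)]
          ring
        calc _ ≤ ENNReal.ofReal c * (ENNReal.ofReal (ζ t) *
              (P t * ∫⁻ x, ENNReal.ofReal (u (x, t) ^ q * χ x))) := by gcongr
          _ = _ := by rw [h2]; ring
    _ = ∫⁻ z in halfSpace N, g z := by
        refine (lintegral_halfSpace_eq hgm fun z hz => ?_).symm
        simp [hg, hζs z.2 (not_lt.1 hz)]
    _ ≤ _ := lintegral_mono hgle

end NonlocalLowerBound

/-! ### Space and time cutoffs with power-type derivative bounds. -/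

section Cutoffs

/-- For a k-th power of a bump, m ≤ k(1-κ) is what makes (k-1)m ≥ kκ + k(m-1). Thus |∇χ|^m keeps a
factor χ^κ besides χ^(m-1); absorption into an energy weighted by the cutoff needs that factor. -/
theorem exists_pow_exponent (m : ℝ) {κ : ℝ} (hκ : κ < 1) :
    ∃ k : ℕ, 2 ≤ k ∧ m ≤ k * (1 - κ) := by
  obtain ⟨k, hk⟩ := exists_nat_ge (m / (1 - κ))
  refine ⟨k + 2, by omega, ?_⟩
  rw [div_le_iff₀ (by linarith)] at hk
  push_cast
  nlinarith

theorem exists_space_cutoff (N : ℕ) {m κ : ℝ} (hm : 1 < m) (hκ0 : 0 ≤ κ) (hκ : κ < 1) :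
    ∃ C : ℝ, 0 < C ∧ ∀ R : ℝ, 0 < R → ∃ χ : E N → ℝ, ContDiff ℝ 1 χ ∧ HasCompactSupport χ ∧
      (∀ x, 0 ≤ χ x) ∧ (∀ x, χ x ≤ 1) ∧ (∀ x, ‖x‖ ≤ R → χ x = 1) ∧
      (∀ x, 2 * R < ‖x‖ → χ x = 0) ∧
      ∀ x, ‖gradient χ x‖ ^ m ≤ C * R ^ (-m) *
        indicator {x | R ≤ ‖x‖ ∧ ‖x‖ ≤ 2 * R} (fun x => χ x ^ κ) x * χ x ^ (m - 1) := by
  obtain ⟨k, hk2, hkm⟩ := exists_pow_exponent m hκ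
  let b : ContDiffBump (0 : E N) := ⟨1, 2, one_pos, one_lt_two⟩
  have hbc : ContDiff ℝ 1 b := b.contDiff
  obtain ⟨L, hL⟩ := (b.hasCompactSupport.fderiv ℝ).exists_bound_of_continuous
    (hbc.continuous_fderiv one_ne_zero)
  have hL1 : ∀ x, ‖fderiv ℝ b x‖ ≤ |L| + 1 := fun x =>
    (hL x).trans ((le_abs_self L).trans (by linarith))
  have hm0 : 0 < m := by linarith
  refine ⟨(k * (|L| + 1)) ^ m, by
    have : (0 : ℝ) < k := by positivity
    positivity, fun R hR => ?_⟩
  have hout : ∀ x : E N, 2 * R < ‖x‖ → b (R⁻¹ • x) = 0 := by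
    intro x hx
    refine b.zero_of_le_dist ?_
    change (2 : ℝ) ≤ _
    rw [dist_zero_right, norm_smul, Real.norm_of_nonneg (inv_pos.2 hR).le, inv_mul_eq_div,
      le_div_iff₀ hR]
    exact hx.le
  have hd : ∀ x, HasFDerivAt (fun x => b (R⁻¹ • x) ^ k)
      ((k * b (R⁻¹ • x) ^ (k - 1)) • (R⁻¹ • fderiv ℝ b (R⁻¹ • x))) x := by
    intro x
    have h1 := ((hbc.differentiable one_ne_zero (R⁻¹ • x)).hasFDerivAt.comp x
      ((hasFDerivAt_id x).const_smul R⁻¹)).pow k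
    refine h1.congr_fderiv ?_
    ext y
    simp
  refine ⟨fun x => b (R⁻¹ • x) ^ k, (hbc.comp (contDiff_const_smul _)).pow k, ?_,
    fun x => pow_nonneg b.nonneg _, fun x => pow_le_one₀ b.nonneg b.le_one, fun x hx => ?_,
    fun x hx => by simp only [hout x hx]; exact zero_pow (by omega), fun x => ?_⟩
  · refine HasCompactSupport.intro (isCompact_closedBall (0 : E N) (2 * R)) fun x hx => ?_
    rw [mem_closedBall_zero_iff, not_le] at hx
    simp only [hout x hx]
    exact zero_pow (by omega)
  · simp only
    rw [b.one_of_mem_closedBall, one_pow]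
    change _ ∈ Metric.closedBall _ (1 : ℝ)
    rw [mem_closedBall_zero_iff, norm_smul, Real.norm_of_nonneg (inv_pos.2 hR).le, inv_mul_eq_div,
      div_le_one hR]
    exact hx
  · have hg : ‖gradient (fun x => b (R⁻¹ • x) ^ k) x‖ =
        ‖(k * b (R⁻¹ • x) ^ (k - 1)) • (R⁻¹ • fderiv ℝ b (R⁻¹ • x))‖ := by
      rw [gradient, (hd x).fderiv, LinearIsometryEquiv.norm_map]
    have hb0 : 0 ≤ b (R⁻¹ • x) := b.nonneg
    by_cases hx : x ∈ {x : E N | R ≤ ‖x‖ ∧ ‖x‖ ≤ 2 * R}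
    · rw [indicator_of_mem hx]
      have hle : ‖gradient (fun x => b (R⁻¹ • x) ^ k) x‖ ≤
          (k * (|L| + 1)) * R⁻¹ * b (R⁻¹ • x) ^ (k - 1) := by
        rw [hg, norm_smul, norm_smul, Real.norm_of_nonneg (by positivity),
          Real.norm_of_nonneg (inv_pos.2 hR).le]
        calc k * b (R⁻¹ • x) ^ (k - 1) * (R⁻¹ * ‖fderiv ℝ b (R⁻¹ • x)‖)
            ≤ k * b (R⁻¹ • x) ^ (k - 1) * (R⁻¹ * (|L| + 1)) := by
              gcongr; exact hL1 _
          _ = _ := by ring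
      have hpow : (b (R⁻¹ • x) ^ (k - 1)) ^ m ≤
          (b (R⁻¹ • x) ^ k) ^ κ * (b (R⁻¹ • x) ^ k) ^ (m - 1) := by
        rw [← Real.rpow_add_of_nonneg (by positivity) hκ0 (by linarith), ← Real.rpow_natCast,
          ← Real.rpow_natCast, ← Real.rpow_mul hb0, ← Real.rpow_mul hb0]
        refine Real.rpow_le_rpow_of_exponent_ge' hb0 b.le_one ?_ ?_
        · have : (0 : ℝ) ≤ k := by positivity
          nlinarith
        · rw [Nat.cast_sub (by omega)]
          push_cast
          nlinarith
      calc ‖gradient (fun x => b (R⁻¹ • x) ^ k) x‖ ^ m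
          ≤ ((k * (|L| + 1)) * R⁻¹ * b (R⁻¹ • x) ^ (k - 1)) ^ m := by gcongr
        _ = (k * (|L| + 1)) ^ m * R ^ (-m) * (b (R⁻¹ • x) ^ (k - 1)) ^ m := by
          rw [Real.mul_rpow (by positivity) (by positivity),
            Real.mul_rpow (by positivity) (by positivity), Real.inv_rpow hR.le,
            Real.rpow_neg hR.le]
        _ ≤ (k * (|L| + 1)) ^ m * R ^ (-m) *
            ((b (R⁻¹ • x) ^ k) ^ κ * (b (R⁻¹ • x) ^ k) ^ (m - 1)) := by gcongr
        _ = _ := by ring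
    · rw [indicator_of_notMem hx, mul_zero, zero_mul]
      have hzero : gradient (fun x => b (R⁻¹ • x) ^ k) x = 0 := by
        rw [← norm_eq_zero, hg]
        rcases lt_or_ge ‖x‖ R with h | h
        · have hmem : R⁻¹ • x ∈ Metric.ball (0 : E N) b.rIn := by
            change _ ∈ Metric.ball _ (1 : ℝ)
            rw [mem_ball_zero_iff, norm_smul, Real.norm_of_nonneg (inv_pos.2 hR).le,
              inv_mul_eq_div, div_lt_one hR]
            exact h
          have : fderiv ℝ b (R⁻¹ • x) = 0 := by
            rw [(b.eventuallyEq_one_of_mem_ball hmem).fderiv_eq]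
            simp
          rw [this]; simp
        · have h2 : 2 * R < ‖x‖ := not_le.1 fun h3 => hx ⟨h, h3⟩
          rw [hout x h2, zero_pow (by omega)]; simp
      rw [hzero, norm_zero, Real.zero_rpow hm0.ne']

/-- A factor rising on [τ, 2τ] times the k-th power of one falling on [T, 2T]. The rising factor
contributes only favourably to -ζ', so the constant does not depend on τ, which can tend to 0. -/
theorem exists_time_cutoff {κ : ℝ} (hκ0 : 0 ≤ κ) (hκ : κ < 1) :
    ∃ C : ℝ, 0 < C ∧ ∀ τ T : ℝ, 0 < τ → 0 < T → ∃ ζ : ℝ → ℝ, ContDiff ℝ 1 ζ ∧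
      HasCompactSupport ζ ∧ (∀ t, 0 ≤ ζ t) ∧ (∀ t, ζ t ≤ 1) ∧ tsupport ζ ⊆ Ioi 0 ∧
      (∀ t, 2 * τ ≤ t → t ≤ T → ζ t = 1) ∧ (∀ t, 2 * T < t → ζ t = 0) ∧
      ∀ t, -deriv ζ t ≤ C / T * indicator (Icc T (2 * T)) (fun t => ζ t ^ κ) t := by
  obtain ⟨k, hk2, hkm⟩ := exists_pow_exponent 2 hκ
  set s : ℝ → ℝ := Real.smoothTransition with hs
  have hsc : ContDiff ℝ 1 s := Real.smoothTransition.contDiff (n := 1)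
  have hs0 : ∀ x, 0 ≤ s x := Real.smoothTransition.nonneg
  have hs1 : ∀ x, s x ≤ 1 := Real.smoothTransition.le_one
  have hds0 : ∀ x, 0 ≤ deriv s x := fun x => Real.smoothTransition.monotone.deriv_nonneg
  have hdz : ∀ x, x ∉ Icc (0 : ℝ) 1 → deriv s x = 0 := by
    intro x hx
    rcases lt_or_ge x 0 with h | h
    · have : s =ᶠ[𝓝 x] fun _ => 0 := by
        filter_upwards [gt_mem_nhds h] with y hy
        exact Real.smoothTransition.zero_of_nonpos (le_of_lt hy)
      rw [this.deriv_eq, deriv_const]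
    · have h1 : 1 < x := not_le.1 fun h' => hx ⟨h, h'⟩
      have : s =ᶠ[𝓝 x] fun _ => 1 := by
        filter_upwards [lt_mem_nhds h1] with y hy
        exact Real.smoothTransition.one_of_one_le (le_of_lt hy)
      rw [this.deriv_eq, deriv_const]
  obtain ⟨L, hL⟩ := (isCompact_Icc (a := (0 : ℝ)) (b := 1)).exists_bound_of_continuousOn
    (hsc.continuous_deriv le_rfl).continuousOn
  have hL1 : ∀ x, deriv s x ≤ |L| + 1 := by
    intro x
    by_cases hx : x ∈ Icc (0 : ℝ) 1
    · exact (le_abs_self _).trans ((hL x hx).trans ((le_abs_self L).trans (by linarith)))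
    · rw [hdz x hx]; positivity
  have hkpos : (0 : ℝ) < k := by
    have : 0 < k := by omega
    exact_mod_cast this
  refine ⟨k * (|L| + 1), by positivity, fun τ T hτ hT => ?_⟩
  have hc1 : ContDiff ℝ 1 fun t : ℝ => s (t / τ - 1) :=
    hsc.comp ((contDiff_id.div_const τ).sub contDiff_const)
  have hc2 : ContDiff ℝ 1 fun t : ℝ => s (2 - t / T) :=
    hsc.comp (contDiff_const.sub (contDiff_id.div_const T))
  have hlow : ∀ t, t ≤ τ → s (t / τ - 1) = 0 := fun t ht =>
    Real.smoothTransition.zero_of_nonpos (by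
      have := (div_le_one hτ).2 ht
      linarith)
  have hhigh : ∀ t, 2 * T ≤ t → s (2 - t / T) = 0 := fun t ht =>
    Real.smoothTransition.zero_of_nonpos (by
      have := (le_div_iff₀ hT).2 ht
      linarith)
  have hk0 : k ≠ 0 := by omega
  have hts : tsupport (fun t : ℝ => s (t / τ - 1) * s (2 - t / T) ^ k) ⊆ Icc τ (2 * T) := by
    refine closure_minimal (fun t ht => ?_) isClosed_Icc
    have ht' : s (t / τ - 1) * s (2 - t / T) ^ k ≠ 0 := ht
    refine ⟨le_of_lt (not_le.1 fun h => ht' ?_), le_of_lt (not_le.1 fun h => ht' ?_)⟩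
    · rw [hlow t h, zero_mul]
    · rw [hhigh t h, zero_pow hk0, mul_zero]
  refine ⟨fun t => s (t / τ - 1) * s (2 - t / T) ^ k, hc1.mul (hc2.pow k),
    isCompact_Icc.of_isClosed_subset (isClosed_tsupport _) hts,
    fun t => mul_nonneg (hs0 _) (pow_nonneg (hs0 _) _),
    fun t => mul_le_one₀ (hs1 _) (pow_nonneg (hs0 _) _) (pow_le_one₀ (hs0 _) (hs1 _)),
    fun t ht => lt_of_lt_of_le hτ (hts ht).1, fun t h1 h2 => ?_, fun t ht => ?_, fun t => ?_⟩
  · have e1 : s (t / τ - 1) = 1 := Real.smoothTransition.one_of_one_le (by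
      have := (le_div_iff₀ hτ).2 h1
      linarith)
    have e2 : s (2 - t / T) = 1 := Real.smoothTransition.one_of_one_le (by
      have := (div_le_one hT).2 h2
      linarith)
    simp only [e1, e2, one_pow, mul_one]
  · simp only [hhigh t ht.le, zero_pow hk0, mul_zero]
  · have hd1 : HasDerivAt (fun t : ℝ => s (t / τ - 1)) (deriv s (t / τ - 1) * (1 / τ)) t :=
      (hsc.differentiable one_ne_zero _).hasDerivAt.comp t
        (((hasDerivAt_id t).div_const τ).sub_const 1)
    have hd2 : HasDerivAt (fun t : ℝ => s (2 - t / T)) (deriv s (2 - t / T) * (-(1 / T))) t :=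
      (hsc.differentiable one_ne_zero _).hasDerivAt.comp t
        (((hasDerivAt_id t).div_const T).const_sub 2)
    have hd3 := hd1.mul (hd2.pow k)
    have e : deriv (fun t : ℝ => s (t / τ - 1) * s (2 - t / T) ^ k) t = _ := hd3.deriv
    rw [e]
    simp only [Pi.pow_apply]
    -- The contribution of the rising factor to ζ', discarded in the next estimate.
    have hA : 0 ≤ deriv s (t / τ - 1) * (1 / τ) * s (2 - t / T) ^ k :=
      mul_nonneg (mul_nonneg (hds0 _) (by positivity)) (pow_nonneg (hs0 _) _)
    have hB : -(deriv s (t / τ - 1) * (1 / τ) * s (2 - t / T) ^ k +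
        s (t / τ - 1) * (↑k * s (2 - t / T) ^ (k - 1) * (deriv s (2 - t / T) * -(1 / T)))) ≤
        s (t / τ - 1) * s (2 - t / T) ^ (k - 1) * (k * deriv s (2 - t / T) / T) := by
      have : -(deriv s (t / τ - 1) * (1 / τ) * s (2 - t / T) ^ k +
        s (t / τ - 1) * (↑k * s (2 - t / T) ^ (k - 1) * (deriv s (2 - t / T) * -(1 / T)))) =
        s (t / τ - 1) * s (2 - t / T) ^ (k - 1) * (k * deriv s (2 - t / T) / T) -
        deriv s (t / τ - 1) * (1 / τ) * s (2 - t / T) ^ k := by ring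
      linarith
    refine hB.trans ?_
    by_cases ht : t ∈ Icc T (2 * T)
    · rw [indicator_of_mem ht]
      have h1 : s (t / τ - 1) * s (2 - t / T) ^ (k - 1) ≤
          (s (t / τ - 1) * s (2 - t / T) ^ k) ^ κ := by
        rw [Real.mul_rpow (hs0 _) (pow_nonneg (hs0 _) _)]
        have a1 : s (t / τ - 1) ≤ s (t / τ - 1) ^ κ := by
          simpa using Real.rpow_le_rpow_of_exponent_ge' (hs0 (t / τ - 1)) (hs1 _) hκ0 hκ.le
        have a2 : s (2 - t / T) ^ (k - 1) ≤ (s (2 - t / T) ^ k) ^ κ := by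
          rw [← Real.rpow_natCast, ← Real.rpow_natCast, ← Real.rpow_mul (hs0 _)]
          refine Real.rpow_le_rpow_of_exponent_ge' (hs0 _) (hs1 _) (by positivity) ?_
          rw [Nat.cast_sub (by omega)]
          push_cast
          nlinarith
        exact mul_le_mul a1 a2 (pow_nonneg (hs0 _) _) (Real.rpow_nonneg (hs0 _) _)
      have h2 : k * deriv s (2 - t / T) / T ≤ k * (|L| + 1) / T := by
        have := hL1 (2 - t / T)
        gcongr
      calc s (t / τ - 1) * s (2 - t / T) ^ (k - 1) * (k * deriv s (2 - t / T) / T)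
          ≤ (s (t / τ - 1) * s (2 - t / T) ^ k) ^ κ * (k * (|L| + 1) / T) :=
            mul_le_mul h1 h2 (div_nonneg (mul_nonneg hkpos.le (hds0 _)) hT.le)
              (Real.rpow_nonneg (mul_nonneg (hs0 _) (pow_nonneg (hs0 _) _)) _)
        _ = _ := by ring
    · rw [indicator_of_notMem ht, mul_zero, hdz _ fun h => ht ?_]
      · simp
      · have h1 : t / T ≤ 2 := by linarith [h.1]
        have h2 : 1 ≤ t / T := by linarith [h.2]
        rw [div_le_iff₀ hT] at h1
        rw [le_div_iff₀ hT] at h2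
        exact ⟨by linarith, h1⟩

end Cutoffs

/-! ### The energy estimate at the invariant scale. -/

section KeyEstimate

variable {N : ℕ}

/-- The conclusion of the nonlinear capacity method for `f` and `u`. -/
def IsCapacityBound (m α C : ℝ) (f : E N × ℝ → ℝ≥0∞) (u : E N × ℝ → ℝ) : Prop :=
  ∀ (χ : E N → ℝ) (ζ D : ℝ → ℝ) (W : E N → ℝ), IsCutoff m χ ζ D W →
    ∀ l ε : ℝ, 0 < l → 0 < ε →
    ∫⁻ z in halfSpace N, f z * ENNReal.ofReal (χ z.1 * ζ z.2) ≤
      ENNReal.ofReal C * ∫⁻ z in halfSpace N, ENNReal.ofReal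
        ((u z + l * (u z + ε) ^ (1 - α)) * (χ z.1 * D z.2) +
          (l * (u z + ε) ^ (m - 1 - α) + l ^ (1 - m) * (u z + ε) ^ ((1 + α) * (m - 1))) *
            (W z.1 * ζ z.2))

/-- The lower order terms of the capacity estimate, in normalised form. -/
def lowerOrder (m α ε v : ℝ) : ℝ :=
  v + (v + ε) ^ (1 - α) + (v + ε) ^ (m - 1 - α) + (v + ε) ^ ((1 + α) * (m - 1))

/-- The part of `B_{2R} × (0,2T]` on which a cutoff between `B_R × (0,T]` and `B_{2R} × (0,2T]`
may vary. -/
def transitionRegion (N : ℕ) (R T : ℝ) : Set (E N × ℝ) :=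
  {z | ‖z.1‖ ≤ 2 * R ∧ 0 < z.2 ∧ z.2 ≤ 2 * T ∧ (T ≤ z.2 ∨ R ≤ ‖z.1‖)}

/-- `χ(x) ζ(t)` is a measurable cutoff between `B_R × [2τ,T]` and `B_{2R} × (0,2T]`. -/
structure IsSpaceTimeCutoff (R T τ : ℝ) (χ : E N → ℝ) (ζ : ℝ → ℝ) : Prop where
  measurable_space : Measurable χ
  nonneg_space : ∀ x, 0 ≤ χ x
  le_one_space : ∀ x, χ x ≤ 1
  eq_one_space : ∀ x, ‖x‖ ≤ R → χ x = 1
  eq_zero_space : ∀ x, 2 * R < ‖x‖ → χ x = 0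
  measurable_time : Measurable ζ
  nonneg_time : ∀ t, 0 ≤ ζ t
  le_one_time : ∀ t, ζ t ≤ 1
  eq_one_time : ∀ t, 2 * τ ≤ t → t ≤ T → ζ t = 1
  eq_zero_of_lt : ∀ t, 2 * T < t → ζ t = 0
  eq_zero_of_nonpos : ∀ t, t ≤ 0 → ζ t = 0

/-- `∫ ζ(t) (∫ u^σ χ dx)² dt`. -/
def energy (σ : ℝ) (u : E N × ℝ → ℝ) (χ : E N → ℝ) (ζ : ℝ → ℝ) : ℝ≥0∞ :=
  ∫⁻ t, ENNReal.ofReal (ζ t) * (∫⁻ x, ENNReal.ofReal (u (x, t) ^ σ * χ x)) ^ 2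

theorem le_rpow_self {x κ : ℝ} (h0 : 0 ≤ x) (h1 : x ≤ 1) (hκ0 : 0 ≤ κ) (hκ1 : κ ≤ 1) :
    x ≤ x ^ κ := by
  simpa using Real.rpow_le_rpow_of_exponent_ge' h0 h1 hκ0 hκ1

/-- With l = U^α and regularisation εU, substituting u = U v turns the time terms into U times
powers of v or v+ε, and the space terms into U^(m-1) times such powers. Hence a single constant A
dominates both coefficients. P and Q locate the variation of ζ and χ, S the transition region.
Positivity of κ makes the weights vanish with the cutoff. -/
theorem scaled_integrand_le {m α ε κ C₁ C₂ R T U A u χ ζ : ℝ} {P Q S : Prop} [Decidable P]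
    [Decidable Q] [Decidable S] (hu : 0 ≤ u) (hε : 0 < ε) (hU : 0 < U) (hT : 0 < T)
    (hκ0 : 0 < κ) (hκ1 : κ < 1) (hC₁ : 0 < C₁) (hC₂ : 0 < C₂)
    (hχ0 : 0 ≤ χ) (hχ1 : χ ≤ 1) (hζ0 : 0 ≤ ζ) (hζ1 : ζ ≤ 1)
    (hA1 : U / T = A) (hA2 : U ^ (m - 1) * R ^ (-m) ≤ A)
    (hP : χ ≠ 0 → ζ ≠ 0 → P → S) (hQ : χ ≠ 0 → ζ ≠ 0 → Q → S) :
    (u + U ^ α * (u + ε * U) ^ (1 - α)) * (χ * (C₂ / T * if P then ζ ^ κ else 0)) +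
      (U ^ α * (u + ε * U) ^ (m - 1 - α) +
        (U ^ α) ^ (1 - m) * (u + ε * U) ^ ((1 + α) * (m - 1))) *
        ((C₁ * R ^ (-m) * if Q then χ ^ κ else 0) * ζ) ≤
      (C₁ + C₂) * A * (lowerOrder m α ε (U⁻¹ * u) * if S then (χ * ζ) ^ κ else 0) := by
  set v := U⁻¹ * u with hv
  have hv0 : 0 ≤ v := by positivity
  have huv : u = U * v := by rw [hv]; field_simp
  have hvε : 0 < v + ε := by linarith
  have e0 : u + ε * U = U * (v + ε) := by rw [huv]; ring
  have hA0 : 0 < A := by rw [← hA1]; positivity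
  have e1 : U ^ α * (u + ε * U) ^ (1 - α) = U * (v + ε) ^ (1 - α) := by
    rw [e0, Real.mul_rpow hU.le hvε.le, ← mul_assoc, ← Real.rpow_add hU]
    simp
  have e2 : U ^ α * (u + ε * U) ^ (m - 1 - α) = U ^ (m - 1) * (v + ε) ^ (m - 1 - α) := by
    rw [e0, Real.mul_rpow hU.le hvε.le, ← mul_assoc, ← Real.rpow_add hU]
    congr 2; ring
  have e3 : (U ^ α) ^ (1 - m) * (u + ε * U) ^ ((1 + α) * (m - 1)) =
      U ^ (m - 1) * (v + ε) ^ ((1 + α) * (m - 1)) := by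
    rw [e0, Real.mul_rpow hU.le hvε.le, ← mul_assoc, ← Real.rpow_mul hU.le, ← Real.rpow_add hU]
    congr 2; ring
  have p1 := Real.rpow_nonneg hvε.le (1 - α)
  have p2 := Real.rpow_nonneg hvε.le (m - 1 - α)
  have p3 := Real.rpow_nonneg hvε.le ((1 + α) * (m - 1))
  have hL0 : 0 ≤ lowerOrder m α ε v := by unfold lowerOrder; positivity
  set b := lowerOrder m α ε v with hb
  set w : ℝ := if S then (χ * ζ) ^ κ else 0 with hw
  have hw0 : 0 ≤ w := by rw [hw]; split_ifs <;> positivity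
  have hχκ := le_rpow_self hχ0 hχ1 hκ0.le hκ1.le
  have hζκ := le_rpow_self hζ0 hζ1 hκ0.le hκ1.le
  have hz : χ = 0 ∨ ζ = 0 → χ ^ κ * ζ ^ κ = 0 := by
    rintro (h | h) <;> simp [h, Real.zero_rpow hκ0.ne']
  have w1 : χ * (if P then ζ ^ κ else 0) ≤ w := by
    by_cases hPp : P
    · rw [if_pos hPp]
      refine (mul_le_mul_of_nonneg_right hχκ (Real.rpow_nonneg hζ0 _)).trans ?_
      by_cases h : χ = 0 ∨ ζ = 0
      · rw [hz h]; exact hw0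
      · push Not at h
        rw [hw, if_pos (hP h.1 h.2 hPp), Real.mul_rpow hχ0 hζ0]
    · rw [if_neg hPp, mul_zero]; exact hw0
  have w2 : (if Q then χ ^ κ else 0) * ζ ≤ w := by
    by_cases hQq : Q
    · rw [if_pos hQq]
      refine (mul_le_mul_of_nonneg_left hζκ (Real.rpow_nonneg hχ0 _)).trans ?_
      by_cases h : χ = 0 ∨ ζ = 0
      · rw [hz h]; exact hw0
      · push Not at h
        rw [hw, if_pos (hQ h.1 h.2 hQq), Real.mul_rpow hχ0 hζ0]
    · rw [if_neg hQq, zero_mul]; exact hw0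
  have b1 : v + (v + ε) ^ (1 - α) ≤ b := by rw [hb]; unfold lowerOrder; linarith
  have b2 : (v + ε) ^ (m - 1 - α) + (v + ε) ^ ((1 + α) * (m - 1)) ≤ b := by
    rw [hb]; unfold lowerOrder; linarith
  rw [e1, e2, e3]
  calc (u + U * (v + ε) ^ (1 - α)) * (χ * (C₂ / T * if P then ζ ^ κ else 0)) +
      (U ^ (m - 1) * (v + ε) ^ (m - 1 - α) + U ^ (m - 1) * (v + ε) ^ ((1 + α) * (m - 1))) *
        ((C₁ * R ^ (-m) * if Q then χ ^ κ else 0) * ζ)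
      = C₂ * (U / T) * ((v + (v + ε) ^ (1 - α)) * (χ * if P then ζ ^ κ else 0)) +
        C₁ * (U ^ (m - 1) * R ^ (-m)) *
          (((v + ε) ^ (m - 1 - α) + (v + ε) ^ ((1 + α) * (m - 1))) *
            ((if Q then χ ^ κ else 0) * ζ)) := by
        rw [show u + U * (v + ε) ^ (1 - α) = U * (v + (v + ε) ^ (1 - α)) by rw [mul_add, ← huv]]
        ring
    _ ≤ C₂ * A * (b * w) + C₁ * A * (b * w) := by
        rw [hA1]
        have q1 : 0 ≤ χ * (if P then ζ ^ κ else 0) := by split_ifs <;> positivity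
        have q2 : 0 ≤ (if Q then χ ^ κ else 0) * ζ := by split_ifs <;> positivity
        refine add_le_add ?_ ?_
        · exact mul_le_mul_of_nonneg_left (mul_le_mul b1 w1 q1 hL0) (by positivity)
        · refine mul_le_mul (mul_le_mul_of_nonneg_left hA2 hC₁.le)
            (mul_le_mul b2 w2 q2 hL0) (mul_nonneg (by positivity) q2) (by positivity)
    _ = _ := by ring

theorem exists_cutoff_estimate (hN : 1 ≤ N) {m p q β α κ C₀ : ℝ} (hp : 0 < p) (hq : 0 < q)
    (hβ : 0 < β) (hm : 1 < m)
    (hpq : p + q ≤ m - 1 + ((N : ℝ) - β + m) / ((N : ℝ) + β))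
    {K : E N → ℝ} (hK : IsAdmissibleKernel β K) {u : E N × ℝ → ℝ} (hu : Measurable u)
    (hu0 : ∀ z, 0 ≤ u z) (hκ0 : 0 < κ) (hκ1 : κ < 1) (hC₀ : 0 < C₀)
    (hcap : IsCapacityBound m α C₀ (nonlocalTerm K p q u) u)
    (hloc : ∀ C : Set (E N × ℝ), IsCompact C → C ⊆ halfSpace N →
      ∫⁻ z in C, nonlocalTerm K p q u z < ∞) :
    ∃ C : ℝ, 0 < C ∧ ∀ R τ T : ℝ, 1 ≤ R → 0 < τ →
      T = R ^ (((N : ℝ) + β) * (p + q) - 2 * N) →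
      ∃ (χ : E N → ℝ) (ζ : ℝ → ℝ), IsSpaceTimeCutoff R T τ χ ζ ∧
        energy ((p + q) / 2) u χ ζ < ∞ ∧
        ∀ ε : ℝ, 0 < ε → energy ((p + q) / 2) u χ ζ ≤
          ENNReal.ofReal (C * (R ^ (-(N : ℝ)) / T)) * ∫⁻ z in halfSpace N, ENNReal.ofReal
            (lowerOrder m α ε (R ^ ((N : ℝ) + β) * u z) *
              indicator (transitionRegion N R T) (fun z => (χ z.1 * ζ z.2) ^ κ) z) := by
  obtain ⟨c, hc, hKc⟩ := hK.exists_lower_bound hβ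
  obtain ⟨C₁, hC₁, hspace⟩ := exists_space_cutoff N hm hκ0.le hκ1
  obtain ⟨C₂, hC₂, htime⟩ := exists_time_cutoff hκ0.le hκ1
  have hγ : 0 < (N : ℝ) + β := by positivity
  refine ⟨c⁻¹ * C₀ * (C₁ + C₂), by positivity, fun R τ T hR hτ hTR => ?_⟩
  have hR0 : 0 < R := by linarith
  have hT : 0 < T := by rw [hTR]; positivity
  obtain ⟨χ, hχc, hχk, hχ0, hχ1, hχe1, hχe0, hχg⟩ := hspace R hR0
  obtain ⟨ζ, hζc, hζk, hζ0, hζ1, hζs, hζe1, hζe0, hζd⟩ := htime τ T hτ hT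
  have hζneg : ∀ t, t ≤ 0 → ζ t = 0 := fun t ht =>
    image_eq_zero_of_notMem_tsupport fun h => not_lt.2 ht (hζs h)
  have hsc : IsSpaceTimeCutoff R T τ χ ζ :=
    ⟨hχc.continuous.measurable, hχ0, hχ1, hχe1, hχe0, hζc.continuous.measurable, hζ0, hζ1, hζe1,
      hζe0, hζneg⟩
  have hms : MeasurableSet {x : E N | R ≤ ‖x‖ ∧ ‖x‖ ≤ 2 * R} :=
    (measurableSet_le measurable_const measurable_norm).inter
      (measurableSet_le measurable_norm measurable_const)
  have hcut : IsCutoff m χ ζ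
      (fun t => C₂ / T * indicator (Icc T (2 * T)) (fun t => ζ t ^ κ) t)
      (fun x => C₁ * R ^ (-m) *
        indicator {x | R ≤ ‖x‖ ∧ ‖x‖ ≤ 2 * R} (fun x => χ x ^ κ) x) :=
    { contDiff_space := hχc
      compact_space := hχk
      nonneg_space := hχ0
      contDiff_time := hζc
      compact_time := hζk
      nonneg_time := hζ0
      tsupport_time := hζs
      measurable_D := ((hζc.continuous.measurable.pow_const κ).indicator
        measurableSet_Icc).const_mul _
      nonneg_D := fun t => mul_nonneg (by positivity)
        (indicator_nonneg (fun t _ => Real.rpow_nonneg (hζ0 t) κ) t)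
      deriv_le := hζd
      measurable_W := ((hχc.continuous.measurable.pow_const κ).indicator hms).const_mul _
      nonneg_W := fun x => mul_nonneg (by positivity)
        (indicator_nonneg (fun x _ => Real.rpow_nonneg (hχ0 x) κ) x)
      gradient_le := hχg }
  have hlow := le_lintegral_nonlocalTerm (K := K) hN hp hq (c := c * R ^ (-β)) (R := R)
    (by positivity) (fun x hx hxR => hKc R hR x hx hxR) hu hu0 hsc.measurable_space hχ0 hχ1 hχe0
    hsc.measurable_time hζneg
  change ENNReal.ofReal (c * R ^ (-β)) * energy ((p + q) / 2) u χ ζ ≤ _ at hlow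
  have hcR : 0 < c * R ^ (-β) := by positivity
  have hdiv : ∀ Z : ℝ≥0∞, ∫⁻ z in halfSpace N, nonlocalTerm K p q u z *
      ENNReal.ofReal (χ z.1 * ζ z.2) ≤ Z → energy ((p + q) / 2) u χ ζ ≤
      ENNReal.ofReal (c * R ^ (-β))⁻¹ * Z := by
    intro Z hZ
    have h1 : energy ((p + q) / 2) u χ ζ = ENNReal.ofReal (c * R ^ (-β))⁻¹ *
        (ENNReal.ofReal (c * R ^ (-β)) * energy ((p + q) / 2) u χ ζ) := by
      rw [← mul_assoc, ← ENNReal.ofReal_mul (by positivity), inv_mul_cancel₀ hcR.ne',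
        ENNReal.ofReal_one, one_mul]
    rw [h1]
    gcongr
    exact hlow.trans hZ
  refine ⟨χ, ζ, hsc, ?_, fun ε hε => ?_⟩
  -- The energy is finite because the cutoff has compact support in t > 0, where the nonlocal term
  -- is locally integrable. This makes the later absorption legitimate.
  · have hk := hasCompactSupport_mul_prod hχk hζk
    have h1 : ∫⁻ z in halfSpace N, nonlocalTerm K p q u z * ENNReal.ofReal (χ z.1 * ζ z.2) ≤
        ∫⁻ z in tsupport (fun z : E N × ℝ => χ z.1 * ζ z.2), nonlocalTerm K p q u z := by
      rw [← lintegral_indicator measurableSet_halfSpace,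
        ← lintegral_indicator (isClosed_tsupport _).measurableSet]
      refine lintegral_mono fun z => ?_
      by_cases hz : z ∈ tsupport (fun z : E N × ℝ => χ z.1 * ζ z.2)
      · rw [indicator_of_mem hz, indicator_of_mem (hcut.tsupport_subset hz)]
        refine mul_le_of_le_one_right' ?_
        rw [← ENNReal.ofReal_one]
        exact ENNReal.ofReal_le_ofReal (mul_le_one₀ (hχ1 _) (hζ0 _) (hζ1 _))
      · have h0 : χ z.1 * ζ z.2 = 0 :=
          image_eq_zero_of_notMem_tsupport (f := fun z : E N × ℝ => χ z.1 * ζ z.2) hz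
        rw [indicator_of_notMem hz]
        simp [indicator, h0]
    exact (hdiv _ h1).trans_lt
      (ENNReal.mul_lt_top ENNReal.ofReal_lt_top (hloc _ hk hcut.tsupport_subset))
  · set U : ℝ := R ^ (-((N : ℝ) + β)) with hU
    have hU0 : 0 < U := by positivity
    have hUinv : U⁻¹ = R ^ ((N : ℝ) + β) := by rw [hU, Real.rpow_neg hR0.le, inv_inv]
    set A : ℝ := R ^ (-β) * (R ^ (-(N : ℝ)) / T) with hA
    have hA1 : U / T = A := by
      rw [hA, hU, mul_div_assoc', ← Real.rpow_add hR0]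
      congr 2; ring
    -- The upper bound on p+q enters exactly here: diffusion is no stronger than the time scaling.
    have hA2 : U ^ (m - 1) * R ^ (-m) ≤ A := by
      rw [← hA1, hU, hTR, ← Real.rpow_mul hR0.le, ← Real.rpow_add hR0, ← Real.rpow_sub hR0]
      refine Real.rpow_le_rpow_of_exponent_le hR ?_
      have h1 : (p + q - (m - 1)) * ((N : ℝ) + β) ≤ (N : ℝ) - β + m := by
        rw [← le_div_iff₀ hγ]; linarith
      nlinarith
    have hmain := hdiv _ (hcap χ ζ _ _ hcut (U ^ α) (ε * U) (by positivity) (by positivity))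
    refine hmain.trans ?_
    have hA0 : 0 < A := by positivity
    have hbound : ∫⁻ z in halfSpace N, ENNReal.ofReal
        ((u z + U ^ α * (u z + ε * U) ^ (1 - α)) *
          (χ z.1 * (C₂ / T * indicator (Icc T (2 * T)) (fun t => ζ t ^ κ) z.2)) +
        (U ^ α * (u z + ε * U) ^ (m - 1 - α) +
          (U ^ α) ^ (1 - m) * (u z + ε * U) ^ ((1 + α) * (m - 1))) *
          ((C₁ * R ^ (-m) * indicator {x | R ≤ ‖x‖ ∧ ‖x‖ ≤ 2 * R} (fun x => χ x ^ κ) z.1) *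
            ζ z.2)) ≤
        ENNReal.ofReal ((C₁ + C₂) * A) * ∫⁻ z in halfSpace N, ENNReal.ofReal
            (lowerOrder m α ε (R ^ ((N : ℝ) + β) * u z) *
              indicator (transitionRegion N R T) (fun z => (χ z.1 * ζ z.2) ^ κ) z) := by
      rw [← lintegral_const_mul' _ _ ENNReal.ofReal_ne_top]
      refine lintegral_mono fun z => ?_
      rw [← ENNReal.ofReal_mul (by positivity), ← hUinv]
      refine ENNReal.ofReal_le_ofReal ?_
      classical
      simp only [indicator_apply]
      have hx : χ z.1 ≠ 0 → ‖z.1‖ ≤ 2 * R := fun h => not_lt.1 fun h' => h (hχe0 _ h')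
      have ht1 : ζ z.2 ≠ 0 → z.2 ≤ 2 * T := fun h => not_lt.1 fun h' => h (hζe0 _ h')
      have ht0 : ζ z.2 ≠ 0 → 0 < z.2 := fun h => not_le.1 fun h' => h (hζneg _ h')
      exact scaled_integrand_le (hu0 z) hε hU0 hT hκ0 hκ1 hC₁ hC₂ (hχ0 _) (hχ1 _) (hζ0 _)
        (hζ1 _) hA1 hA2 (fun h1 h2 h3 => ⟨hx h1, ht0 h2, ht1 h2, Or.inl h3.1⟩)
        (fun h1 h2 h3 => ⟨hx h1, ht0 h2, ht1 h2, Or.inr h3.1⟩)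
    refine (mul_le_mul_right (mul_le_mul_right hbound _) _).trans (le_of_eq ?_)
    rw [← mul_assoc, ← mul_assoc, ← ENNReal.ofReal_mul (by positivity),
      ← ENNReal.ofReal_mul (by positivity)]
    congr 2
    rw [hA, mul_inv]
    have : R ^ (-β) ≠ 0 := by positivity
    field_simp

end KeyEstimate

/-! ### Absorbing lower powers into v^σ. -/

section LowerOrder

/-- Split at M with M^(κ-1) = δ: below it the constant suffices, above it sublinearity does. -/
theorem exists_rpow_le_mul_add {κ δ : ℝ} (hκ0 : 0 < κ) (hκ1 : κ < 1) (hδ : 0 < δ) :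
    ∃ C : ℝ, 0 < C ∧ ∀ s : ℝ, 0 ≤ s → s ^ κ ≤ δ * s + C := by
  set M : ℝ := δ ^ (-(1 / (1 - κ))) with hM
  have hM0 : 0 < M := by positivity
  have h1κ : 0 < 1 - κ := by linarith
  refine ⟨M ^ κ, by positivity, fun s hs => ?_⟩
  rcases le_or_gt s M with h | h
  · have := Real.rpow_le_rpow hs h hκ0.le
    nlinarith [mul_nonneg hδ.le hs]
  · have hs0 : 0 < s := hM0.trans h
    have e : M ^ (κ - 1) = δ := by
      rw [hM, ← Real.rpow_mul hδ.le, show -(1 / (1 - κ)) * (κ - 1) = 1 by field_simp; ring,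
        Real.rpow_one]
    have h2 : s ^ (κ - 1) ≤ δ := by
      rw [← e]; exact Real.rpow_le_rpow_of_nonpos hM0 h.le (by linarith)
    have h3 : s ^ κ = s ^ (κ - 1) * s := by
      rw [← Real.rpow_add_one hs0.ne']; ring_nf
    rw [h3]
    have := mul_le_mul_of_nonneg_right h2 hs
    have : 0 < M ^ κ := by positivity
    linarith

/-- Split at M with M^e = γ: below it the constant suffices, above it the higher power σ does. -/
theorem exists_rpow_le_add_mul {e σ γ : ℝ} (he : 0 < e) (heσ : e < σ) (hγ : 0 < γ) :
    ∃ C : ℝ, 0 < C ∧ ∀ s : ℝ, 0 ≤ s → s ^ e ≤ γ + C * s ^ σ := by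
  set M : ℝ := γ ^ (1 / e) with hM
  have hM0 : 0 < M := by positivity
  refine ⟨M ^ (e - σ), by positivity, fun s hs => ?_⟩
  rcases le_or_gt s M with h | h
  · have h1 := Real.rpow_le_rpow hs h he.le
    have h2 : M ^ e = γ := by
      rw [hM, ← Real.rpow_mul hγ.le, one_div_mul_cancel he.ne', Real.rpow_one]
    have h3 : 0 ≤ M ^ (e - σ) * s ^ σ := by positivity
    linarith
  · have hs0 : 0 < s := hM0.trans h
    have h3 : s ^ e = s ^ (e - σ) * s ^ σ := by rw [← Real.rpow_add hs0]; ring_nf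
    rw [h3]
    have h2 : s ^ (e - σ) ≤ M ^ (e - σ) :=
      Real.rpow_le_rpow_of_nonpos hM0 h.le (by linarith)
    have := mul_le_mul_of_nonneg_right h2 (Real.rpow_nonneg hs σ)
    linarith

theorem add_rpow_le_two_rpow_mul {a b σ : ℝ} (ha : 0 ≤ a) (hb : 0 ≤ b) (hσ : 0 ≤ σ) :
    (a + b) ^ σ ≤ 2 ^ σ * (a ^ σ + b ^ σ) := by
  have h1 : (a + b) ^ σ ≤ (2 * max a b) ^ σ := by
    refine Real.rpow_le_rpow (by positivity) ?_ hσ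
    linarith [le_max_left a b, le_max_right a b]
  rw [Real.mul_rpow (by norm_num) (le_max_of_le_left ha)] at h1
  refine h1.trans (mul_le_mul_of_nonneg_left ?_ (by positivity))
  rcases le_total a b with h | h
  · rw [max_eq_right h]; linarith [Real.rpow_nonneg ha σ]
  · rw [max_eq_left h]; linarith [Real.rpow_nonneg hb σ]

variable {m α σ : ℝ}

/-- With ε = 1 all four powers are at most (v+1)^a, and (v+1)^a h^(a/σ) = ((v+1)^σ h)^(a/σ) is a
sublinear power of the weighted energy density. This identity dictates the cutoff exponent κ = a/σ.
-/
theorem exists_lowerOrder_mul_le {a δ : ℝ} (ha : 1 ≤ a) (haσ : a < σ)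
    (h1 : 1 - α ≤ a) (h2 : m - 1 - α ≤ a) (h3 : (1 + α) * (m - 1) ≤ a)
    (hδ : 0 < δ) :
    ∃ C : ℝ, 0 < C ∧ ∀ v h : ℝ, 0 ≤ v → 0 ≤ h → h ≤ 1 →
      lowerOrder m α 1 v * h ^ (a / σ) ≤ δ * (v ^ σ * h) + C := by
  have hσ : 0 < σ := by linarith
  have hδ' : 0 < δ / (4 * 2 ^ σ) := by positivity
  obtain ⟨C, hC, hC'⟩ := exists_rpow_le_mul_add (κ := a / σ) (by positivity)
    ((div_lt_one hσ).2 haσ) hδ'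
  refine ⟨δ + 4 * C, by positivity, fun v h hv h0 hh1 => ?_⟩
  have hv1 : 1 ≤ v + 1 := by linarith
  have hexp : ∀ e : ℝ, e ≤ a → (v + 1) ^ e ≤ (v + 1) ^ a := fun e he =>
    Real.rpow_le_rpow_of_exponent_le hv1 he
  have hlo : lowerOrder m α 1 v ≤ 4 * (v + 1) ^ a := by
    have h0' := hexp 1 ha
    rw [Real.rpow_one] at h0'
    unfold lowerOrder
    linarith [hexp _ h1, hexp _ h2, hexp _ h3]
  have hs := hC' ((v + 1) ^ σ * h) (by positivity)
  rw [Real.mul_rpow (by positivity) h0, ← Real.rpow_mul (by linarith),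
    mul_div_cancel₀ _ hσ.ne'] at hs
  have hsum := add_rpow_le_two_rpow_mul hv zero_le_one hσ.le
  rw [Real.one_rpow] at hsum
  calc lowerOrder m α 1 v * h ^ (a / σ) ≤ 4 * (v + 1) ^ a * h ^ (a / σ) :=
        mul_le_mul_of_nonneg_right hlo (Real.rpow_nonneg h0 _)
    _ ≤ 4 * (δ / (4 * 2 ^ σ) * ((v + 1) ^ σ * h) + C) := by rw [mul_assoc]; gcongr
    _ ≤ 4 * (δ / (4 * 2 ^ σ) * (2 ^ σ * (v ^ σ + 1) * h) + C) := by gcongr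
    _ = δ * (v ^ σ * h) + (δ * h + 4 * C) := by field_simp; ring
    _ ≤ δ * (v ^ σ * h) + (δ + 4 * C) := by
        have := mul_le_mul_of_nonneg_left hh1 hδ.le
        linarith

/-- For the vanishing step the additive constant must be arbitrarily small. This works because all
four exponents are positive, by α < 1 and α < m-1, so each power is small for small v and ε. -/
theorem exists_lowerOrder_le {γ : ℝ} (hσ : 1 < σ) (hα0 : 0 < α) (hα1 : α < 1)
    (hαm : α < m - 1) (h2 : m - 1 - α < σ) (h3 : (1 + α) * (m - 1) < σ) (hγ : 0 < γ) :
    ∃ ε C : ℝ, 0 < ε ∧ 0 < C ∧ ∀ v : ℝ, 0 ≤ v → lowerOrder m α ε v ≤ γ + C * v ^ σ := by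
  -- Four terms of γ/8 use half of γ; the other half pays for C 2^σ ε^σ.
  have hγ' : 0 < γ / 8 := by positivity
  obtain ⟨C₀, hC₀, H₀⟩ := exists_rpow_le_add_mul one_pos hσ hγ'
  obtain ⟨C₁, hC₁, H₁⟩ := exists_rpow_le_add_mul (e := 1 - α) (σ := σ) (by linarith)
    (by linarith) hγ'
  obtain ⟨C₂, hC₂, H₂⟩ := exists_rpow_le_add_mul (e := m - 1 - α) (by linarith) h2 hγ'
  obtain ⟨C₃, hC₃, H₃⟩ := exists_rpow_le_add_mul (e := (1 + α) * (m - 1))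
    (mul_pos (by linarith) (by linarith)) h3 hγ'
  set C := C₀ + C₁ + C₂ + C₃ with hC
  have hCpos : 0 < C := by positivity
  have hσ0 : 0 < σ := by linarith
  set ε : ℝ := (γ / (2 * C * 2 ^ σ)) ^ (1 / σ) with hε
  have hε0 : 0 < ε := by positivity
  have hεσ : ε ^ σ = γ / (2 * C * 2 ^ σ) := by
    rw [hε, ← Real.rpow_mul (by positivity), one_div_mul_cancel hσ0.ne', Real.rpow_one]
  refine ⟨ε, C * 2 ^ σ, hε0, by positivity, fun v hv => ?_⟩
  have hvε : 0 ≤ v + ε := by linarith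
  have hmono : v ^ σ ≤ (v + ε) ^ σ := Real.rpow_le_rpow hv (by linarith) hσ0.le
  have a0 := H₀ v hv
  rw [Real.rpow_one] at a0
  have a1 := H₁ _ hvε
  have a2 := H₂ _ hvε
  have a3 := H₃ _ hvε
  have a4 := mul_le_mul_of_nonneg_left hmono hC₀.le
  have a5 : lowerOrder m α ε v ≤ γ / 2 + C * (v + ε) ^ σ := by
    unfold lowerOrder
    rw [hC]
    linarith
  have a6 := mul_le_mul_of_nonneg_left (add_rpow_le_two_rpow_mul hv hε0.le hσ0.le) hCpos.le
  rw [hεσ] at a6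
  have a7 : C * (2 ^ σ * (v ^ σ + γ / (2 * C * 2 ^ σ))) = C * 2 ^ σ * v ^ σ + γ / 2 := by
    field_simp
  linarith

end LowerOrder

/-! ### Scale-invariant comparison with the energy, and exhaustion. -/

section EnergyBounds

variable {N : ℕ}

theorem ofReal_mul_le_sq_add {a M : ℝ} (ha : 0 ≤ a) (hM : 0 < M) (g : ℝ≥0∞) :
    ENNReal.ofReal a * g ≤ ENNReal.ofReal M * g ^ 2 + ENNReal.ofReal (a ^ 2 / M) := by
  rcases eq_or_ne g ∞ with rfl | hg
  · have : ENNReal.ofReal M * (∞ : ℝ≥0∞) ^ 2 = ∞ := by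
      rw [ENNReal.top_pow two_ne_zero, ENNReal.mul_top (by simpa using hM)]
    rw [this, top_add]
    exact le_top
  · lift g to NNReal using hg
    rw [← ENNReal.ofReal_coe_nnreal, ← ENNReal.ofReal_pow g.coe_nonneg, ← ENNReal.ofReal_mul ha,
      ← ENNReal.ofReal_mul hM.le, ← ENNReal.ofReal_add (by positivity) (by positivity)]
    refine ENNReal.ofReal_le_ofReal ?_
    have h1 : M * (g : ℝ) ^ 2 + a ^ 2 / M - a * g =
        M * ((g : ℝ) - a / (2 * M)) ^ 2 + 3 / 4 * (a ^ 2 / M) := by field_simp; ring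
    have h2 : 0 ≤ M * ((g : ℝ) - a / (2 * M)) ^ 2 + 3 / 4 * (a ^ 2 / M) := by positivity
    linarith

/-- Cauchy–Schwarz in time on an interval of length 2T, in Young form: T^(-1/2) g ≤ M g² + T^(-1)/M,
and integrating the constant costs at most 2/M. -/
theorem lintegral_time_le {ζ : ℝ → ℝ} {g : ℝ → ℝ≥0∞} {T M : ℝ} (hT : 0 < T) (hM : 0 < M)
    (hζ : Measurable ζ) (hg : Measurable g) (hζ1 : ∀ t, ζ t ≤ 1)
    (hζs : ∀ t, t ∉ Ioc 0 (2 * T) → ζ t = 0) :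
    ENNReal.ofReal (T ^ (-(1 / 2 : ℝ))) * ∫⁻ t, ENNReal.ofReal (ζ t) * g t ≤
      ENNReal.ofReal M * (∫⁻ t, ENNReal.ofReal (ζ t) * g t ^ 2) + ENNReal.ofReal (2 / M) := by
  have hsq : (T ^ (-(1 / 2 : ℝ))) ^ 2 = T⁻¹ := by
    rw [← Real.rpow_natCast, ← Real.rpow_mul hT.le]
    norm_num [Real.rpow_neg_one]
  have h1 : ∀ t, ENNReal.ofReal (T ^ (-(1 / 2 : ℝ))) * (ENNReal.ofReal (ζ t) * g t) ≤
      ENNReal.ofReal M * (ENNReal.ofReal (ζ t) * g t ^ 2) +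
        ENNReal.ofReal (T⁻¹ / M) * ENNReal.ofReal (ζ t) := by
    intro t
    have := ofReal_mul_le_sq_add (a := T ^ (-(1 / 2 : ℝ))) (by positivity) hM (g t)
    rw [hsq] at this
    calc _ = ENNReal.ofReal (ζ t) * (ENNReal.ofReal (T ^ (-(1 / 2 : ℝ))) * g t) := by ring
      _ ≤ ENNReal.ofReal (ζ t) * (ENNReal.ofReal M * g t ^ 2 + ENNReal.ofReal (T⁻¹ / M)) := by
        gcongr
      _ = _ := by ring
  rw [← lintegral_const_mul' _ _ ENNReal.ofReal_ne_top,
    ← lintegral_const_mul' _ _ ENNReal.ofReal_ne_top]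
  refine (lintegral_mono h1).trans ?_
  have hm : Measurable fun t => ENNReal.ofReal M * (ENNReal.ofReal (ζ t) * g t ^ 2) :=
    (hζ.ennreal_ofReal.mul (hg.pow_const 2)).const_mul _
  rw [lintegral_add_left hm]
  gcongr
  rw [lintegral_const_mul' _ _ ENNReal.ofReal_ne_top]
  have h2 : ∫⁻ t, ENNReal.ofReal (ζ t) ≤ ENNReal.ofReal (2 * T) := by
    calc ∫⁻ t, ENNReal.ofReal (ζ t) ≤ ∫⁻ t, indicator (Ioc 0 (2 * T)) (fun _ => 1) t := by
          refine lintegral_mono fun t => ?_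
          by_cases ht : t ∈ Ioc 0 (2 * T)
          · rw [indicator_of_mem ht, ← ENNReal.ofReal_one]
            exact ENNReal.ofReal_le_ofReal (hζ1 t)
          · simp [hζs t ht]
      _ = _ := by
          rw [lintegral_indicator measurableSet_Ioc]
          simp
  calc ENNReal.ofReal (T⁻¹ / M) * ∫⁻ t, ENNReal.ofReal (ζ t)
      ≤ ENNReal.ofReal (T⁻¹ / M) * ENNReal.ofReal (2 * T) := by gcongr
    _ = ENNReal.ofReal (2 / M) := by
      rw [← ENNReal.ofReal_mul (by positivity)]
      congr 1
      field_simp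

theorem exists_volume_closedBall (N : ℕ) : ∃ V : ℝ, 0 ≤ V ∧ ∀ R : ℝ, 0 < R →
    volume (Metric.closedBall (0 : E N) (2 * R)) = ENNReal.ofReal (V * R ^ (N : ℝ)) := by
  refine ⟨2 ^ N * (volume (Metric.ball (0 : E N) 1)).toReal, by positivity, fun R hR => ?_⟩
  rw [Measure.addHaar_closedBall _ _ (by positivity), finrank_euclideanSpace, Fintype.card_fin,
    Real.rpow_natCast, mul_right_comm, ← mul_pow, ENNReal.ofReal_mul (by positivity),
    ENNReal.ofReal_toReal Metric.isBounded_ball.measure_lt_top.ne]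

/-- Integration over a box of size `R^N T` in normalised form. -/
theorem normalised_lintegral_le {σ γ R T M c d V : ℝ} (hR : 0 < R)
    (hTR : T = R ^ (2 * (γ * σ) - 2 * N)) (hM : 0 < M) (hc : 0 ≤ c) (hd : 0 ≤ d) (hV0 : 0 ≤ V)
    (hV : volume (Metric.closedBall (0 : E N) (2 * R)) = ENNReal.ofReal (V * R ^ (N : ℝ)))
    {u w F : E N × ℝ → ℝ} {ζ : ℝ → ℝ} (hu : Measurable u) (hu0 : ∀ z, 0 ≤ u z)
    (hw : Measurable w) (hζ : Measurable ζ) (hζ0 : ∀ t, 0 ≤ ζ t)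
    (hζ1 : ∀ t, ζ t ≤ 1) (hζs : ∀ t, t ∉ Ioc 0 (2 * T) → ζ t = 0)
    (hF : ∀ z, F z ≤ c * ((R ^ γ * u z) ^ σ * (w z * ζ z.2)) +
      d * indicator (Metric.closedBall 0 (2 * R) ×ˢ Ioc 0 (2 * T)) (fun _ => 1) z) :
    ENNReal.ofReal (R ^ (-(N : ℝ)) / T) * ∫⁻ z in halfSpace N, ENNReal.ofReal (F z) ≤
      ENNReal.ofReal c * (ENNReal.ofReal M * (∫⁻ t, ENNReal.ofReal (ζ t) *
        (∫⁻ x, ENNReal.ofReal (u (x, t) ^ σ * w (x, t))) ^ 2) + ENNReal.ofReal (2 / M)) +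
      ENNReal.ofReal (2 * d * V) := by
  have hT : 0 < T := by rw [hTR]; positivity
  set g : ℝ → ℝ≥0∞ := fun t => ∫⁻ x, ENNReal.ofReal (u (x, t) ^ σ * w (x, t)) with hg
  have huw : Measurable fun z => ENNReal.ofReal (u z ^ σ * w z) :=
    ((hu.pow_const σ).mul hw).ennreal_ofReal
  have hgm : Measurable g := huw.lintegral_prod_left'
  set Q : Set (E N × ℝ) := Metric.closedBall 0 (2 * R) ×ˢ Ioc 0 (2 * T) with hQ
  have hQm : MeasurableSet Q := Metric.isClosed_closedBall.measurableSet.prod measurableSet_Ioc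
  have hpt : ∀ z, ENNReal.ofReal (F z) ≤ ENNReal.ofReal (c * R ^ (γ * σ)) *
      (ENNReal.ofReal (ζ z.2) * ENNReal.ofReal (u z ^ σ * w z)) +
      indicator Q (fun _ => ENNReal.ofReal d) z := by
    intro z
    refine (ENNReal.ofReal_le_ofReal (hF z)).trans (ENNReal.ofReal_add_le.trans
      (add_le_add (le_of_eq ?_) (le_of_eq ?_)))
    · have := hu0 z
      rw [← ENNReal.ofReal_mul (hζ0 _), ← ENNReal.ofReal_mul (by positivity),
        Real.mul_rpow (by positivity) (hu0 z), ← Real.rpow_mul hR.le]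
      congr 1; ring
    · by_cases hz : z ∈ Q <;> simp [hz]
  have hm1 : Measurable fun z : E N × ℝ => ENNReal.ofReal (c * R ^ (γ * σ)) *
      (ENNReal.ofReal (ζ z.2) * ENNReal.ofReal (u z ^ σ * w z)) :=
    (((hζ.comp measurable_snd).ennreal_ofReal).mul huw).const_mul _
  have hI1 : ∫⁻ z : E N × ℝ, ENNReal.ofReal (c * R ^ (γ * σ)) *
      (ENNReal.ofReal (ζ z.2) * ENNReal.ofReal (u z ^ σ * w z)) =
      ENNReal.ofReal (c * R ^ (γ * σ)) * ∫⁻ t, ENNReal.ofReal (ζ t) * g t := by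
    rw [Measure.volume_eq_prod, lintegral_prod_symm' _ hm1,
      ← lintegral_const_mul' _ _ ENNReal.ofReal_ne_top]
    refine lintegral_congr fun t => ?_
    have hm2 : Measurable fun x => ENNReal.ofReal (u (x, t) ^ σ * w (x, t)) :=
      huw.comp measurable_prodMk_right
    simp only
    rw [lintegral_const_mul' _ _ ENNReal.ofReal_ne_top,
      lintegral_const_mul' _ _ ENNReal.ofReal_ne_top]
  have hI2 : ∫⁻ z, indicator Q (fun _ => ENNReal.ofReal d) z =
      ENNReal.ofReal d * (ENNReal.ofReal (V * R ^ (N : ℝ)) * ENNReal.ofReal (2 * T)) := by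
    rw [lintegral_indicator hQm, setLIntegral_const, hQ, Measure.volume_eq_prod,
      Measure.prod_prod, hV, Real.volume_Ioc, sub_zero]
  have htot : ∫⁻ z in halfSpace N, ENNReal.ofReal (F z) ≤
      ENNReal.ofReal (c * R ^ (γ * σ)) * (∫⁻ t, ENNReal.ofReal (ζ t) * g t) +
      ENNReal.ofReal d * (ENNReal.ofReal (V * R ^ (N : ℝ)) * ENNReal.ofReal (2 * T)) := by
    calc _ ≤ ∫⁻ z, ENNReal.ofReal (F z) := setLIntegral_le_lintegral _ _
      _ ≤ _ := lintegral_mono hpt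
      _ = _ := by rw [lintegral_add_left hm1, hI1, hI2]
  -- The exponent of T is chosen for this identity: no power of R survives the normalisation.
  have hscale : R ^ (-(N : ℝ)) / T * R ^ (γ * σ) = T ^ (-(1 / 2 : ℝ)) := by
    rw [hTR, ← Real.rpow_mul hR.le, ← Real.rpow_sub hR, ← Real.rpow_add hR]
    congr 1; ring
  have htime := lintegral_time_le hT hM hζ hgm hζ1 hζs
  calc _ ≤ ENNReal.ofReal (R ^ (-(N : ℝ)) / T) *
        (ENNReal.ofReal (c * R ^ (γ * σ)) * (∫⁻ t, ENNReal.ofReal (ζ t) * g t) +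
      ENNReal.ofReal d * (ENNReal.ofReal (V * R ^ (N : ℝ)) * ENNReal.ofReal (2 * T))) := by
        gcongr
    _ = ENNReal.ofReal c * (ENNReal.ofReal (T ^ (-(1 / 2 : ℝ))) *
          ∫⁻ t, ENNReal.ofReal (ζ t) * g t) + ENNReal.ofReal (2 * d * V) := by
        have hRN : R ^ (-(N : ℝ)) * R ^ (N : ℝ) = 1 := by
          rw [← Real.rpow_add hR]; simp
        rw [mul_add, ← hscale]
        congr 1
        · rw [← mul_assoc, ← mul_assoc, ← ENNReal.ofReal_mul (by positivity),
            ← ENNReal.ofReal_mul hc]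
          congr 2; ring
        · rw [← ENNReal.ofReal_mul (by positivity), ← ENNReal.ofReal_mul hd,
            ← ENNReal.ofReal_mul (by positivity)]
          rw [show R ^ (-(N : ℝ)) / T * (d * (V * R ^ (N : ℝ) * (2 * T))) =
            (R ^ (-(N : ℝ)) * R ^ (N : ℝ)) * (2 * d * V) * (T / T) by ring, hRN,
            div_self hT.ne', one_mul, mul_one]
    _ ≤ _ := by gcongr

theorem lintegral_le_energy {R T τ σ : ℝ} {u : E N × ℝ → ℝ} {χ : E N → ℝ} {ζ : ℝ → ℝ}
    (h : IsSpaceTimeCutoff R T τ χ ζ) :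
    ∫⁻ t in Icc (2 * τ) T, (∫⁻ x in Metric.closedBall 0 R, ENNReal.ofReal (u (x, t) ^ σ)) ^ 2 ≤
      energy σ u χ ζ := by
  rw [energy, ← lintegral_indicator measurableSet_Icc]
  refine lintegral_mono fun t => ?_
  by_cases ht : t ∈ Icc (2 * τ) T
  · rw [indicator_of_mem ht, h.eq_one_time t ht.1 ht.2, ENNReal.ofReal_one, one_mul]
    refine pow_le_pow_left' ?_ 2
    rw [← lintegral_indicator Metric.isClosed_closedBall.measurableSet]
    refine lintegral_mono fun x => ?_
    by_cases hx : x ∈ Metric.closedBall (0 : E N) R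
    · rw [indicator_of_mem hx, h.eq_one_space x (by simpa using hx), mul_one]
    · simp [hx]
  · simp [ht]

/-- `∫_0^∞ (∫ u^σ dx)² dt`. -/
def totalEnergy (σ : ℝ) (u : E N × ℝ → ℝ) : ℝ≥0∞ :=
  ∫⁻ t in Ioi (0 : ℝ), (∫⁻ x, ENNReal.ofReal (u (x, t) ^ σ)) ^ 2

/-- Fatou's lemma along R = n+1, τ = 1/(n+1), which exhausts the open half-space. -/
theorem totalEnergy_le_of_tendsto {σ θ : ℝ} (hθ : 0 < θ) {u : E N × ℝ → ℝ} (hu : Measurable u)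
    {c : ℕ → ℝ≥0∞} {c₀ : ℝ≥0∞} (hc : Tendsto c atTop (𝓝 c₀))
    (h : ∀ n : ℕ, ∫⁻ t in Icc (2 * (1 / ((n : ℝ) + 1))) (((n : ℝ) + 1) ^ θ),
      (∫⁻ x in Metric.closedBall 0 ((n : ℝ) + 1), ENNReal.ofReal (u (x, t) ^ σ)) ^ 2 ≤ c n) :
    totalEnergy σ u ≤ c₀ := by
  have hum : Measurable fun z => ENNReal.ofReal (u z ^ σ) := (hu.pow_const σ).ennreal_ofReal
  set S : ℕ → Set ℝ := fun n => Icc (2 * (1 / ((n : ℝ) + 1))) (((n : ℝ) + 1) ^ θ) with hS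
  set G : ℕ → ℝ → ℝ≥0∞ := fun n => indicator (S n) fun t =>
    (∫⁻ x in Metric.closedBall 0 ((n : ℝ) + 1), ENNReal.ofReal (u (x, t) ^ σ)) ^ 2 with hG
  have hn1 : Tendsto (fun n : ℕ => (n : ℝ) + 1) atTop atTop :=
    tendsto_natCast_atTop_atTop.atTop_add tendsto_const_nhds
  have hGm : ∀ n, Measurable (G n) := fun n => by
    have h1 : Measurable fun t => ∫⁻ x in Metric.closedBall 0 ((n : ℝ) + 1),
        ENNReal.ofReal (u (x, t) ^ σ) := hum.lintegral_prod_left'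
    exact (h1.pow_const 2).indicator measurableSet_Icc
  have hlim : ∀ t ∈ Ioi (0 : ℝ), Tendsto (fun n => G n t) atTop
      (𝓝 ((∫⁻ x, ENNReal.ofReal (u (x, t) ^ σ)) ^ 2)) := by
    intro t ht
    have ht0 : (0 : ℝ) < t := ht
    have hcov : AECover (volume : Measure (E N)) atTop
        (fun n : ℕ => Metric.closedBall (0 : E N) ((n : ℝ) + 1)) := aecover_closedBall hn1
    have h1 := hcov.lintegral_tendsto_of_countably_generated
      (f := fun x => ENNReal.ofReal (u (x, t) ^ σ)) (hum.comp measurable_prodMk_right).aemeasurable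
    have h2 := ENNReal.Tendsto.pow (n := 2) h1
    refine h2.congr' ?_
    have a1 : ∀ᶠ n : ℕ in atTop, 2 * (1 / ((n : ℝ) + 1)) ≤ t := by
      have : Tendsto (fun n : ℕ => 2 * (1 / ((n : ℝ) + 1))) atTop (𝓝 (2 * 0)) :=
        tendsto_one_div_add_atTop_nhds_zero_nat.const_mul 2
      rw [mul_zero] at this
      exact (this.eventually (gt_mem_nhds ht0)).mono fun n hn => le_of_lt hn
    have a2 : ∀ᶠ n : ℕ in atTop, t ≤ ((n : ℝ) + 1) ^ θ :=
      ((tendsto_rpow_atTop hθ).comp hn1).eventually_ge_atTop t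
    filter_upwards [a1, a2] with n b1 b2
    have : t ∈ S n := ⟨b1, b2⟩
    simp only [hG, indicator_of_mem this]
  calc totalEnergy σ u = ∫⁻ t in Ioi (0 : ℝ), liminf (fun n => G n t) atTop := by
        rw [totalEnergy]
        exact setLIntegral_congr_fun measurableSet_Ioi fun t ht => (hlim t ht).liminf_eq.symm
    _ ≤ liminf (fun n => ∫⁻ t in Ioi (0 : ℝ), G n t) atTop := lintegral_liminf_le hGm
    _ ≤ liminf c atTop := by
        refine liminf_le_liminf (Eventually.of_forall fun n => ?_)
        refine (setLIntegral_le_lintegral _ _).trans ?_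
        simp only [hG]
        rw [lintegral_indicator measurableSet_Icc]
        exact h n
    _ = c₀ := hc.liminf_eq

end EnergyBounds

/-! ### Finiteness, then vanishing, of the total energy. -/

section Liouville

variable {N : ℕ}

/-- The energy inside `B_R × (2τ,T]`, with `T = R^(2γσ-2N)`, is controlled by lower order terms in
the transition region, at the scale `u ~ R^(-γ)`. -/
def HasCutoffEstimate (m α κ σ γ C : ℝ) (u : E N × ℝ → ℝ) : Prop :=
  ∀ R τ T : ℝ, 1 ≤ R → 0 < τ → T = R ^ (2 * (γ * σ) - 2 * N) →
    ∃ (χ : E N → ℝ) (ζ : ℝ → ℝ), IsSpaceTimeCutoff R T τ χ ζ ∧ energy σ u χ ζ < ∞ ∧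
      ∀ ε : ℝ, 0 < ε → energy σ u χ ζ ≤
        ENNReal.ofReal (C * (R ^ (-(N : ℝ)) / T)) * ∫⁻ z in halfSpace N, ENNReal.ofReal
          (lowerOrder m α ε (R ^ γ * u z) *
            indicator (transitionRegion N R T) (fun z => (χ z.1 * ζ z.2) ^ κ) z)

theorem transitionRegion_subset (R T : ℝ) :
    transitionRegion N R T ⊆ Metric.closedBall 0 (2 * R) ×ˢ Ioc 0 (2 * T) :=
  fun _ hz => ⟨by simpa using hz.1, hz.2.1, hz.2.2.1⟩

theorem measurableSet_transitionRegion (R T : ℝ) : MeasurableSet (transitionRegion N R T) := by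
  have h1 : Measurable fun z : E N × ℝ => ‖z.1‖ := measurable_norm.comp measurable_fst
  have h2 : Measurable fun z : E N × ℝ => z.2 := measurable_snd
  exact (measurableSet_le h1 measurable_const).inter ((measurableSet_lt measurable_const h2).inter
    ((measurableSet_le h2 measurable_const).inter ((measurableSet_le measurable_const h2).union
      (measurableSet_le measurable_const h1))))

theorem lowerOrder_nonneg {m α ε v : ℝ} (hε : 0 ≤ ε) (hv : 0 ≤ v) : 0 ≤ lowerOrder m α ε v := by
  unfold lowerOrder
  positivity

variable {m α σ γ C : ℝ} {u : E N × ℝ → ℝ}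

/-- The lower order terms, weighted by (χζ)^(a/σ), are at most a small multiple of v^σ χζ plus a
constant. The small multiple returns as half of the cutoff energy, which is finite and hence
absorbable, leaving a bound independent of R and τ. -/
theorem HasCutoffEstimate.totalEnergy_lt_top {a : ℝ} (h : HasCutoffEstimate m α (a / σ) σ γ C u)
    (hu : Measurable u) (hu0 : ∀ z, 0 ≤ u z) (hC : 0 < C) (hθ : 0 < 2 * (γ * σ) - 2 * N)
    (ha : 1 ≤ a) (haσ : a < σ) (h1 : 1 - α ≤ a) (h2 : m - 1 - α ≤ a)
    (h3 : (1 + α) * (m - 1) ≤ a) : totalEnergy σ u < ∞ := by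
  obtain ⟨V, hV0, hV⟩ := exists_volume_closedBall N
  -- The factor 1/(2C) turns the estimate into X ≤ X/2 + constant.
  obtain ⟨D, hD, hD'⟩ := exists_lowerOrder_mul_le (m := m) (α := α) (σ := σ) ha haσ h1 h2 h3
    (δ := 1 / (2 * C)) (by positivity)
  have hbound : ∀ R τ T : ℝ, 1 ≤ R → 0 < τ → T = R ^ (2 * (γ * σ) - 2 * N) →
      ∃ (χ : E N → ℝ) (ζ : ℝ → ℝ), IsSpaceTimeCutoff R T τ χ ζ ∧
        energy σ u χ ζ ≤ ENNReal.ofReal (2 * (1 + C * (2 * D * V))) := by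
    intro R τ T hR hτ hT
    have hR0 : 0 < R := by linarith
    have hT0 : 0 < T := by rw [hT]; positivity
    obtain ⟨χ, ζ, hc, hfin, hest⟩ := h R τ T hR hτ hT
    refine ⟨χ, ζ, hc, ?_⟩
    have hζs : ∀ t, t ∉ Ioc 0 (2 * T) → ζ t = 0 := by
      intro t ht
      rcases le_or_gt t 0 with h0 | h0
      · exact hc.eq_zero_of_nonpos t h0
      · exact hc.eq_zero_of_lt t (not_le.1 fun h' => ht ⟨h0, h'⟩)
    have hn := normalised_lintegral_le (M := 1) (c := 1 / (2 * C)) (d := D) hR0 hT one_pos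
      (by positivity) hD.le hV0 (hV R hR0) (w := fun z => χ z.1)
      (F := fun z => lowerOrder m α 1 (R ^ γ * u z) *
        indicator (transitionRegion N R T) (fun z => (χ z.1 * ζ z.2) ^ (a / σ)) z) hu hu0
      (hc.measurable_space.comp measurable_fst) hc.measurable_time hc.nonneg_time hc.le_one_time
      hζs fun z => by
        have hv : 0 ≤ R ^ γ * u z := mul_nonneg (by positivity) (hu0 z)
        have hχζ : 0 ≤ χ z.1 * ζ z.2 := mul_nonneg (hc.nonneg_space _) (hc.nonneg_time _)
        by_cases hz : z ∈ transitionRegion N R T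
        · rw [indicator_of_mem hz, indicator_of_mem (transitionRegion_subset R T hz), mul_one]
          exact hD' _ _ hv hχζ (mul_le_one₀ (hc.le_one_space _) (hc.nonneg_time _)
            (hc.le_one_time _))
        · rw [indicator_of_notMem hz, mul_zero]
          have : 0 ≤ indicator (Metric.closedBall (0 : E N) (2 * R) ×ˢ Ioc 0 (2 * T))
            (fun _ => (1 : ℝ)) z := indicator_nonneg (fun _ _ => zero_le_one) z
          positivity
    change _ ≤ ENNReal.ofReal (1 / (2 * C)) * (ENNReal.ofReal 1 * energy σ u χ ζ +
      ENNReal.ofReal (2 / 1)) + _ at hn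
    have hX := hest 1 one_pos
    rw [ENNReal.ofReal_mul hC.le, mul_assoc] at hX
    have hX2 := hX.trans (mul_le_mul_right hn _)
    set X := energy σ u χ ζ with hXdef
    have hXr : X = ENNReal.ofReal X.toReal := (ENNReal.ofReal_toReal hfin.ne).symm
    have hx0 : 0 ≤ X.toReal := ENNReal.toReal_nonneg
    rw [hXr] at hX2 ⊢
    rw [← ENNReal.ofReal_mul zero_le_one, ← ENNReal.ofReal_add (by positivity) (by positivity),
      ← ENNReal.ofReal_mul (by positivity), ← ENNReal.ofReal_add (by positivity) (by positivity),
      ← ENNReal.ofReal_mul hC.le, ENNReal.ofReal_le_ofReal_iff (by positivity)] at hX2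
    refine ENNReal.ofReal_le_ofReal ?_
    have e : C * (1 / (2 * C) * (1 * X.toReal + 2 / 1) + 2 * D * V) =
        X.toReal / 2 + (1 + C * (2 * D * V)) := by field_simp; ring
    linarith
  refine lt_of_le_of_lt (totalEnergy_le_of_tendsto hθ hu (tendsto_const_nhds
    (x := ENNReal.ofReal (2 * (1 + C * (2 * D * V))))) fun n => ?_) ENNReal.ofReal_lt_top
  obtain ⟨χ, ζ, hc, hle⟩ := hbound ((n : ℝ) + 1) (1 / ((n : ℝ) + 1)) _
    (by linarith [n.cast_nonneg (α := ℝ)]) (by positivity) rfl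
  exact (lintegral_le_energy hc).trans hle

/-- The energy in the transition region tends to zero when the total energy is finite. -/
theorem tendsto_transition_energy {θ : ℝ} (hθ : 0 < θ) (hu : Measurable u)
    (hfin : totalEnergy σ u < ∞) :
    Tendsto (fun n : ℕ => ∫⁻ t, ENNReal.ofReal
        (indicator (Ioc 0 (2 * ((n : ℝ) + 1) ^ θ)) (fun _ => (1 : ℝ)) t) *
        (∫⁻ x, ENNReal.ofReal (u (x, t) ^ σ * indicator
          (transitionRegion N ((n : ℝ) + 1) (((n : ℝ) + 1) ^ θ)) (fun _ => (1 : ℝ)) (x, t))) ^ 2)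
      atTop (𝓝 0) := by
  have hum : Measurable fun z => ENNReal.ofReal (u z ^ σ) := (hu.pow_const σ).ennreal_ofReal
  have hn1 : Tendsto (fun n : ℕ => (n : ℝ) + 1) atTop atTop :=
    tendsto_natCast_atTop_atTop.atTop_add tendsto_const_nhds
  set w : ℕ → E N × ℝ → ℝ := fun n => indicator
    (transitionRegion N ((n : ℝ) + 1) (((n : ℝ) + 1) ^ θ)) (fun _ => (1 : ℝ)) with hw
  set ζ : ℕ → ℝ → ℝ := fun n => indicator (Ioc 0 (2 * ((n : ℝ) + 1) ^ θ)) (fun _ => (1 : ℝ))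
    with hζ
  have hwm : ∀ n, Measurable (w n) := fun n =>
    measurable_const.indicator (measurableSet_transitionRegion _ _)
  have hζm : ∀ n, Measurable (ζ n) := fun n => measurable_const.indicator measurableSet_Ioc
  have hw1 : ∀ n z, w n z ≤ 1 := fun n z => indicator_le_self' (fun _ _ => zero_le_one) z
  have hζ1 : ∀ n t, ζ n t ≤ 1 := fun n t => indicator_le_self' (fun _ _ => zero_le_one) t
  have hwm' : ∀ n, Measurable fun z => ENNReal.ofReal (u z ^ σ * w n z) := fun n =>
    ((hu.pow_const σ).mul (hwm n)).ennreal_ofReal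
  have hg : ∀ n, Measurable fun t => ∫⁻ x, ENNReal.ofReal (u (x, t) ^ σ * w n (x, t)) := fun n =>
    (hwm' n).lintegral_prod_left'
  have hle : ∀ n z, ENNReal.ofReal (u z ^ σ * w n z) ≤ ENNReal.ofReal (u z ^ σ) := by
    intro n z
    by_cases hz : z ∈ transitionRegion N ((n : ℝ) + 1) (((n : ℝ) + 1) ^ θ)
    · simp [hw, hz]
    · simp [hw, hz]
  have hres : ∀ n, ∫⁻ t, ENNReal.ofReal (ζ n t) *
      (∫⁻ x, ENNReal.ofReal (u (x, t) ^ σ * w n (x, t))) ^ 2 =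
      ∫⁻ t in Ioi (0 : ℝ), ENNReal.ofReal (ζ n t) *
      (∫⁻ x, ENNReal.ofReal (u (x, t) ^ σ * w n (x, t))) ^ 2 := by
    intro n
    refine (setLIntegral_eq_of_support_subset fun t ht => ?_).symm
    by_contra h
    refine ht ?_
    have : t ∉ Ioc 0 (2 * ((n : ℝ) + 1) ^ θ) := fun h' => h h'.1
    simp [hζ, this]
  refine Tendsto.congr (fun n => (hres n).symm) ?_
  rw [← lintegral_zero (α := ℝ) (μ := volume.restrict (Ioi (0 : ℝ)))]
  refine tendsto_lintegral_of_dominated_convergence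
    (fun t => (∫⁻ x, ENNReal.ofReal (u (x, t) ^ σ)) ^ 2)
    (fun n => (hζm n).ennreal_ofReal.mul ((hg n).pow_const 2))
    (fun n => Eventually.of_forall fun t => ?_) hfin.ne ?_
  · calc _ ≤ 1 * (∫⁻ x, ENNReal.ofReal (u (x, t) ^ σ * w n (x, t))) ^ 2 := by
          refine mul_le_mul' ?_ le_rfl
          rw [← ENNReal.ofReal_one]
          exact ENNReal.ofReal_le_ofReal (hζ1 n t)
      _ ≤ _ := by
          rw [one_mul]
          exact pow_le_pow_left' (lintegral_mono fun x => hle n (x, t)) 2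
  · have hGm : Measurable fun t => ∫⁻ x, ENNReal.ofReal (u (x, t) ^ σ) := hum.lintegral_prod_left'
    filter_upwards [ae_lt_top (hGm.pow_const 2) hfin.ne, ae_restrict_mem measurableSet_Ioi]
      with t ht _
    have hGt : ∫⁻ x, ENNReal.ofReal (u (x, t) ^ σ) ≠ ∞ := by
      intro h
      rw [h, ENNReal.top_pow two_ne_zero] at ht
      exact ht.ne rfl
    have hin : Tendsto (fun n => ∫⁻ x, ENNReal.ofReal (u (x, t) ^ σ * w n (x, t))) atTop
        (𝓝 0) := by
      rw [← lintegral_zero (α := E N) (μ := volume)]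
      refine tendsto_lintegral_of_dominated_convergence (fun x => ENNReal.ofReal (u (x, t) ^ σ))
        (fun n => (hwm' n).comp measurable_prodMk_right)
        (fun n => Eventually.of_forall fun x => hle n (x, t)) hGt
        (Eventually.of_forall fun x => ?_)
      refine tendsto_const_nhds.congr' ?_
      -- Each fixed (x,t) leaves the transition region once R > ‖x‖ and T > t; this pointwise limit
      -- drives both dominated convergences.
      filter_upwards [((tendsto_rpow_atTop hθ).comp hn1).eventually_gt_atTop t,
        hn1.eventually_gt_atTop ‖x‖] with n b1 b2
      have : (x, t) ∉ transitionRegion N ((n : ℝ) + 1) (((n : ℝ) + 1) ^ θ) := by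
        rintro ⟨-, -, -, h | h⟩
        · exact absurd b1 (not_lt.2 h)
        · exact absurd b2 (not_lt.2 h)
      simp [hw, this]
    have h2 := ENNReal.Tendsto.pow (n := 2) hin
    rw [zero_pow two_ne_zero] at h2
    refine tendsto_of_tendsto_of_tendsto_of_le_of_le tendsto_const_nhds h2 (fun _ => zero_le)
      fun n => ?_
    refine mul_le_of_le_one_left' ?_
    rw [← ENNReal.ofReal_one]
    exact ENNReal.ofReal_le_ofReal (hζ1 n t)

/-- Given η, bound the lower powers by η + B v^σ. The v^σ part is controlled by the transition
energy, which tends to 0 since the total energy is finite, up to a Young remainder of order η. Only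
a multiple of η survives the limit R → ∞. -/
theorem HasCutoffEstimate.totalEnergy_eq_zero {κ : ℝ} (h : HasCutoffEstimate m α κ σ γ C u)
    (hu : Measurable u) (hu0 : ∀ z, 0 ≤ u z) (hκ : 0 ≤ κ) (hC : 0 < C)
    (hθ : 0 < 2 * (γ * σ) - 2 * N) (hσ : 1 < σ) (hα0 : 0 < α) (hα1 : α < 1) (hαm : α < m - 1)
    (h2 : m - 1 - α < σ) (h3 : (1 + α) * (m - 1) < σ) (hfin : totalEnergy σ u < ∞) :
    totalEnergy σ u = 0 := by
  obtain ⟨V, hV0, hV⟩ := exists_volume_closedBall N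
  have key : ∀ η : ℝ, 0 < η → totalEnergy σ u ≤ ENNReal.ofReal (C * (η + 2 * η * V)) := by
    intro η hη
    obtain ⟨ε, B, hε, hB, hle⟩ := exists_lowerOrder_le hσ hα0 hα1 hαm h2 h3 hη
    -- Makes the Young remainder B · 2/M equal to η.
    set M : ℝ := 2 * B / η with hM
    have hM0 : 0 < M := by positivity
    have hlim := tendsto_transition_energy (σ := σ) hθ hu hfin
    have hlim2 := ENNReal.Tendsto.const_mul (a := ENNReal.ofReal C)
      (((ENNReal.Tendsto.const_mul (a := ENNReal.ofReal B)
        ((ENNReal.Tendsto.const_mul (a := ENNReal.ofReal M) hlim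
          (Or.inr ENNReal.ofReal_ne_top)).add_const (ENNReal.ofReal (2 / M)))
        (Or.inr ENNReal.ofReal_ne_top))).add_const (ENNReal.ofReal (2 * η * V)))
      (Or.inr ENNReal.ofReal_ne_top)
    have hval : ENNReal.ofReal C * (ENNReal.ofReal B * (ENNReal.ofReal M * 0 +
        ENNReal.ofReal (2 / M)) + ENNReal.ofReal (2 * η * V)) =
        ENNReal.ofReal (C * (η + 2 * η * V)) := by
      rw [mul_zero, zero_add, ← ENNReal.ofReal_mul hB.le,
        ← ENNReal.ofReal_add (by positivity) (by positivity), ← ENNReal.ofReal_mul hC.le]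
      congr 3
      rw [hM]; field_simp
    rw [hval] at hlim2
    refine totalEnergy_le_of_tendsto hθ hu hlim2 fun n => ?_
    have hR : (1 : ℝ) ≤ (n : ℝ) + 1 := by linarith [n.cast_nonneg (α := ℝ)]
    have hR0 : (0 : ℝ) < (n : ℝ) + 1 := by linarith
    set T : ℝ := ((n : ℝ) + 1) ^ (2 * (γ * σ) - 2 * N) with hT
    obtain ⟨χ, ζ, hc, -, hest⟩ := h ((n : ℝ) + 1) (1 / ((n : ℝ) + 1)) T hR (by positivity) hT
    have hn := normalised_lintegral_le (M := M) (c := B) (d := η) hR0 hT hM0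
      hB.le hη.le hV0 (hV _ hR0)
      -- The cutoff weight is now replaced by 1 on the transition region: nothing is absorbed, since
      -- that energy tends to 0.
      (w := indicator (transitionRegion N ((n : ℝ) + 1) T) (fun _ => (1 : ℝ)))
      (ζ := indicator (Ioc 0 (2 * T)) (fun _ => (1 : ℝ)))
      (F := fun z => lowerOrder m α ε (((n : ℝ) + 1) ^ γ * u z) *
        indicator (transitionRegion N ((n : ℝ) + 1) T) (fun z => (χ z.1 * ζ z.2) ^ κ) z) hu hu0
      (measurable_const.indicator (measurableSet_transitionRegion _ _))
      (measurable_const.indicator measurableSet_Ioc)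
      (fun t => indicator_nonneg (fun _ _ => zero_le_one) t)
      (fun t => indicator_le_self' (fun _ _ => zero_le_one) t)
      (fun t ht => indicator_of_notMem ht _) fun z => by
        have hv : 0 ≤ ((n : ℝ) + 1) ^ γ * u z := mul_nonneg (by positivity) (hu0 z)
        have hχζ : 0 ≤ χ z.1 * ζ z.2 := mul_nonneg (hc.nonneg_space _) (hc.nonneg_time _)
        by_cases hz : z ∈ transitionRegion N ((n : ℝ) + 1) T
        · have hzQ := transitionRegion_subset _ _ hz
          rw [indicator_of_mem hz, indicator_of_mem hzQ, indicator_of_mem hz,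
            indicator_of_mem hzQ.2, mul_one, mul_one, mul_one]
          refine le_trans (mul_le_of_le_one_right (lowerOrder_nonneg hε.le hv) ?_)
            ((hle _ hv).trans (le_of_eq (add_comm _ _)))
          exact Real.rpow_le_one hχζ (mul_le_one₀ (hc.le_one_space _) (hc.nonneg_time _)
            (hc.le_one_time _)) hκ
        · rw [indicator_of_notMem hz, indicator_of_notMem hz, zero_mul, mul_zero, mul_zero,
            mul_zero, zero_add]
          exact mul_nonneg hη.le (indicator_nonneg (fun _ _ => zero_le_one) z)
    refine (lintegral_le_energy hc).trans ((hest ε hε).trans ?_)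
    rw [ENNReal.ofReal_mul hC.le, mul_assoc]
    exact mul_le_mul_right hn _
  have hlim : Tendsto (fun η : ℝ => ENNReal.ofReal (C * (η + 2 * η * V))) (𝓝[>] 0) (𝓝 0) := by
    have hc : Continuous fun η : ℝ => ENNReal.ofReal (C * (η + 2 * η * V)) :=
      ENNReal.continuous_ofReal.comp (by fun_prop)
    have := (hc.tendsto 0).mono_left (nhdsWithin_le_nhds (s := Ioi 0))
    simpa using this
  exact le_antisymm (ge_of_tendsto hlim (by
    filter_upwards [self_mem_nhdsWithin] with η hη using key η hη)) zero_le

theorem ae_eq_zero_of_totalEnergy_eq_zero (hu : Measurable u) (hu0 : ∀ z, 0 ≤ u z)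
    (h : totalEnergy σ u = 0) : ∀ᵐ z ∂(volume.restrict (halfSpace N)), u z = 0 := by
  have hum : Measurable fun z => ENNReal.ofReal (u z ^ σ) := (hu.pow_const σ).ennreal_ofReal
  have hGm : Measurable fun t => ∫⁻ x, ENNReal.ofReal (u (x, t) ^ σ) := hum.lintegral_prod_left'
  have h1 := (lintegral_eq_zero_iff (hGm.pow_const 2)).1 h
  have h2 : ∫⁻ t in Ioi (0 : ℝ), ∫⁻ x, ENNReal.ofReal (u (x, t) ^ σ) = 0 := by
    rw [lintegral_eq_zero_iff hGm]
    filter_upwards [h1] with t ht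
    simpa using ht
  have h3 : ∫⁻ z in halfSpace N, ENNReal.ofReal (u z ^ σ) = 0 := by
    have e : halfSpace N = (univ : Set (E N)) ×ˢ Ioi (0 : ℝ) := by
      ext z; simp [halfSpace]
    rw [e, Measure.volume_eq_prod, ← Measure.prod_restrict, Measure.restrict_univ,
      lintegral_prod_symm' _ hum, h2]
  rw [lintegral_eq_zero_iff hum] at h3
  filter_upwards [h3] with z hz
  have h4 : u z ^ σ ≤ 0 := by simpa using hz
  by_contra h5
  exact absurd h4 (not_le.2 (Real.rpow_pos_of_pos (lt_of_le_of_ne (hu0 z) (Ne.symm h5)) σ))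

end Liouville

/-! ### Measurable representatives and choice of exponents. -/

section Conclusion

variable {N : ℕ} {m p q β : ℝ} {K : E N → ℝ} {u v : E N × ℝ → ℝ}

theorem restrict_halfSpace_eq_prod : (volume : Measure (E N × ℝ)).restrict (halfSpace N) =
    (volume : Measure (E N)).prod (volume.restrict (Ioi (0 : ℝ))) := by
  have e : halfSpace N = (univ : Set (E N)) ×ˢ Ioi (0 : ℝ) := by
    ext z; simp [halfSpace]
  rw [e, Measure.volume_eq_prod, ← Measure.prod_restrict, Measure.restrict_univ]

/-- The convolution at time t sees the whole slice of u, so Fubini is needed: almost every slice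
agrees almost everywhere. -/
theorem nonlocalTerm_congr_ae (h : u =ᵐ[volume.restrict (halfSpace N)] v) :
    nonlocalTerm K p q u =ᵐ[volume.restrict (halfSpace N)] nonlocalTerm K p q v := by
  have h0 := h
  rw [restrict_halfSpace_eq_prod] at h ⊢
  have h1 := Measure.ae_ae_of_ae_prod
    ((Measure.measurePreserving_swap (μ := volume.restrict (Ioi (0 : ℝ)))
      (ν := (volume : Measure (E N)))).quasiMeasurePreserving.ae h)
  have h2 := (Measure.quasiMeasurePreserving_snd (μ := (volume : Measure (E N)))
    (ν := volume.restrict (Ioi (0 : ℝ)))).ae h1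
  filter_upwards [h, h2] with z hz hz2
  have : convPow K p u z = convPow K p v z := by
    refine lintegral_congr_ae ?_
    filter_upwards [hz2] with y hy
    simp only [Prod.swap_prod_mk] at hy
    rw [hy]
  rw [nonlocalTerm, nonlocalTerm, this, hz]

theorem IsCapacityBound.congr_ae {α C : ℝ} (h : IsCapacityBound m α C (nonlocalTerm K p q u) u)
    (huv : u =ᵐ[volume.restrict (halfSpace N)] v) :
    IsCapacityBound m α C (nonlocalTerm K p q v) v := by
  intro χ ζ D W hc l ε hl hε
  refine le_of_eq_of_le ?_ ((h χ ζ D W hc l ε hl hε).trans_eq ?_)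
  · refine lintegral_congr_ae ?_
    filter_upwards [nonlocalTerm_congr_ae (K := K) (p := p) (q := q) huv] with z hz
    rw [hz]
  · congr 1
    refine lintegral_congr_ae ?_
    filter_upwards [huv] with z hz
    rw [hz]

theorem WeakIneq.isInteriorWeakIneq {A : E N → ℝ → E N → E N} {ut : E N × ℝ → ℝ}
    {Du : E N × ℝ → E N} (h : WeakIneq K p q A u ut Du) :
    IsInteriorWeakIneq (nonlocalTerm K p q u) ut (flux A u Du) :=
  fun φ h1 h2 _ h4 => (h φ h1 h2 h4).2.2

theorem WeakIneqByParts.isInteriorWeakIneq {A : E N → ℝ → E N → E N} {u₀ : E N → ℝ}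
    {ut : E N × ℝ → ℝ} {Du : E N × ℝ → E N} (h : WeakIneqByParts K p q A u₀ u Du)
    (ht : IsWeakTimeDeriv u ut) :
    IsInteriorWeakIneq (nonlocalTerm K p q u) ut (flux A u Du) := by
  intro φ h1 h2 h3 h4
  have h0 : ∀ x : E N, φ (x, 0) = 0 := fun x => by
    by_contra hne
    exact lt_irrefl (0 : ℝ) (h3 (subset_tsupport φ (Function.mem_support.2 hne)))
  have := (h φ h1 h2 h4).2.2
  simpa only [h0, mul_zero, integral_zero, neg_zero, zero_sub, ht φ h1 h2 h3, neg_neg] using this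

/-- The critical and subcritical Liouville property, for a measurable representative. -/
theorem IsCapacityBound.ae_eq_zero (hN : 1 ≤ N) (hp : 0 < p) (hq : 0 < q) (hβ : 0 < β)
    (hm : 1 < m) (hpq_upper : p + q ≤ m - 1 + ((N : ℝ) - β + m) / ((N : ℝ) + β))
    (hK : IsAdmissibleKernel β K) (hu : Measurable u) (hu0 : ∀ z, 0 ≤ u z) {α C₀ : ℝ}
    (hα0 : 0 < α) (hα1 : α < 1) (hαm : α < m - 1) (hσ : 1 < (p + q) / 2)
    (hσ2 : m - 1 - α < (p + q) / 2) (hσ3 : (1 + α) * (m - 1) < (p + q) / 2) (hC₀ : 0 < C₀)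
    (hcap : IsCapacityBound m α C₀ (nonlocalTerm K p q u) u)
    (hloc : ∀ C : Set (E N × ℝ), IsCompact C → C ⊆ halfSpace N →
      ∫⁻ z in C, nonlocalTerm K p q u z < ∞) :
    ∀ᵐ z ∂(volume.restrict (halfSpace N)), u z = 0 := by
  have hN0 : (0 : ℝ) ≤ N := N.cast_nonneg
  -- The largest exponent among the lower order terms; 1-α ≤ 1 is covered.
  set a : ℝ := max 1 (max (m - 1 - α) ((1 + α) * (m - 1))) with ha
  have ha1 : 1 ≤ a := le_max_left _ _
  have haσ : a < (p + q) / 2 := max_lt hσ (max_lt hσ2 hσ3)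
  have hκ0 : 0 < a / ((p + q) / 2) := by positivity
  have hκ1 : a / ((p + q) / 2) < 1 := (div_lt_one (by positivity)).2 haσ
  obtain ⟨C, hC, hest⟩ := exists_cutoff_estimate hN hp hq hβ hm hpq_upper hK hu hu0 hκ0 hκ1 hC₀
    hcap hloc
  have hγ : 2 * (((N : ℝ) + β) * ((p + q) / 2)) - 2 * N = ((N : ℝ) + β) * (p + q) - 2 * N := by
    ring
  -- As p+q > 2, the exponent of R in T is positive, so the time intervals exhaust (0,∞).
  have hθ : 0 < 2 * (((N : ℝ) + β) * ((p + q) / 2)) - 2 * N := by nlinarith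
  have hcut : HasCutoffEstimate m α (a / ((p + q) / 2)) ((p + q) / 2) ((N : ℝ) + β) C u :=
    fun R τ T hR hτ hT => hest R τ T hR hτ (by rw [hT, hγ])
  have hfin := hcut.totalEnergy_lt_top hu hu0 hC hθ ha1 haσ (by linarith)
    ((le_max_left _ _).trans (le_max_right _ _)) ((le_max_right _ _).trans (le_max_right _ _))
  exact ae_eq_zero_of_totalEnergy_eq_zero hu hu0
    (hcut.totalEnergy_eq_zero hu hu0 hκ0.le hC hθ hσ hα0 hα1 hαm hσ2 hσ3 hfin)

theorem IsNonnegWeakSolution.ae_eq_zero (hN : 1 ≤ N) (hp : 0 < p) (hq : 0 < q) (hβ : 0 < β)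
    (hm : 1 < m) (hK : IsAdmissibleKernel β K) {A : E N → ℝ → E N → E N}
    (hA : IsWeaklyCoercive m A) (hpq_lower : 2 * max 1 (m - 1) < p + q)
    (hpq_upper : p + q ≤ m - 1 + ((N : ℝ) - β + m) / ((N : ℝ) + β)) {u₀ : E N → ℝ}
    (h : IsNonnegWeakSolution m p q K A u₀ u) :
    ∀ᵐ z ∂(volume.restrict (halfSpace N)), u z = 0 := by
  obtain ⟨hu, ut, Du, hS, hF, hloc, hweak⟩ := h
  have hI : IsInteriorWeakIneq (nonlocalTerm K p q u) ut (flux A u Du) := by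
    rcases hweak with h | h
    · exact h.1.isInteriorWeakIneq
    · exact h.isInteriorWeakIneq hS.weak_time
  obtain ⟨c₀, hc₀, hco⟩ := hA.coercive
  have hσ : max 1 (m - 1) < (p + q) / 2 := by linarith
  obtain ⟨hσ1, hσm⟩ := max_lt_iff.1 hσ
  -- The last entry of the minimum encodes (1+α)(m-1) < σ, possible because m-1 < σ.
  obtain ⟨α, hα0, hα⟩ := exists_between
    (a₁ := (0 : ℝ)) (a₂ := min (min 1 (m - 1)) (((p + q) / 2 - (m - 1)) / (m - 1)))
    (lt_min (lt_min one_pos (by linarith)) (div_pos (by linarith) (by linarith)))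
  obtain ⟨hα', hα3⟩ := lt_min_iff.1 hα
  obtain ⟨hα1, hαm⟩ := lt_min_iff.1 hα'
  rw [lt_div_iff₀ (by linarith)] at hα3
  obtain ⟨C, hC, hcap⟩ := hI.weighted_test hm hS hF hu hc₀
    (by filter_upwards [hu] with z hz using hco _ _ _ hz) hα0 hα1
  have hum := hS.memLp.aestronglyMeasurable
  -- An everywhere measurable and nonnegative representative, for the slice-by-slice Tonelli
  -- arguments.
  set v : E N × ℝ → ℝ := fun z => max (hum.mk u z) 0 with hv
  have huv : u =ᵐ[volume.restrict (halfSpace N)] v := by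
    filter_upwards [hu, hum.ae_eq_mk] with z hz hz2
    rw [hv]
    simp only
    rw [← hz2, max_eq_left hz]
  have hvm : Measurable v := hum.stronglyMeasurable_mk.measurable.max measurable_const
  have hv0 := IsCapacityBound.ae_eq_zero hN hp hq hβ hm hpq_upper hK hvm (fun z => le_max_right _ _)
    hα0 hα1 hαm hσ1 (by linarith) (by linarith) hC (IsCapacityBound.congr_ae hcap huv)
    fun C hC hCs => by
      rw [← lintegral_congr_ae (ae_restrict_of_ae_restrict_of_subset hCs
        (nonlocalTerm_congr_ae huv))]
      exact hloc C hC hCs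
  exact huv.trans hv0

end Conclusion

end QuasilinearNonlocal

end

theorem mainTheorem1 (N : ℕ) (hN : 1 ≤ N) (m p q β : ℝ) (hp : 0 < p) (hq : 0 < q)
    (hβ : 0 < β) (hβm : β < m / 2) (hm : (2 * (N : ℝ) + 1) / ((N : ℝ) + 1) < m)
    (K : QuasilinearNonlocal.E N → ℝ) (hK : QuasilinearNonlocal.IsAdmissibleKernel β K)
    (A : QuasilinearNonlocal.E N → ℝ → QuasilinearNonlocal.E N → QuasilinearNonlocal.E N)
    (hA : QuasilinearNonlocal.IsWeaklyCoercive m A)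
    (hpq_lower : 2 * max 1 (m - 1) < p + q)
    (hpq_upper : p + q ≤ m - 1 + ((N : ℝ) - β + m) / ((N : ℝ) + β))
    (u₀ : QuasilinearNonlocal.E N → ℝ) (hu₀ : LocallyIntegrable u₀ volume)
    (hu₀_nonneg : ∀ᵐ x ∂volume, 0 ≤ u₀ x) :
    ¬ ∃ u : QuasilinearNonlocal.E N × ℝ → ℝ,
      QuasilinearNonlocal.IsNonnegWeakSolution m p q K A u₀ u ∧
      ¬ (∀ᵐ z ∂(volume.restrict (QuasilinearNonlocal.halfSpace N)), u z = 0) := by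
  have hN1 : (1 : ℝ) ≤ N := by exact_mod_cast hN
  -- N+1 ≤ 2N+1, so the lower bound on m exceeds or equals 1.
  have hm1 : 1 < m := lt_of_le_of_lt ((one_le_div (by linarith)).2 (by linarith)) hm
  rintro ⟨u, hu, hne⟩
  exact hne (hu.ae_eq_zero hN hp hq hβ hm1 hK hA hpq_lower hpq_upper)
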